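/- Let $\alpha,\beta,\gamma>-1$, $\delta\in\mathbb R$, and for $0<q<1$ put $a=q^\alpha$, $b=q^\beta$, $c=q^\gamma$, $d=-q^\delta$. Write $(z;q)_k=\prod_{j=0}^{k-1}(1-zq^j)$ for $0\le k\le\infty$, $(z_1,\dots,z_r;q)_k=\prod_i(z_i;q)_k$, $(z)_k=z(z+1)\cdots(z+k-1)$, $[n]_q=\frac{q^n-1}{q-1}$, $\binom{n}{k}_q=\frac{(q;q)_n}{(q;q)_k(q;q)_{n-k}}$. For $p\ne 1$ let $D_p f(x)=\frac{f(px)-f(x)}{(p-1)x}$ for $x\neq0$, $D_pf(0)=f'(0)$, and let $D_p^1,D_p^2$ be the corresponding partial operators in $x$ and $y$. Put $\varrho^{(\alpha,\beta,\gamma)}(x,y)=(1-y)^\alpha(x+1)^\beta(y-x)^\gamma$ and $\mathcal R=\{(x,y):x\le y\le 1,\ -1\le x\le 1\}$. For $N\in\mathbb N_0$ let $$\begin{aligned}\mathcal E_{N,q}u=\;&q(dq-x)(acq^2-x)D_q^1D_{q^{-1}}^1u+q(aq-y)(dq-y)D_q^2D_{q^{-1}}^2u+acq^4(d-bx)(1-y)D_q^1D_q^2u\\&+(dq-x)(aq-y)D_{q^{-1}}^1D_{q^{-1}}^2u+b_1D_q^1u+b_2D_q^2u+q^{2-N}[N]_q\tfrac{1-abcq^{N+2}}{q-1}u,\end{aligned}$$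 $b_1=\frac{q}{q-1}\bigl(q(d-acdq^2+acq(1+bq(x-1)))-x\bigr)$, $b_2=\frac{q}{q-1}\bigl(dq+aq(1-dq+bcq^2(y-1))-y\bigr)$, and $$\begin{aligned}\mathcal E_Nf=\;&(x^2-1)f_{xx}+(y^2-1)f_{yy}+2(x+1)(y-1)f_{xy}+\bigl(x(\alpha+\beta+\gamma+3)+\alpha-\beta+\gamma+1\bigr)f_x\\&+\bigl(y(\alpha+\beta+\gamma+3)+\alpha-\beta-\gamma-1\bigr)f_y-N(\alpha+\beta+\gamma+N+2)f.\end{aligned}$$ Say that polynomials $p_{N,k}$ ($0\le k\le N$, $N\ge0$) form an *orthogonal system of solutions* if, for each $N$, $p_{N,0},\dots,p_{N,N}$ are linearly independent, have total degree $N$, satisfy $\mathcal E_Np_{N,k}=0$, and each is orthogonal on $\mathcal R$ with respect to $\varrho^{(\alpha,\beta,\gamma)}$ to all polynomials of total degree $<N$ (all integrals of polynomials times $p_{N,k}\,\varrho^{(\alpha,\beta,\gamma)}$ converging absolutely). Then: 1. **Equation.** If $f$ is twice continuously differentiable near $(x,y)\in\mathbb R^2$, then $\lim_{q\uparrow1}\mathcal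 E_{N,q}f(x,y)=\mathcal E_Nf(x,y)$. 2. **Weight.** Let $W(x,y)=W(x,y;a,b,c,d;q)=\dfrac{(dq/y,\,c^{-1}x/y,\,x/d,\,y/a,\,y/d;q)_\infty}{y\,(c^{-1}d/y,\,cqy/d,\,x/y,\,bx/d,\,y;q)_\infty}$. If $-1<x<y<1$ and $y>0$, then $\lim_{q\uparrow1}W(x,y)=\varrho^{(\alpha,\beta,\gamma)}(x,y)$. If $-1<x<y\le0$, the same holds along the nodes of the $q$-integral: for any $k(q),l(q)\in\mathbb N_0$ such that $x_q=dq^{l(q)+1}\to x$ and $y_q=dq^{k(q)+1}\to y$ as $q\uparrow1$, the limit $w(q)=\lim_{t\to y_q,\,t\ne y_q}W(x_q,t)$ exists for $q$ close to $1$, and $\lim_{q\uparrow1}w(q)=\varrho^{(\alpha,\beta,\gamma)}(x,y)$. 3. **Monic polynomials.** Let $$\widehat P_{n,m}(x,y)=\frac{(d/b)^n(aq;q)_m(bq;q)_n(dq^{n+1};q)_m(abcq^{m+2}/d;q)_n}{(abcq^{m+n+2};q)_{n+m}}\sum_{i=0}^n\sum_{j=0}^m\frac{(-1)^{i+j}\binom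 ni_q\binom mj_q\,q^{\frac{i(i-2n+1)+j(j-2m+1)}2}(abcq^{m+n+2};q)_{i+j}\,(bx/d;q)_i(y;q)_j}{(aq;q)_j(bq;q)_i(dq^{n+1};q)_j(abcq^{m+2}/d;q)_i},$$ and, with $s=\alpha+\beta+\gamma+m+n+2$, $$\widehat A_{n,m}(x,y)=(-1)^n2^{n+m}\frac{(\alpha+1)_m(\beta+1)_n}{(s)_{n+m}}\sum_{i,j\ge0}\frac{(s)_{i+j}(-n)_i(-m)_j}{(\beta+1)_i(\alpha+1)_j\,i!\,j!}\Bigl(\frac{x+1}2\Bigr)^i\Bigl(\frac{1-y}2\Bigr)^j$$ (a Kampé de Fériet series). Then $\widehat A_{n,m}=x^ny^m+{}$terms of lower total degree, the $\widehat A_{N-k,k}$ form an orthogonal system of solutions, and $\lim_{q\uparrow1}\widehat P_{n,m}(x,y)=\widehat A_{n,m}(x,y)$ for all real $x,y$. 4. **Non-monic polynomials.** For $0\le m\le n$ let $P_{n,m}(x,y)=P_{n-m}(y;a,bcq^{2m+1},dq^m;q)\;y^m(dq/y;q)_m\;P_m(x/y;c,b,d/y;q)$, where $P_k(t;A,B,C;q)={}_3\phi_2(q^{-k},ABq^{k+1},t;\,Aq,Cq;\,q,q)$,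 and $$J_{n,m}(x,y)=(y+1)^m\,{}_2F_1\Bigl({-m,\ \beta+\gamma+m+1\atop\gamma+1};\tfrac{y-x}{y+1}\Bigr)\,{}_2F_1\Bigl({m-n,\ \alpha+\beta+\gamma+m+n+2\atop\alpha+1};\tfrac{1-y}2\Bigr).$$ Both are polynomials in $(x,y)$ (defined by the formulas where no denominator vanishes and extended to all of $\mathbb R^2$). The $J_{N,k}$ form an orthogonal system of solutions and are mutually orthogonal on $\mathcal R$ with respect to $\varrho^{(\alpha,\beta,\gamma)}$; for $y\ne-1$, $$J_{n,m}(x,y)=\frac{m!\,(y+1)^m\,(n-m)!}{(\gamma+1)_m(\alpha+1)_{n-m}}P_m^{(\gamma,\beta)}\Bigl(\frac{2x-y+1}{y+1}\Bigr)P_{n-m}^{(\alpha,\beta+\gamma+2m+1)}(y)$$ with the Jacobi polynomials $P_n^{(A,B)}(t)=\frac{(A+1)_n}{n!}{}_2F_1(-n,n+A+B+1;A+1;\frac{1-t}2)$; and $\lim_{q\uparrow1}P_{n,m}(x,y)=J_{n,m}(x,y)$ for all real $x,y$ (for the literal formulas if $y\ne0,-1$, and for the polynomial extensions everywhere). 5.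 **Rodrigues polynomials.** Let $$\varrho(x,y)=\frac{(y/a,\,x/d,\,dq/y,\,x/(cy),\,y/d;q)_\infty}{(y,\,x/y,\,bx/d,\,dq/(cy),\,cy/d;q)_\infty},$$ $$\tilde P_{n,m}=\frac{\Lambda_{n,m}}{\varrho(x,y)}[D_q^1]^n[D_q^2]^m\bigl[\varrho(x,y)\,x^{2n}y^{2m}(dq/x;q)_n(aq/y;q)_m(x/y;q)_m(cqy/x;q)_n\bigr],$$ where the normalizing constants $\Lambda_{n,m}=\Lambda_{n,m}(q)$ satisfy $\Lambda_{n,m}(q)\to(-1)^{n+m}$ as $q\uparrow1$, and let, for $-1<x<y<1$, $$\tilde A_{n,m}(x,y)=\frac1{\varrho^{(\alpha,\beta,\gamma)}(x,y)}\frac{\partial^{n+m}}{\partial x^n\partial y^m}\bigl[(x+1)^{\beta+n}(1-y)^{\alpha+m}(y-x)^{\gamma+n+m}\bigr].$$ Then $\tilde A_{n,m}$ is a polynomial in $(x,y)$, the $\tilde A_{N-k,k}$ form an orthogonal system of solutions, and $\lim_{q\uparrow1}\tilde P_{n,m}(x,y)=\tilde A_{n,m}(x,y)$: for the literal formula at all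 points with $-1<x<y<1$, $y>0$, $x\ne0$; and, since $\tilde P_{n,m}$ coincides with a polynomial at all points where no division by zero occurs in its formula, for the polynomial extensions at all real $x,y$. -/

import Mathlib

open Filter Topology MeasureTheory

noncomputable section

/-! ### `q`-shifted factorials and basic hypergeometric series -/

/-- The finite `q`-shifted factorial `(z;q)_k`. -/
def qPoch (z q : ℝ) (k : ℕ) : ℝ := ∏ j ∈ Finset.range k, (1 - z * q ^ j)

/-- The infinite `q`-shifted factorial `(z;q)_∞`. -/
def qPochInf (z q : ℝ) : ℝ := ∏' j : ℕ, (1 - z * q ^ j)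

/-- The `q`-number `[n]_q`. -/
def qNum (q : ℝ) (n : ℕ) : ℝ := (q ^ n - 1) / (q - 1)

/-- The `q`-binomial coefficient. -/
def qBinom (q : ℝ) (n k : ℕ) : ℝ := qPoch q q n / (qPoch q q k * qPoch q q (n - k))

/-- The basic hypergeometric series `₃φ₂(a₁,a₂,a₃;b₁,b₂;q,z)`. -/
def phi32 (a₁ a₂ a₃ b₁ b₂ q z : ℝ) : ℝ :=
  ∑' k : ℕ, qPoch a₁ q k * qPoch a₂ q k * qPoch a₃ q k /
    (qPoch b₁ q k * qPoch b₂ q k * qPoch q q k) * z ^ k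

/-! ### Partial `q`-difference operators and the `q`-difference equation -/

/-- The `q`-derivative, equal to the ordinary derivative at the origin. With `q⁻¹` in place of `q`
it is the operator `D_{q⁻¹} f(x) = q (f(x) - f(x/q)) / ((q-1) x)`. -/
def qDiff (q : ℝ) (f : ℝ → ℝ) (x : ℝ) : ℝ :=
  if x = 0 then deriv f 0 else (f (q * x) - f x) / ((q - 1) * x)

/-- The partial `q`-derivative in the first variable. -/
def qDiff₁ (q : ℝ) (f : ℝ → ℝ → ℝ) : ℝ → ℝ → ℝ := fun x y => qDiff q (fun s => f s y) x

/-- The partial `q`-derivative in the second variable. -/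
def qDiff₂ (q : ℝ) (f : ℝ → ℝ → ℝ) : ℝ → ℝ → ℝ := fun x y => qDiff q (fun t => f x t) y

/-- The left-hand side, at the point `(x, y)`, of the second-order partial `q`-difference equation
(with eigenvalue `λ_N`) of the bivariate big `q`-Jacobi polynomials, applied to `u`. -/
def qEquation (N : ℕ) (a b c d q : ℝ) (u : ℝ → ℝ → ℝ) (x y : ℝ) : ℝ :=
  let a11 := √q * (d * q - x) * (a * c * q ^ 2 - x)
  let a22 := √q * (a * q - y) * (d * q - y)
  let a12a := a * c * q ^ 4 * (d - b * x) * (1 - y)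
  let a12d := (d * q - x) * (a * q - y)
  let b1 := q * (q * (d - a * c * d * q ^ 2 + a * c * q * (1 + b * q * (-1 + x))) - x) / (-1 + q)
  let b2 := q * (d * q + a * q * (1 - d * q + b * c * q ^ 2 * (-1 + y)) - y) / (-1 + q)
  let lam := q ^ (2 - (N : ℤ)) * qNum q N * ((1 - a * b * c * q ^ (N + 2)) / (q - 1))
  a11 * √q * qDiff₁ q (qDiff₁ q⁻¹ u) x y + a22 * √q * qDiff₂ q (qDiff₂ q⁻¹ u) x y
    + a12a * qDiff₁ q (qDiff₂ q u) x y + a12d * qDiff₁ q⁻¹ (qDiff₂ q⁻¹ u) x y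
    + b1 * qDiff₁ q u x y + b2 * qDiff₂ q u x y + lam * u x y

/-- The left-hand side, at the point `(x, y)`, of the Appell-type partial differential equation
with eigenvalue index `N`, applied to `f`. -/
def appellEquation (N : ℕ) (α β γ : ℝ) (f : ℝ → ℝ → ℝ) (x y : ℝ) : ℝ :=
  (x ^ 2 - 1) * deriv (fun s => deriv (fun r => f r y) s) x
    + (y ^ 2 - 1) * deriv (fun t => deriv (fun r => f x r) t) y
    + 2 * ((x + 1) * (y - 1)) * deriv (fun s => deriv (fun t => f s t) y) x
    + (x * (α + β + γ + 3) + α - β + γ + 1) * deriv (fun s => f s y) x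
    + (y * (α + β + γ + 3) + α - β - γ - 1) * deriv (fun t => f x t) y
    - N * (α + β + γ + N + 2) * f x y

/-! ### Weights -/

/-- The weight function `W(x,y;a,b,c,d;q)` of the bivariate big `q`-Jacobi polynomials. -/
def qWeight (x y a b c d q : ℝ) : ℝ :=
  (qPochInf (d * q / y) q * qPochInf (c⁻¹ * x / y) q * qPochInf (x / d) q *
      qPochInf (y / a) q * qPochInf (y / d) q) /
    (y * (qPochInf (c⁻¹ * d / y) q * qPochInf (c * q * y / d) q * qPochInf (x / y) q *
      qPochInf (b * x / d) q * qPochInf y q))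

/-- The numerator of the weight `ϱ`. -/
def rhoNum (x y a c d q : ℝ) : ℝ :=
  qPochInf (y / a) q * qPochInf (x / d) q * qPochInf (d * q / y) q *
    qPochInf (x / (c * y)) q * qPochInf (y / d) q

/-- The denominator of the weight `ϱ`. -/
def rhoDen (x y b c d q : ℝ) : ℝ :=
  qPochInf y q * qPochInf (x / y) q * qPochInf (b * x / d) q *
    qPochInf (d * q / (c * y)) q * qPochInf (c * y / d) q

/-- The weight `ϱ(x,y)` solving the `q`-Pearson system; it is `W` times the constant `-d/c`. -/
def qRho (x y a b c d q : ℝ) : ℝ := rhoNum x y a c d q / rhoDen x y b c d q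

/-- The limiting weight `(1-y)^α (x+1)^β (y-x)^γ`. -/
def jacobiWeight (α β γ x y : ℝ) : ℝ := (1 - y) ^ α * (x + 1) ^ β * (y - x) ^ γ

/-- The closed triangle on which the limiting polynomials are orthogonal. -/
def triangle : Set (ℝ × ℝ) := {p | p.1 ≤ p.2 ∧ p.2 ≤ 1 ∧ -1 ≤ p.1 ∧ p.1 ≤ 1}

/-! ### The three families of bivariate big `q`-Jacobi polynomials -/

/-- The monic family `P̂_{n,m}(x,y;a,b,c,d;q)`. The exponent of `q` is an exact integer division. -/
def monicBigQJacobi (n m : ℕ) (x y a b c d q : ℝ) : ℝ :=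
  (d / b) ^ n * qPoch (a * q) q m * qPoch (b * q) q n * qPoch (d * q ^ (n + 1)) q m *
      qPoch (a * b * c * q ^ (m + 2) / d) q n / qPoch (a * b * c * q ^ (m + n + 2)) q (n + m) *
    ∑ i ∈ Finset.range (n + 1), ∑ j ∈ Finset.range (m + 1),
      (-1) ^ (i + j) * qBinom q n i * qBinom q m j *
        q ^ (((i : ℤ) * (i - 2 * n + 1) + (j : ℤ) * (j - 2 * m + 1)) / 2) *
        qPoch (a * b * c * q ^ (m + n + 2)) q (i + j) /
        (qPoch (a * q) q j * qPoch (b * q) q i * qPoch (d * q ^ (n + 1)) q j *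
          qPoch (a * b * c * q ^ (m + 2) / d) q i) *
        qPoch (b * x / d) q i * qPoch y q j

/-- The univariate big `q`-Jacobi polynomial `P_m(t;A,B,C;q)`. -/
def bigQJacobi (m : ℕ) (t A B C q : ℝ) : ℝ :=
  phi32 (q ^ m)⁻¹ (A * B * q ^ (m + 1)) t (A * q) (C * q) q q

/-- The non-monic family `P_{n,m}(x,y;a,b,c,d;q)`, `0 ≤ m ≤ n`. -/
def bivBigQJacobi (n m : ℕ) (x y a b c d q : ℝ) : ℝ :=
  bigQJacobi (n - m) y a (b * c * q ^ (2 * m + 1)) (d * q ^ m) q *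
    (y ^ m * qPoch (d * q / y) q m) * bigQJacobi m (x / y) c b (d / y) q

/-- The Rodrigues family `P̃_{n,m}(x,y;a,b,c,d;q)` with normalizing constant `Λ`. -/
def rodriguesBigQJacobi (n m : ℕ) (Λ x y a b c d q : ℝ) : ℝ :=
  Λ / qRho x y a b c d q *
    (qDiff₁ q)^[n] ((qDiff₂ q)^[m] (fun s t =>
      qRho s t a b c d q * s ^ (2 * n) * t ^ (2 * m) * qPoch (d * q / s) q n *
        qPoch (a * q / t) q m * qPoch (s / t) q m * qPoch (c * q * t / s) q n)) x y

/-- The points at which every factor in the Rodrigues formula is meaningful: no division by zero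
occurs in it. These points are dense in the plane. -/
def RodriguesRegular (n m : ℕ) (x y a b c d q : ℝ) : Prop :=
  x ≠ 0 ∧ y ≠ 0 ∧ rhoNum x y a c d q ≠ 0 ∧
    ∀ i ≤ n, ∀ j ≤ m, rhoDen (q ^ i * x) (q ^ j * y) b c d q ≠ 0

/-! ### The limiting families -/

/-- The Pochhammer symbol (rising factorial) `(z)_k`. -/
def poch (z : ℝ) (k : ℕ) : ℝ := (ascPochhammer ℝ k).eval z

/-- The Kampé de Fériet series, with joint parameters `a` over `b`, parameters `c` over `d` for the
first variable and `c'` over `d'` for the second one. -/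
def kampeDeFeriet (a c c' b d d' : List ℝ) (x y : ℝ) : ℝ :=
  ∑' p : ℕ × ℕ,
    ((a.map (poch · (p.1 + p.2))).prod * (c.map (poch · p.1)).prod * (c'.map (poch · p.2)).prod) /
      ((b.map (poch · (p.1 + p.2))).prod * (d.map (poch · p.1)).prod *
        (d'.map (poch · p.2)).prod) *
      (x ^ p.1 * y ^ p.2 / ((p.1.factorial : ℝ) * (p.2.factorial : ℝ)))

/-- The monic bivariate Jacobi polynomials `Â_{n,m}`. -/
def monicJacobi (n m : ℕ) (α β γ x y : ℝ) : ℝ :=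
  (-1) ^ n * 2 ^ (n + m) * (poch (α + 1) m * poch (β + 1) n /
      poch (α + β + γ + m + n + 2) (n + m)) *
    kampeDeFeriet [α + β + γ + m + n + 2] [-(n : ℝ)] [-(m : ℝ)] [] [β + 1] [α + 1]
      ((x + 1) / 2) ((1 - y) / 2)

/-- The univariate Jacobi polynomial `P_n^{(a,b)}`. -/
def jacobiP (n : ℕ) (a b x : ℝ) : ℝ :=
  poch (a + 1) n / n.factorial * ₂F₁ (-(n : ℝ)) (n + a + b + 1) (a + 1) ((1 - x) / 2)

/-- The non-monic family `J_{n,m}`, for `y ≠ -1`. -/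
def jacobiJ (n m : ℕ) (α β γ x y : ℝ) : ℝ :=
  (y + 1) ^ m * ₂F₁ (-(m : ℝ)) (β + γ + m + 1) (γ + 1) ((y - x) / (y + 1)) *
    ₂F₁ ((m : ℝ) - n) (α + β + γ + m + n + 2) (α + 1) ((1 - y) / 2)

/-- The Rodrigues family `Ã_{n,m}`, in the interior of the triangle. -/
def rodriguesJacobi (n m : ℕ) (α β γ x y : ℝ) : ℝ :=
  1 / jacobiWeight α β γ x y *
    iteratedDeriv n (fun s => iteratedDeriv m (fun t =>
      (s + 1) ^ (β + n) * (1 - t) ^ (α + m) * (t - s) ^ (γ + n + m)) y) x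

/-- The value at `(x, y)` of a real polynomial in two variables. -/
def evalPt (p : MvPolynomial (Fin 2) ℝ) (x y : ℝ) : ℝ := MvPolynomial.eval ![x, y] p

/-- `P N 0, …, P N N` (for every `N`) are linearly independent polynomials of total degree `N`, each
of them solves the Appell-type equation with index `N`, and each of them is orthogonal, with
respect to the weight on the triangle, to all polynomials of total degree less than `N`. -/
def IsOrthogonalSolutionSystem (α β γ : ℝ) (P : ℕ → ℕ → MvPolynomial (Fin 2) ℝ) : Prop :=
  ∀ N : ℕ, LinearIndependent ℝ (fun k : Fin (N + 1) => P N k) ∧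
    ∀ k ≤ N, (P N k).totalDegree = N ∧
      (∀ x y : ℝ, appellEquation N α β γ (evalPt (P N k)) x y = 0) ∧
      ∀ R : MvPolynomial (Fin 2) ℝ,
        IntegrableOn (fun z : ℝ × ℝ => evalPt (P N k) z.1 z.2 * evalPt R z.1 z.2 *
          jacobiWeight α β γ z.1 z.2) triangle ∧
        (R.totalDegree < N →
          ∫ z in triangle, evalPt (P N k) z.1 z.2 * evalPt R z.1 z.2 *
            jacobiWeight α β γ z.1 z.2 = 0)

end

/-! # Limits of bivariate big `q`-Jacobi polynomials -/

noncomputable section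

open MvPolynomial (C)

/-! ### Limits of finite `q`-shifted factorials -/

/-! All limits in `q` rest on two asymptotic facts. A finite factorial `(q^r;q)_k` vanishes to order
`k`, and `(q^r;q)_k / (1-q)^k → (r)_k`; a finite factorial whose base tends to `z₀` tends to
`(1-z₀)^k`. For infinite products only quotients `(q^r z;q)_∞ / (z;q)_∞` occur, and these tend to
`(1-z₀)^(-r)` when `z → z₀ < 1` (`tendsto_qPochInf_ratio`). For `0 ≤ r ≤ 1` this is a squeeze:
weighted AM-GM compares each factor with a geometric mean of two neighbouring factors of `(z;q)_∞`,
and the product of these means collapses. The functional equation `(z;q)_∞ = (1-z)(qz;q)_∞` extends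
the result to all real `r`. The weight is a product of five such quotients. At the nodes with `y ≤
0` it has the form 0/0, and the common infinite factors are cancelled first.

The equation converges because `q`-difference quotients converge to derivatives (Peano expansion for
the pure second differences, two mean value theorems for the mixed ones) and because the singular
coefficients are difference quotients in `q` at `q = 1`.

On the limit side, put `u = x+1`, `v = 1-y`, `w = y-x`, so that `u+v+w = 2`. With `ϱ` the weight,
the differential operator is `-ϱ⁻¹[∂x(uwϱ ∂x) + ∂y(vwϱ ∂y) + (∂x+∂y)(uvϱ(∂x+∂y))]`, hence symmetric
for the weighted integral (`jacobiInt_appellOp_symm`). It preserves total degree, acts on `u^i v^j`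
as `(i+j)(i+j+α+β+γ+2)` modulo lower degree (`appellOp_uv`), and these eigenvalues are distinct for
distinct degrees. So any nonzero polynomial solution has degree `N` and is orthogonal to all lower
degrees. Each family therefore needs only the eigenvalue equation and linear independence
(`isOrthogonalSolutionSystem_of`).

The monic family solves the coefficient recurrences in the basis `u^i v^j`, and its top-degree
coefficients give independence. The non-monic family separates into a homogeneous factor in `(x+1,
y+1)` and a factor in `y`; it also consists of eigenfunctions of a second symmetric operator acting
in `x` alone, which gives independence and mutual orthogonality. For the Rodrigues family, each
differentiation intertwines the operators with shifted parameters, and integration by parts against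
monomials gives independence.

The `q`-families converge term by term in the first two cases. For the Rodrigues family the
`q`-Pearson relations turn every application of `D_q` into an operation on polynomials whose limit
is, up to sign, the classical one (`exists_qRaiseX`, `exists_qRaiseY`). The signs multiply to
`(-1)^(n+m)`, which the normalization removes. -/

theorem qPoch_succ (z q : ℝ) (k : ℕ) : qPoch z q (k + 1) = qPoch z q k * (1 - z * q ^ k) :=
  Finset.prod_range_succ _ _

theorem poch_succ (z : ℝ) (k : ℕ) : poch z (k + 1) = poch z k * (z + k) := by
  simp [poch, ascPochhammer_succ_eval]

theorem poch_zero (z : ℝ) : poch z 0 = 1 := by simp [poch]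

theorem poch_one (k : ℕ) : poch 1 k = k.factorial := by
  induction k with
  | zero => simp [poch_zero]
  | succ k ih => rw [poch_succ, ih, Nat.factorial_succ]; push_cast; ring

theorem poch_pos {z : ℝ} (hz : 0 < z) (k : ℕ) : 0 < poch z k := ascPochhammer_pos k z hz

theorem eventually_mem_Ioo : ∀ᶠ q : ℝ in 𝓝[<] 1, 0 < q ∧ q < 1 := by
  filter_upwards [Ioo_mem_nhdsLT (show (0 : ℝ) < 1 by norm_num)] with q hq using hq

theorem tendsto_id_nhdsLT_one : Tendsto (fun q : ℝ => q) (𝓝[<] 1) (𝓝 1) :=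
  tendsto_id.mono_left nhdsWithin_le_nhds

theorem tendsto_rpow_nhdsLT_one (r : ℝ) : Tendsto (fun q : ℝ => q ^ r) (𝓝[<] 1) (𝓝 1) := by
  have h : ContinuousAt (fun q : ℝ => q ^ r) 1 :=
    Real.continuousAt_rpow_const 1 r (Or.inl one_ne_zero)
  simpa using h.tendsto.mono_left nhdsWithin_le_nhds

theorem tendsto_pow_nhdsLT_one (k : ℕ) : Tendsto (fun q : ℝ => q ^ k) (𝓝[<] 1) (𝓝 1) := by
  simpa using tendsto_id_nhdsLT_one.pow k

theorem tendsto_zpow_nhdsLT_one (k : ℤ) : Tendsto (fun q : ℝ => q ^ k) (𝓝[<] 1) (𝓝 1) := by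
  simpa using tendsto_id_nhdsLT_one.zpow₀ k (Or.inl one_ne_zero)

theorem hasDerivAt_rpow_one (r : ℝ) : HasDerivAt (fun q : ℝ => q ^ r) r 1 := by
  simpa using Real.hasDerivAt_rpow_const (x := 1) (p := r) (Or.inl one_ne_zero)

/-- The difference quotient at `1` of a function of `q`. -/
theorem tendsto_div_sub_one {G : ℝ → ℝ} {G' : ℝ} (hG : HasDerivAt G G' 1) :
    Tendsto (fun q => (G q - G 1) / (q - 1)) (𝓝[<] 1) (𝓝 G') := by
  have h := hasDerivAt_iff_tendsto_slope.1 hG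
  refine ((h.mono_left (nhdsWithin_mono 1 fun q hq => ne_of_lt hq)).congr fun q => ?_)
  simp [slope_def_field]

theorem tendsto_one_sub_rpow_div (r : ℝ) :
    Tendsto (fun q : ℝ => (1 - q ^ r) / (1 - q)) (𝓝[<] 1) (𝓝 r) := by
  refine (tendsto_div_sub_one (hasDerivAt_rpow_one r)).congr fun q => ?_
  rw [Real.one_rpow, ← neg_sub 1 q, ← neg_sub 1 (q ^ r), neg_div_neg_eq]

/-- Each factor `1 - q^(r+j)` is `(1-q)(r+j+o(1))`, so `k` factors are balanced by `(1-q)^k`. The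
base is only required to be eventually a power of `q`, since exponents can be merged only for `q >
0`. -/
theorem tendsto_qPoch_div {z : ℝ → ℝ} {r : ℝ} (hz : ∀ᶠ q in 𝓝[<] 1, z q = q ^ r) (k : ℕ) :
    Tendsto (fun q : ℝ => qPoch (z q) q k / (1 - q) ^ k) (𝓝[<] 1) (𝓝 (poch r k)) := by
  induction k with
  | zero => simp [qPoch, poch_zero]
  | succ k ih =>
    rw [poch_succ]
    refine (ih.mul (tendsto_one_sub_rpow_div (r + k))).congr' ?_
    filter_upwards [eventually_mem_Ioo, hz] with q hq hz
    rw [qPoch_succ, pow_succ, hz, Real.rpow_add hq.1, Real.rpow_natCast, mul_div_mul_comm]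

theorem tendsto_qPoch {z : ℝ → ℝ} {z₀ : ℝ} (hz : Tendsto z (𝓝[<] 1) (𝓝 z₀)) (k : ℕ) :
    Tendsto (fun q : ℝ => qPoch (z q) q k) (𝓝[<] 1) (𝓝 ((1 - z₀) ^ k)) := by
  induction k with
  | zero => simp [qPoch]
  | succ k ih =>
    simp_rw [qPoch_succ]
    simpa [pow_succ] using ih.mul ((hz.mul (tendsto_pow_nhdsLT_one k)).const_sub 1)

/-! ### Limits of `q`-difference quotients -/

theorem tendsto_mul_nhdsNE {x : ℝ} (hx : x ≠ 0) :
    Tendsto (fun p : ℝ => p * x) (𝓝[≠] 1) (𝓝[≠] x) := by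
  refine tendsto_nhdsWithin_iff.2 ⟨?_, ?_⟩
  · have : Tendsto (fun p : ℝ => p * x) (𝓝 1) (𝓝 (1 * x)) := tendsto_id.mul_const x
    rw [one_mul] at this
    exact this.mono_left nhdsWithin_le_nhds
  · filter_upwards [self_mem_nhdsWithin] with p hp h
    exact hp (mul_right_cancel₀ hx (by simpa using h))

theorem tendsto_inv_nhdsNE_one : Tendsto (fun p : ℝ => p⁻¹) (𝓝[≠] 1) (𝓝[≠] 1) := by
  refine tendsto_nhdsWithin_iff.2 ⟨?_, ?_⟩
  · have : Tendsto (fun p : ℝ => p⁻¹) (𝓝 1) (𝓝 1⁻¹) := tendsto_inv₀ one_ne_zero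
    rw [inv_one] at this
    exact this.mono_left nhdsWithin_le_nhds
  · filter_upwards [self_mem_nhdsWithin] with p hp h
    exact hp (by simpa using h)

theorem eventually_ne_one_and_pos : ∀ᶠ p : ℝ in 𝓝[≠] 1, p ≠ 1 ∧ 0 < p := by
  filter_upwards [self_mem_nhdsWithin, nhdsWithin_le_nhds (Ioi_mem_nhds zero_lt_one)] with p h1 h2
  exact ⟨h1, h2⟩

/-- The quotient is the slope of `f` between `x` and `px`. The limit is taken on both sides of `1`,
because `D_{q⁻¹}` uses the parameter `q⁻¹ > 1`. -/
theorem tendsto_qDiff {f : ℝ → ℝ} {x : ℝ} (hf : DifferentiableAt ℝ f x) :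
    Tendsto (fun p => qDiff p f x) (𝓝[≠] 1) (𝓝 (deriv f x)) := by
  by_cases hx : x = 0
  · subst hx
    simp [qDiff]
  have h := (hasDerivAt_iff_tendsto_slope.1 hf.hasDerivAt).comp (tendsto_mul_nhdsNE hx)
  refine h.congr fun p => ?_
  simp only [qDiff, hx, if_false, Function.comp, slope_def_field]
  congr 1
  ring

/-- The second order Taylor quotient converges to half of the second derivative. -/
theorem tendsto_taylor_quotient {f : ℝ → ℝ} {x : ℝ} (hf : ∀ᶠ z in 𝓝 x, DifferentiableAt ℝ f z)
    (hf' : DifferentiableAt ℝ (deriv f) x) :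
    Tendsto (fun z => (f z - f x - deriv f x * (z - x)) / (z - x) ^ 2) (𝓝[≠] x)
      (𝓝 (deriv (deriv f) x / 2)) := by
  refine HasDerivAt.lhopital_zero_nhdsNE (f' := fun z => deriv f z - deriv f x)
    (g' := fun z => 2 * (z - x)) ?_ ?_ ?_ ?_ ?_ ?_
  · filter_upwards [nhdsWithin_le_nhds hf] with z hz
    have := (hz.hasDerivAt.sub_const (f x)).sub
      (((hasDerivAt_id z).sub_const x).const_mul (deriv f x))
    exact this.congr_deriv (by simp)
  · filter_upwards with z
    exact (((hasDerivAt_id z).sub_const x).pow 2).congr_deriv (by simp)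
  · filter_upwards [self_mem_nhdsWithin] with z hz
    exact mul_ne_zero two_ne_zero (sub_ne_zero.2 hz)
  · have h1 : ContinuousAt f x := hf.self_of_nhds.continuousAt
    have : ContinuousAt (fun z => f z - f x - deriv f x * (z - x)) x := by fun_prop
    simpa using this.tendsto.mono_left nhdsWithin_le_nhds
  · have : ContinuousAt (fun z : ℝ => (z - x) ^ 2) x := by fun_prop
    simpa using this.tendsto.mono_left nhdsWithin_le_nhds
  · have h := (hasDerivAt_iff_tendsto_slope.1 hf'.hasDerivAt).div_const 2
    refine h.congr fun z => ?_
    rw [slope_def_field, div_div, mul_comm (z - x)]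

/-- In the expansion `f(z) = f(x) + f'(x)(z-x) + S(z)(z-x)²` the terms of order at most one cancel,
and the second difference is exactly `S(qx) + q⁻¹ S(q⁻¹x)`, where `S → f''(x)/2`. -/
theorem tendsto_qDiff_qDiff_inv {f : ℝ → ℝ} {x : ℝ}
    (hf : ∀ᶠ z in 𝓝 x, DifferentiableAt ℝ f z) (hf' : DifferentiableAt ℝ (deriv f) x) :
    Tendsto (fun q => qDiff q (qDiff q⁻¹ f) x) (𝓝[≠] 1) (𝓝 (deriv (deriv f) x)) := by
  obtain ⟨S, hS, key⟩ : ∃ S : ℝ → ℝ, Tendsto S (𝓝[≠] x) (𝓝 (deriv (deriv f) x / 2)) ∧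
      ∀ z, f z = f x + deriv f x * (z - x) + S z * (z - x) ^ 2 := by
    refine ⟨_, tendsto_taylor_quotient hf hf', fun z => ?_⟩
    by_cases hz : z = x
    · simp [hz]
    · have : z - x ≠ 0 := sub_ne_zero.2 hz
      field_simp
      ring
  have hinv : Tendsto (fun p : ℝ => p⁻¹) (𝓝[≠] 1) (𝓝 1) :=
    tendsto_inv_nhdsNE_one.mono_right nhdsWithin_le_nhds
  -- At the origin the outer operator is the ordinary derivative at `0` of `D_{q⁻¹} f`. It is
  -- computed from the same expansion and equals `(f''(0)/2)(q⁻¹ + 1)`.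
  by_cases hx : x = 0
  · subst hx
    have hd : ∀ᶠ q : ℝ in 𝓝[≠] 1,
        deriv (deriv f) 0 / 2 * (q⁻¹ + 1) = qDiff q (qDiff q⁻¹ f) 0 := by
      filter_upwards [eventually_ne_one_and_pos] with q hq
      have hq0 : q ≠ 0 := hq.2.ne'
      have hq1 : q⁻¹ - 1 ≠ 0 := sub_ne_zero.2 (by simpa using hq.1)
      rw [qDiff, if_pos rfl]
      refine (HasDerivAt.deriv ?_).symm
      rw [hasDerivAt_iff_tendsto_slope]
      have h1 : Tendsto (fun s : ℝ => q⁻¹ * s) (𝓝[≠] 0) (𝓝[≠] 0) := by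
        refine tendsto_nhdsWithin_iff.2 ⟨?_, ?_⟩
        · have : Tendsto (fun s : ℝ => q⁻¹ * s) (𝓝 0) (𝓝 (q⁻¹ * 0)) := tendsto_id.const_mul _
          rw [mul_zero] at this
          exact this.mono_left nhdsWithin_le_nhds
        · filter_upwards [self_mem_nhdsWithin] with s hs
          exact mul_ne_zero (inv_ne_zero hq0) hs
      have h2 := ((((hS.comp h1).mul_const (q⁻¹ ^ 2)).sub hS).div_const (q⁻¹ - 1))
      have h3 : (deriv (deriv f) 0 / 2 * q⁻¹ ^ 2 - deriv (deriv f) 0 / 2) / (q⁻¹ - 1) =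
          deriv (deriv f) 0 / 2 * (q⁻¹ + 1) := by
        rw [div_eq_iff hq1]; ring
      rw [h3] at h2
      refine h2.congr' ?_
      filter_upwards [self_mem_nhdsWithin] with s hs
      have hs0 : s ≠ 0 := hs
      rw [slope_def_field, qDiff, qDiff, if_neg hs0, if_pos rfl, key (q⁻¹ * s), key s]
      simp only [Function.comp, sub_zero]
      generalize S (q⁻¹ * s) = A
      generalize S s = B
      have hq3 : 1 - q ≠ 0 := sub_ne_zero.2 hq.1.symm
      have e : q⁻¹ - 1 = (1 - q) / q := by field_simp
      rw [e]
      field_simp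
      ring
    refine Tendsto.congr' hd ?_
    have := (hinv.add_const 1).const_mul (deriv (deriv f) 0 / 2)
    convert this using 2
    ring
  · have h1 : Tendsto (fun q : ℝ => S (q * x)) (𝓝[≠] 1) (𝓝 (deriv (deriv f) x / 2)) :=
      hS.comp (tendsto_mul_nhdsNE hx)
    have h2 : Tendsto (fun q : ℝ => S (q⁻¹ * x)) (𝓝[≠] 1) (𝓝 (deriv (deriv f) x / 2)) :=
      hS.comp ((tendsto_mul_nhdsNE hx).comp tendsto_inv_nhdsNE_one)
    have h3 := h1.add (h2.mul hinv)
    have h4 : deriv (deriv f) x / 2 + deriv (deriv f) x / 2 * 1 = deriv (deriv f) x := by ring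
    rw [h4] at h3
    refine h3.congr' ?_
    filter_upwards [eventually_ne_one_and_pos] with q hq
    have hq0 : q ≠ 0 := hq.2.ne'
    have hq1 : q⁻¹ - 1 ≠ 0 := sub_ne_zero.2 (by simpa using hq.1)
    have hq2 : q - 1 ≠ 0 := sub_ne_zero.2 hq.1
    have hq3 : 1 - q ≠ 0 := sub_ne_zero.2 hq.1.symm
    simp only [qDiff, hx, if_false, mul_ne_zero hq0 hx, inv_mul_cancel_left₀ hq0]
    rw [key (q * x), key (q⁻¹ * x)]
    generalize S (q * x) = A
    generalize S (q⁻¹ * x) = B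
    have e : q⁻¹ - 1 = (1 - q) / q := by field_simp
    rw [e]
    field_simp
    ring

/-- The mixed second difference quotient converges to the mixed derivative. -/
theorem mixed_difference_quotient {f g h : ℝ → ℝ → ℝ} {x y : ℝ}
    (hg : ∀ᶠ z : ℝ × ℝ in 𝓝 (x, y), HasDerivAt (fun t => f z.1 t) (g z.1 z.2) z.2)
    (hh : ∀ᶠ z : ℝ × ℝ in 𝓝 (x, y), HasDerivAt (fun s => g s z.2) (h z.1 z.2) z.1)
    (hc : ContinuousAt (Function.uncurry h) (x, y)) {ε : ℝ} (hε : 0 < ε) :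
    ∃ r > 0, ∀ s t : ℝ, |s - x| < r → |t - y| < r → s ≠ x → t ≠ y →
      |(f s t - f s y - (f x t - f x y)) / ((s - x) * (t - y)) - h x y| ≤ ε := by
  have hc' := Metric.continuousAt_iff.1 hc ε hε
  obtain ⟨r₁, hr₁, h1⟩ := hc'
  obtain ⟨r₂, hr₂, h2⟩ := Metric.eventually_nhds_iff.1 (hg.and hh)
  have box : ∀ {s t r : ℝ}, |s - x| < r → |t - y| < r → dist (s, t) (x, y) < r := by
    intro s t r hs ht
    rw [Prod.dist_eq]
    exact max_lt (by simpa [Real.dist_eq] using hs) (by simpa [Real.dist_eq] using ht)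
  refine ⟨min r₁ r₂, lt_min hr₁ hr₂, fun s t hs ht hsx hty => ?_⟩
  have between : ∀ {a b c : ℝ}, c ∈ Set.uIcc a b → |c - a| ≤ |b - a| := fun {a b c} hc => by
    simpa [abs_sub_comm] using Set.abs_sub_left_of_mem_uIcc hc
  have mvt : ∀ (k k' : ℝ → ℝ) (a b : ℝ), a ≠ b → (∀ c ∈ Set.uIcc a b, HasDerivAt k (k' c) c) →
      ∃ c ∈ Set.uIcc a b, k b - k a = k' c * (b - a) := by
    intro k k' a b hab hk
    rcases lt_or_gt_of_ne hab with hab | hab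
    · rw [Set.uIcc_of_le hab.le] at hk ⊢
      obtain ⟨c, hc, e⟩ := exists_hasDerivAt_eq_slope k k' hab
        (fun c hc => (hk c hc).continuousAt.continuousWithinAt)
        (fun c hc => hk c (Set.Ioo_subset_Icc_self hc))
      exact ⟨c, Set.Ioo_subset_Icc_self hc, by rw [e, div_mul_cancel₀ _ (sub_ne_zero.2 hab.ne')]⟩
    · rw [Set.uIcc_of_ge hab.le] at hk ⊢
      obtain ⟨c, hc, e⟩ := exists_hasDerivAt_eq_slope k k' hab
        (fun c hc => (hk c hc).continuousAt.continuousWithinAt)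
        (fun c hc => hk c (Set.Ioo_subset_Icc_self hc))
      refine ⟨c, Set.Ioo_subset_Icc_self hc, ?_⟩
      rw [e, ← neg_sub a b, mul_neg, div_mul_cancel₀ _ (sub_ne_zero.2 hab.ne')]
      ring
  have hx0 : |x - x| < min r₁ r₂ := by simpa using ⟨hr₁, hr₂⟩
  -- The double difference is the increment in `t` of `f(s,·) - f(x,·)`. One mean value theorem in
  -- `t` and a second one in `s` express it as `h ξ η` times the area.
  obtain ⟨η, hη, e1⟩ := mvt (fun t => f s t - f x t) (fun t => g s t - g x t) y t hty.symm
    (fun c hc => by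
      have hc' : |c - y| < r₂ := (between hc).trans_lt (ht.trans_le (min_le_right _ _))
      exact (h2 (box (hs.trans_le (min_le_right _ _)) hc')).1.sub
        (h2 (box (hx0.trans_le (min_le_right _ _)) hc')).1)
  have hη' : |η - y| < min r₁ r₂ := (between hη).trans_lt ht
  obtain ⟨ξ, hξ, e2⟩ := mvt (fun s => g s η) (fun s => h s η) x s hsx.symm
    (fun c hc => by
      have hc' : |c - x| < r₂ := (between hc).trans_lt (hs.trans_le (min_le_right _ _))
      exact (h2 (box hc' (hη'.trans_le (min_le_right _ _)))).2)
  have hξ' : |ξ - x| < min r₁ r₂ := (between hξ).trans_lt hs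
  have e3 : f s t - f s y - (f x t - f x y) = h ξ η * ((s - x) * (t - y)) := by
    have e1' : (f s t - f x t) - (f s y - f x y) = (g s η - g x η) * (t - y) := e1
    have e2' : g s η - g x η = h ξ η * (s - x) := e2
    rw [e2'] at e1'
    linear_combination e1'
  rw [e3, mul_div_cancel_right₀ _ (mul_ne_zero (sub_ne_zero.2 hsx) (sub_ne_zero.2 hty))]
  have := h1 (box (hξ'.trans_le (min_le_left _ _)) (hη'.trans_le (min_le_left _ _)))
  rw [Real.dist_eq] at this
  exact this.le

/-- Off the axes this is the mixed difference quotient at `(px, py)`. On the axes one or both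
operators degenerate to ordinary derivatives and need a separate argument. -/
theorem tendsto_qDiff_mixed {f : ℝ → ℝ → ℝ} {x y : ℝ}
    (hf : ContDiffAt ℝ 2 (Function.uncurry f) (x, y)) :
    Tendsto (fun p => qDiff₁ p (qDiff₂ p f) x y) (𝓝[≠] 1)
      (𝓝 (deriv (fun s => deriv (fun t => f s t) y) x)) := by
  set F := Function.uncurry f with hF
  have hev : ∀ᶠ z in 𝓝 (x, y), ContDiffAt ℝ 2 F z := hf.eventually (by simp)
  have hdF : ∀ᶠ z in 𝓝 (x, y), DifferentiableAt ℝ F z := by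
    filter_upwards [hev] with z hz using hz.differentiableAt (by norm_num)
  have hd2 : ∀ z, ContDiffAt ℝ 2 F z → ContDiffAt ℝ 1 (fun z => fderiv ℝ F z (0, 1)) z :=
    fun z hz => (hz.fderiv_right (m := 1) (by norm_num)).clm_apply contDiffAt_const
  have lineY : ∀ z : ℝ × ℝ, HasDerivAt (fun t : ℝ => (z.1, t)) ((0 : ℝ), (1 : ℝ)) z.2 := fun z =>
    (hasDerivAt_const z.2 z.1).prodMk (hasDerivAt_id z.2)
  have lineX : ∀ z : ℝ × ℝ, HasDerivAt (fun s : ℝ => (s, z.2)) ((1 : ℝ), (0 : ℝ)) z.1 := fun z =>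
    (hasDerivAt_id z.1).prodMk (hasDerivAt_const z.1 z.2)
  have hg : ∀ᶠ z : ℝ × ℝ in 𝓝 (x, y),
      HasDerivAt (fun t => f z.1 t) (deriv (fun t => f z.1 t) z.2) z.2 ∧
      deriv (fun t => f z.1 t) z.2 = fderiv ℝ F z (0, 1) := by
    filter_upwards [hdF] with z hz
    have h : HasDerivAt (fun t => f z.1 t) (fderiv ℝ F z (0, 1)) z.2 :=
      HasFDerivAt.comp_hasDerivAt (f := fun t : ℝ => (z.1, t)) z.2
        (show HasFDerivAt F (fderiv ℝ F z) (z.1, z.2) from hz.hasFDerivAt) (lineY z)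
    exact ⟨h.deriv ▸ h, h.deriv⟩
  have hh : ∀ᶠ z : ℝ × ℝ in 𝓝 (x, y),
      HasDerivAt (fun s => deriv (fun t => f s t) z.2)
        (fderiv ℝ (fun z => fderiv ℝ F z (0, 1)) z (1, 0)) z.1 := by
    filter_upwards [hev, eventually_eventually_nhds.2 hg] with z hz hgz
    have hd := (hd2 z hz).differentiableAt (by norm_num)
    have h : HasDerivAt (fun s => fderiv ℝ F (s, z.2) (0, 1))
        (fderiv ℝ (fun z => fderiv ℝ F z (0, 1)) z (1, 0)) z.1 :=
      HasFDerivAt.comp_hasDerivAt (l := fun z => fderiv ℝ F z (0, 1))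
        (f := fun s : ℝ => (s, z.2)) z.1
        (show HasFDerivAt _ _ (z.1, z.2) from hd.hasFDerivAt) (lineX z)
    refine h.congr_of_eventuallyEq ?_
    have : Tendsto (fun s : ℝ => (s, z.2)) (𝓝 z.1) (𝓝 (z.1, z.2)) :=
      (lineX z).continuousAt.tendsto
    filter_upwards [this.eventually hgz] with s hs using hs.2
  set h : ℝ → ℝ → ℝ := fun s t => fderiv ℝ (fun z => fderiv ℝ F z (0, 1)) (s, t) (1, 0)
  have hc : ContinuousAt (Function.uncurry h) (x, y) := by
    have := ((hd2 _ hf).fderiv_right (m := 0) (by norm_num)).continuousAt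
    exact this.clm_apply continuousAt_const
  have hxy : HasDerivAt (fun s => deriv (fun t => f s t) y) (h x y) x := hh.self_of_nhds
  -- On `y = 0` the inner operator is already `∂/∂y`, so only a one-variable limit remains.
  by_cases hy : y = 0
  · subst hy
    have := tendsto_qDiff hxy.differentiableAt
    simpa [qDiff₁, qDiff₂, qDiff] using this
  rw [hxy.deriv, Metric.tendsto_nhds]
  intro ε hε
  obtain ⟨r, hr, H⟩ := mixed_difference_quotient (hg.mono fun _ h => h.1) hh hc (half_pos hε)
  have near : ∀ w : ℝ, ∀ᶠ p : ℝ in 𝓝[≠] 1, |p * w - w| < r := by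
    intro w
    have : ContinuousAt (fun p : ℝ => p * w - w) 1 := by fun_prop
    have := this.tendsto.mono_left (nhdsWithin_le_nhds (s := {1}ᶜ))
    filter_upwards [this.eventually (Metric.ball_mem_nhds _ hr)] with p hp
    simpa [Real.dist_eq] using hp
  have hdx : ∀ᶠ t in 𝓝 y, DifferentiableAt ℝ (fun s => f s t) x := by
    have : Tendsto (fun t : ℝ => (x, t)) (𝓝 y) (𝓝 (x, y)) := (lineY (x, y)).continuousAt.tendsto
    filter_upwards [this.eventually hdF] with t ht
    exact (HasFDerivAt.comp_hasDerivAt (f := fun s : ℝ => (s, t)) x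
        (show HasFDerivAt F _ (x, t) from ht.hasFDerivAt) (lineX (x, t))).differentiableAt
  have hpy : Tendsto (fun p : ℝ => p * y) (𝓝[≠] 1) (𝓝 y) :=
    (tendsto_mul_nhdsNE hy).mono_right nhdsWithin_le_nhds
  filter_upwards [near x, near y, eventually_ne_one_and_pos, hpy.eventually hdx] with p hpx hpy hp hd
  have hp1 : p - 1 ≠ 0 := sub_ne_zero.2 hp.1
  have hyne : p * y ≠ y := fun e => hp.1 (mul_right_cancel₀ hy (by simpa using e))
  rw [Real.dist_eq]
  refine lt_of_le_of_lt ?_ (half_lt_self hε)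
  -- On `x = 0` the outer operator is a derivative in `s` of a difference quotient in `t`. The bound
  -- on double difference quotients is uniform in `s`, so it survives the limit `s → 0`.
  by_cases hx : x = 0
  · subst hx
    have hk : HasDerivAt (fun s => (f s (p * y) - f s y) / ((p - 1) * y))
        (deriv (fun s => (f s (p * y) - f s y) / ((p - 1) * y)) 0) 0 :=
      ((hd.sub hdx.self_of_nhds).div_const _).hasDerivAt
    have e : qDiff₁ p (qDiff₂ p f) 0 y = deriv (fun s => (f s (p * y) - f s y) / ((p - 1) * y)) 0 := by
      simp [qDiff₁, qDiff₂, qDiff, hy]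
    rw [e]
    refine le_of_tendsto (((hasDerivAt_iff_tendsto_slope.1 hk).sub_const (h 0 y)).abs) ?_
    filter_upwards [self_mem_nhdsWithin, nhdsWithin_le_nhds (Metric.ball_mem_nhds 0 hr)] with s hs hs'
    have hs0 : s ≠ 0 := hs
    have := H s (p * y) (by simpa [Real.dist_eq] using hs') hpy hs hyne
    refine (congrArg (fun z => |z - h 0 y|) ?_).trans_le this
    rw [slope_def_field]
    have e2 : p * y - y = (p - 1) * y := by ring
    rw [e2, sub_zero, ← sub_div, div_div, mul_comm s]
  · have hxne : p * x ≠ x := fun e => hp.1 (mul_right_cancel₀ hx (by simpa using e))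
    have := H (p * x) (p * y) hpx hpy hxne hyne
    refine (congrArg (fun z => |z - h x y|) ?_).trans_le this
    simp only [qDiff₁, qDiff₂, qDiff, hx, hy, if_false]
    have e1 : p * x - x = (p - 1) * x := by ring
    have e2 : p * y - y = (p - 1) * y := by ring
    rw [e1, e2, ← sub_div, div_div, mul_comm ((p - 1) * x)]

/-! ### The limit of the partial `q`-difference equation -/

theorem tendsto_qEquation (α β γ δ : ℝ) (N : ℕ) (f : ℝ → ℝ → ℝ) (x y : ℝ)
    (hf : ContDiffAt ℝ 2 (Function.uncurry f) (x, y)) :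
    Tendsto (fun q : ℝ => qEquation N (q ^ α) (q ^ β) (q ^ γ) (-(q ^ δ)) q f x y)
        (𝓝[<] 1) (𝓝 (appellEquation N α β γ f x y)) := by
  have hlt : (𝓝[<] (1 : ℝ)) ≤ 𝓝[≠] 1 := nhdsWithin_mono 1 fun q hq => ne_of_lt hq
  have hinv : Tendsto (fun p : ℝ => p⁻¹) (𝓝[<] 1) (𝓝[≠] 1) := tendsto_inv_nhdsNE_one.mono_left hlt
  have h1 : ContDiffAt ℝ 2 (fun s => f s y) x :=
    ContDiffAt.comp (g := Function.uncurry f) (f := fun s : ℝ => (s, y)) x hf (by fun_prop)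
  have h2 : ContDiffAt ℝ 2 (fun t => f x t) y :=
    ContDiffAt.comp (g := Function.uncurry f) (f := fun t : ℝ => (x, t)) y hf (by fun_prop)
  have diff : ∀ {k : ℝ → ℝ} {z : ℝ}, ContDiffAt ℝ 2 k z →
      (∀ᶠ w in 𝓝 z, DifferentiableAt ℝ k w) ∧ DifferentiableAt ℝ (deriv k) z := by
    intro k z hk
    constructor
    · filter_upwards [hk.eventually (by simp)] with w hw using hw.differentiableAt (by norm_num)
    · have : ContDiffAt ℝ 1 (fun w => fderiv ℝ k w 1) z :=
        (hk.fderiv_right (m := 1) (by norm_num)).clm_apply contDiffAt_const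
      simpa using this.differentiableAt (by norm_num)
  have hxx := (tendsto_qDiff_qDiff_inv (diff h1).1 (diff h1).2).mono_left hlt
  have hyy := (tendsto_qDiff_qDiff_inv (diff h2).1 (diff h2).2).mono_left hlt
  have hx := (tendsto_qDiff (diff h1).1.self_of_nhds).mono_left hlt
  have hy := (tendsto_qDiff (diff h2).1.self_of_nhds).mono_left hlt
  have hm := tendsto_qDiff_mixed hf
  have hm1 := hm.mono_left hlt
  have hm2 := hm.comp hinv
  have ta := tendsto_rpow_nhdsLT_one α
  have tb := tendsto_rpow_nhdsLT_one β
  have tc := tendsto_rpow_nhdsLT_one γ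
  have td := (tendsto_rpow_nhdsLT_one δ).neg
  have tq := tendsto_id_nhdsLT_one
  have tq2 := tendsto_pow_nhdsLT_one 2
  have tq4 := tendsto_pow_nhdsLT_one 4
  have ts : Tendsto (fun q : ℝ => √q) (𝓝[<] 1) (𝓝 1) := by
    have := (Real.continuous_sqrt.tendsto 1).comp tq
    rwa [Real.sqrt_one] at this
  have da := hasDerivAt_rpow_one α
  have db := hasDerivAt_rpow_one β
  have dc := hasDerivAt_rpow_one γ
  have dd := (hasDerivAt_rpow_one δ).neg
  have dq := hasDerivAt_id (1 : ℝ)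
  have dq2 := hasDerivAt_pow 2 (1 : ℝ)
  have A11 : Tendsto (fun q : ℝ => √q * (-(q ^ δ) * q - x) * (q ^ α * q ^ γ * q ^ 2 - x) * √q)
      (𝓝[<] 1) (𝓝 (x ^ 2 - 1)) := by
    have := ((ts.mul ((td.mul tq).sub_const x)).mul (((ta.mul tc).mul tq2).sub_const x)).mul ts
    convert this using 2
    ring
  have A22 : Tendsto (fun q : ℝ => √q * (q ^ α * q - y) * (-(q ^ δ) * q - y) * √q)
      (𝓝[<] 1) (𝓝 (y ^ 2 - 1)) := by
    have := ((ts.mul ((ta.mul tq).sub_const y)).mul ((td.mul tq).sub_const y)).mul ts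
    convert this using 2
    ring
  -- Both mixed coefficients have the limit `(x+1)(y-1)`, and both mixed differences tend to the
  -- same mixed derivative; this is the source of the factor 2.
  have A12 : Tendsto (fun q : ℝ => q ^ α * q ^ γ * q ^ 4 * (-(q ^ δ) - q ^ β * x) * (1 - y))
      (𝓝[<] 1) (𝓝 ((x + 1) * (y - 1))) := by
    have := ((((ta.mul tc).mul tq4).mul (td.sub (tb.mul_const x))).mul_const (1 - y))
    convert this using 2
    ring
  have A12' : Tendsto (fun q : ℝ => (-(q ^ δ) * q - x) * (q ^ α * q - y))
      (𝓝[<] 1) (𝓝 ((x + 1) * (y - 1))) := by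
    have := ((td.mul tq).sub_const x).mul ((ta.mul tq).sub_const y)
    convert this using 2
    ring
  -- The numerator vanishes at `q = 1`, so the coefficient is a difference quotient there and its
  -- limit is the derivative of the numerator. The same holds for `B2` and for both factors of the
  -- eigenvalue term.
  have B1 : Tendsto (fun q : ℝ => q * (q * (-(q ^ δ) - q ^ α * q ^ γ * -(q ^ δ) * q ^ 2 +
      q ^ α * q ^ γ * q * (1 + q ^ β * q * (-1 + x))) - x) / (-1 + q))
      (𝓝[<] 1) (𝓝 (x * (α + β + γ + 3) + α - β + γ + 1)) := by
    have hD := (dq.mul ((dd.sub (((da.mul dc).mul dd).mul dq2)).add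
      (((da.mul dc).mul dq).mul (((db.mul dq).mul_const (-1 + x)).const_add 1)))).sub_const x
    have := tq.mul (tendsto_div_sub_one hD)
    refine (this.congr fun q => ?_).trans_eq (congrArg 𝓝 ?_)
    · simp; ring
    · simp; ring
  have B2 : Tendsto (fun q : ℝ => q * (-(q ^ δ) * q + q ^ α * q * (1 - -(q ^ δ) * q +
      q ^ β * q ^ γ * q ^ 2 * (-1 + y)) - y) / (-1 + q))
      (𝓝[<] 1) (𝓝 (y * (α + β + γ + 3) + α - β - γ - 1)) := by
    have hD := ((dd.mul dq).add ((da.mul dq).mul (((dd.mul dq).const_sub 1).add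
      (((db.mul dc).mul dq2).mul_const (-1 + y))))).sub_const y
    have := tq.mul (tendsto_div_sub_one hD)
    refine (this.congr fun q => ?_).trans_eq (congrArg 𝓝 ?_)
    · simp; ring
    · simp; ring
  have Lam : Tendsto (fun q : ℝ => q ^ (2 - (N : ℤ)) * qNum q N *
      ((1 - q ^ α * q ^ β * q ^ γ * q ^ (N + 2)) / (q - 1)))
      (𝓝[<] 1) (𝓝 (-(N * (α + β + γ + N + 2)))) := by
    have l1 : Tendsto (fun q : ℝ => qNum q N) (𝓝[<] 1) (𝓝 N) := by
      have := tendsto_div_sub_one (hasDerivAt_pow N (1 : ℝ))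
      simpa [qNum] using this
    have l2 := tendsto_div_sub_one
      ((((da.mul db).mul dc).mul (hasDerivAt_pow (N + 2) (1 : ℝ))).const_sub 1)
    refine ((((tendsto_zpow_nhdsLT_one (2 - (N : ℤ))).mul l1).mul l2).congr
      fun q => ?_).trans_eq (congrArg 𝓝 ?_)
    · simp
    · simp; ring
  have := (((((A11.mul hxx).add (A22.mul hyy)).add (A12.mul hm1)).add (A12'.mul hm2)).add
    (B1.mul hx)).add (B2.mul hy) |>.add (Lam.mul_const (f x y))
  refine (this.congr fun q => ?_).trans_eq (congrArg 𝓝 ?_)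
  · simp only [qEquation, qDiff₁, qDiff₂, Function.comp]
  · simp only [appellEquation]
    ring

/-! ### Infinite `q`-shifted factorials -/

section qPochInf

variable {q : ℝ}

theorem summable_mul_pow (hq : 0 < q ∧ q < 1) (z : ℝ) : Summable fun j : ℕ => ‖-(z * q ^ j)‖ := by
  have := (summable_geometric_of_lt_one hq.1.le hq.2).mul_left |z|
  refine this.congr fun j => ?_
  rw [norm_neg, norm_mul, Real.norm_eq_abs, Real.norm_eq_abs, abs_of_pos (pow_pos hq.1 j)]

theorem multipliable_qPoch (hq : 0 < q ∧ q < 1) (z : ℝ) :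
    Multipliable fun j : ℕ => 1 - z * q ^ j := by
  simpa [sub_eq_add_neg] using multipliable_one_add_of_summable (summable_mul_pow hq z)

theorem tendsto_qPoch_atTop (hq : 0 < q ∧ q < 1) (z : ℝ) :
    Tendsto (fun k => qPoch z q k) atTop (𝓝 (qPochInf z q)) :=
  (multipliable_qPoch hq z).hasProd.tendsto_prod_nat

theorem qPochInf_split (hq : 0 < q ∧ q < 1) (z : ℝ) (k : ℕ) :
    qPochInf z q = qPoch z q k * qPochInf (z * q ^ k) q := by
  have h : Multipliable fun j : ℕ => 1 - z * q ^ (j + k) := by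
    simpa [pow_add, mul_assoc, mul_comm, mul_left_comm] using multipliable_qPoch hq (z * q ^ k)
  rw [qPochInf, ← Multipliable.prod_mul_tprod_nat_mul' (f := fun j => 1 - z * q ^ j) h, qPoch,
    qPochInf]
  congr 2
  funext j
  rw [pow_add]
  ring

theorem qPochInf_step (hq : 0 < q ∧ q < 1) (z : ℝ) :
    qPochInf z q = (1 - z) * qPochInf (q * z) q := by
  rw [qPochInf_split hq z 1]
  simp [qPoch, mul_comm z q]

theorem qPochInf_ne_zero (hq : 0 < q ∧ q < 1) {z : ℝ} (hz : ∀ j : ℕ, z * q ^ j ≠ 1) :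
    qPochInf z q ≠ 0 := by
  have := tprod_one_add_ne_zero_of_summable (f := fun j : ℕ => -(z * q ^ j))
    (fun j h => hz j (by linarith)) (summable_mul_pow hq z)
  simpa [qPochInf, sub_eq_add_neg] using this

theorem one_sub_mul_pow_pos (hq : 0 < q ∧ q < 1) {z : ℝ} (hz : z < 1) (j : ℕ) :
    0 < 1 - z * q ^ j := by
  have h0 := pow_pos hq.1 j
  have h1 : q ^ j ≤ 1 := pow_le_one₀ hq.1.le hq.2.le
  rcases le_or_gt z 0 with h | h <;> nlinarith

theorem qPoch_pos (hq : 0 < q ∧ q < 1) {z : ℝ} (hz : z < 1) (k : ℕ) : 0 < qPoch z q k :=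
  Finset.prod_pos fun j _ => one_sub_mul_pow_pos hq hz j

theorem qPochInf_pos (hq : 0 < q ∧ q < 1) {z : ℝ} (hz : z < 1) : 0 < qPochInf z q := by
  refine lt_of_le_of_ne (ge_of_tendsto' (tendsto_qPoch_atTop hq z) fun k => (qPoch_pos hq hz k).le)
    (qPochInf_ne_zero hq fun j h => ?_).symm
  have := one_sub_mul_pow_pos hq hz j
  linarith

/-- Near `z` the terms are dominated by `(|z|+1) q^j`, so the partial products converge locally
uniformly. -/
theorem continuous_qPochInf (hq : 0 < q ∧ q < 1) : Continuous fun z => qPochInf z q := by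
  rw [continuous_iff_continuousAt]
  intro z
  have h := Summable.hasProdLocallyUniformlyOn_nat_one_add (f := fun (j : ℕ) (w : ℝ) => -(w * q ^ j))
    (K := Metric.ball z 1) Metric.isOpen_ball
    ((summable_geometric_of_lt_one hq.1.le hq.2).mul_left (|z| + 1))
    (Eventually.of_forall fun j w hw => by
      have hj := pow_pos hq.1 j
      rw [norm_neg, norm_mul, Real.norm_eq_abs, Real.norm_eq_abs, abs_of_pos hj]
      have : |w - z| < 1 := by simpa [Real.dist_eq] using hw
      have h2 : |w| ≤ |z| + 1 := by
        have := abs_sub_abs_le_abs_sub w z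
        linarith
      exact mul_le_mul_of_nonneg_right h2 hj.le)
    (fun j => by fun_prop)
  have hc : ContinuousOn (fun w => ∏' j : ℕ, (1 + -(w * q ^ j))) (Metric.ball z 1) :=
    h.continuousOn (Frequently.of_forall fun s => by fun_prop)
  have := hc.continuousAt (Metric.ball_mem_nhds z one_pos)
  simpa [qPochInf, sub_eq_add_neg] using this

end qPochInf

/-! ### The asymptotics of quotients of infinite `q`-shifted factorials -/

/-- This is Hölder's inequality for the two-term sums `1 + u` and `1 + uq` with weights `1-r` and
`r`, obtained from two weighted AM-GM inequalities. With `u = -z q^j` it bounds one factor of `(q^r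
z;q)_∞` for `z ≤ 0`. -/
theorem one_add_mul_rpow_le {u q r : ℝ} (hu : 0 ≤ u) (hq : 0 < q) (hr : 0 ≤ r) (hr1 : r ≤ 1) :
    1 + u * q ^ r ≤ (1 + u) ^ (1 - r) * (1 + u * q) ^ r := by
  have hv : 0 ≤ u * q := by positivity
  have h1 := Real.geom_mean_le_arith_mean2_weighted (sub_nonneg.2 hr1) hr
    (show 0 ≤ 1 / (1 + u) by positivity) (show 0 ≤ 1 / (1 + u * q) by positivity) (by ring)
  have h2 := Real.geom_mean_le_arith_mean2_weighted (sub_nonneg.2 hr1) hr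
    (show 0 ≤ u / (1 + u) by positivity) (show 0 ≤ u * q / (1 + u * q) by positivity) (by ring)
  rw [Real.div_rpow (by positivity) (by positivity), Real.div_rpow (by positivity) (by positivity)]
    at h1 h2
  have e1 : u ^ (1 - r) * (u * q) ^ r = u * q ^ r := by
    rw [Real.mul_rpow hu hq.le, ← mul_assoc, ← Real.rpow_add_of_nonneg hu (sub_nonneg.2 hr1) hr]
    simp
  have p1 : 0 < (1 + u) ^ (1 - r) := by positivity
  have p2 : 0 < (1 + u * q) ^ r := by positivity
  have key : (1 + u * q ^ r) / ((1 + u) ^ (1 - r) * (1 + u * q) ^ r) ≤ 1 := by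
    have e : (1 + u * q ^ r) / ((1 + u) ^ (1 - r) * (1 + u * q) ^ r) =
        1 ^ (1 - r) / (1 + u) ^ (1 - r) * (1 ^ r / (1 + u * q) ^ r) +
        u ^ (1 - r) / (1 + u) ^ (1 - r) * ((u * q) ^ r / (1 + u * q) ^ r) := by
      rw [div_mul_div_comm, div_mul_div_comm, e1, Real.one_rpow, Real.one_rpow]
      ring
    rw [e]
    refine (add_le_add h1 h2).trans (le_of_eq ?_)
    field_simp
    ring
  rwa [div_le_one (by positivity)] at key

/-- Weighted AM-GM is used twice: the left side is at most `1 - ((1-r)u + r u q)`, and the bracket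
is at least `u q^r`. It is the one-factor bound for `0 ≤ z < 1`, with the opposite direction. -/
theorem le_one_sub_mul_rpow {u q r : ℝ} (hu : 0 ≤ u) (hu1 : u < 1) (hq : 0 < q) (hq1 : q < 1)
    (hr : 0 ≤ r) (hr1 : r ≤ 1) :
    (1 - u) ^ (1 - r) * (1 - u * q) ^ r ≤ 1 - u * q ^ r := by
  have hv : 0 ≤ u * q := by positivity
  have hv1 : u * q < 1 := by nlinarith
  have h1 := Real.geom_mean_le_arith_mean2_weighted (sub_nonneg.2 hr1) hr
    (show 0 ≤ 1 - u by linarith) (show 0 ≤ 1 - u * q by linarith) (by ring)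
  have h2 := Real.geom_mean_le_arith_mean2_weighted (sub_nonneg.2 hr1) hr hu hv (by ring)
  have e1 : u ^ (1 - r) * (u * q) ^ r = u * q ^ r := by
    rw [Real.mul_rpow hu hq.le, ← mul_assoc, ← Real.rpow_add_of_nonneg hu (sub_nonneg.2 hr1) hr]
    simp
  rw [e1] at h2
  nlinarith

section

variable {q z r : ℝ}

/-- The product tends to `(z;q)_∞^(1-r) (qz;q)_∞^r`, and `(z;q)_∞ = (1-z)(qz;q)_∞` collapses this to
a single infinite product. -/
theorem tendsto_qPoch_geom (hq : 0 < q ∧ q < 1) (hz : z < 1) :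
    Tendsto (fun k => ∏ j ∈ Finset.range k, ((1 - z * q ^ j) ^ (1 - r) *
      (1 - z * q ^ j * q) ^ r)) atTop (𝓝 (qPochInf z q * (1 - z) ^ (-r))) := by
  have hzq : q * z < 1 := by simpa [mul_comm] using one_sub_mul_pow_pos hq hz 1
  have h1 : 0 < 1 - z := by linarith
  have p := qPochInf_pos hq hzq
  have e : qPochInf z q * (1 - z) ^ (-r) =
      qPochInf z q ^ (1 - r) * qPochInf (q * z) q ^ r := by
    rw [qPochInf_step hq z, Real.mul_rpow h1.le p.le, mul_assoc (_ ^ (1 - r)), ← Real.rpow_add p,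
      sub_add_cancel, Real.rpow_one, sub_eq_add_neg 1 r, Real.rpow_add h1, Real.rpow_one]
    ring
  rw [e]
  refine (((tendsto_qPoch_atTop hq z).rpow_const (Or.inl (qPochInf_pos hq hz).ne')).mul
    ((tendsto_qPoch_atTop hq (q * z)).rpow_const (Or.inl p.ne'))).congr fun k => ?_
  rw [Finset.prod_mul_distrib, Real.finsetProd_rpow _ _
    (fun j _ => (one_sub_mul_pow_pos hq hz j).le), qPoch, qPoch,
    Real.finsetProd_rpow _ (fun j => 1 - z * q ^ j * q) fun j _ => by
      have := one_sub_mul_pow_pos hq hz (j + 1)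
      rw [pow_succ, ← mul_assoc] at this
      exact this.le]
  congr 3 with j
  ring

theorem qPochInf_rpow_mul_le (hq : 0 < q ∧ q < 1) (hr : 0 ≤ r) (hr1 : r ≤ 1) (hz : z ≤ 0) :
    qPochInf (q ^ r * z) q ≤ qPochInf z q * (1 - z) ^ (-r) := by
  refine le_of_tendsto_of_tendsto' (tendsto_qPoch_atTop hq _)
    (tendsto_qPoch_geom hq (by linarith)) fun k => Finset.prod_le_prod (fun j _ => ?_) fun j _ => ?_
  · have := Real.rpow_pos_of_pos hq.1 r
    exact (one_sub_mul_pow_pos hq (by nlinarith) j).le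
  · have := one_add_mul_rpow_le (u := -z * q ^ j)
      (mul_nonneg (by linarith) (pow_pos hq.1 j).le) hq.1 hr hr1
    exact (this.trans_eq' (by ring)).trans_eq (by congr 2 <;> ring)

theorem le_qPochInf_rpow_mul (hq : 0 < q ∧ q < 1) (hr : 0 ≤ r) (hr1 : r ≤ 1) (hz : 0 ≤ z)
    (hz1 : z < 1) : qPochInf z q * (1 - z) ^ (-r) ≤ qPochInf (q ^ r * z) q := by
  refine le_of_tendsto_of_tendsto' (tendsto_qPoch_geom hq hz1) (tendsto_qPoch_atTop hq _)
    fun k => Finset.prod_le_prod (fun j _ => ?_) fun j _ => ?_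
  · have h1 := one_sub_mul_pow_pos hq hz1 j
    have h2 := one_sub_mul_pow_pos hq hz1 (j + 1)
    rw [pow_succ, ← mul_assoc] at h2
    positivity
  · have := le_one_sub_mul_rpow (u := z * q ^ j) (mul_nonneg hz (pow_pos hq.1 j).le)
      (by linarith [one_sub_mul_pow_pos hq hz1 j]) hq.1 hq.2 hr hr1
    exact this.trans_eq (by ring)

/-- One bound is the factorwise comparison at `z` with exponent `r`. The other is the same
comparison at `q^r z` with exponent `1-r`, since `q^(1-r) q^r z = qz`. Which is upper and which is
lower depends on the sign of `z`, hence the `min` and `max`; both have the same limit as `q ↑ 1`. -/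
theorem qPochInf_ratio_bounds (hq : 0 < q ∧ q < 1) (hr : 0 ≤ r) (hr1 : r ≤ 1) (hz : z < 1) :
    min ((1 - z) ^ (-r)) ((1 - q ^ r * z) ^ (1 - r) / (1 - z)) ≤
        qPochInf (q ^ r * z) q / qPochInf z q ∧
      qPochInf (q ^ r * z) q / qPochInf z q ≤
        max ((1 - z) ^ (-r)) ((1 - q ^ r * z) ^ (1 - r) / (1 - z)) := by
  have h1 : 0 < 1 - z := by linarith
  have hr0 := Real.rpow_pos_of_pos hq.1 r
  have hrle : q ^ r ≤ 1 := Real.rpow_le_one hq.1.le hq.2.le hr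
  have hz' : q ^ r * z < 1 := by
    rcases le_or_gt z 0 with h | h <;> nlinarith
  have h2 : 0 < 1 - q ^ r * z := by linarith
  have p := qPochInf_pos hq hz
  have p' := qPochInf_pos hq hz'
  have eq1 : q ^ (1 - r) * (q ^ r * z) = q * z := by
    rw [← mul_assoc, ← Real.rpow_add hq.1]
    simp
  have e2 : qPochInf (q * z) q = qPochInf z q / (1 - z) := by
    rw [qPochInf_step hq z]
    field_simp
  have e3 : (1 - q ^ r * z) ^ (-(1 - r)) = ((1 - q ^ r * z) ^ (1 - r))⁻¹ := Real.rpow_neg h2.le _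
  have p3 : 0 < (1 - q ^ r * z) ^ (1 - r) := Real.rpow_pos_of_pos h2 _
  rcases le_or_gt z 0 with h | h
  · have a1 := qPochInf_rpow_mul_le hq hr hr1 h
    have a2 := qPochInf_rpow_mul_le (z := q ^ r * z) hq (sub_nonneg.2 hr1) (by linarith)
      (by nlinarith)
    rw [eq1, e2, e3] at a2
    constructor
    · refine (min_le_right _ _).trans ?_
      rw [le_div_iff₀ p]
      rw [← div_eq_mul_inv, le_div_iff₀ p3] at a2
      refine le_trans (le_of_eq ?_) a2
      ring
    · refine le_trans ?_ (le_max_left _ _)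
      rw [div_le_iff₀ p]
      exact a1.trans_eq (mul_comm _ _)
  · have a1 := le_qPochInf_rpow_mul hq hr hr1 h.le hz
    have a2 := le_qPochInf_rpow_mul (z := q ^ r * z) hq (sub_nonneg.2 hr1) (by linarith)
      (by positivity) hz'
    rw [eq1, e2, e3] at a2
    constructor
    · refine (min_le_left _ _).trans ?_
      rw [le_div_iff₀ p]
      exact (mul_comm _ _).trans_le a1
    · refine le_trans ?_ (le_max_right _ _)
      rw [div_le_iff₀ p]
      rw [← div_eq_mul_inv, div_le_iff₀ p3] at a2
      refine le_trans a2 (le_of_eq ?_)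
      ring

end

theorem tendsto_qPochInf_ratio_aux {r : ℝ} (hr : 0 ≤ r) (hr1 : r ≤ 1) {z : ℝ → ℝ} {z₀ : ℝ}
    (hz : Tendsto z (𝓝[<] 1) (𝓝 z₀)) (hz₀ : z₀ < 1) :
    Tendsto (fun q => qPochInf (q ^ r * z q) q / qPochInf (z q) q) (𝓝[<] 1)
      (𝓝 ((1 - z₀) ^ (-r))) := by
  have h1 : 0 < 1 - z₀ := by linarith
  have A : Tendsto (fun q => (1 - z q) ^ (-r)) (𝓝[<] 1) (𝓝 ((1 - z₀) ^ (-r))) :=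
    (hz.const_sub 1).rpow_const (Or.inl h1.ne')
  have B : Tendsto (fun q => (1 - q ^ r * z q) ^ (1 - r) / (1 - z q)) (𝓝[<] 1)
      (𝓝 ((1 - z₀) ^ (-r))) := by
    have := ((((tendsto_rpow_nhdsLT_one r).mul hz).const_sub 1).rpow_const (p := 1 - r)
      (Or.inl (by simpa using h1.ne'))).div (hz.const_sub 1) h1.ne'
    refine this.trans_eq (congrArg 𝓝 ?_)
    rw [one_mul, sub_eq_add_neg 1 r, Real.rpow_add h1, Real.rpow_one, mul_div_cancel_left₀ _ h1.ne']
  have m1 := A.min B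
  have m2 := A.max B
  rw [min_self] at m1
  rw [max_self] at m2
  refine tendsto_of_tendsto_of_tendsto_of_le_of_le' m1 m2 ?_ ?_
  · filter_upwards [eventually_mem_Ioo, hz.eventually (gt_mem_nhds hz₀)] with q hq hzq
    exact (qPochInf_ratio_bounds hq hr hr1 hzq).1
  · filter_upwards [eventually_mem_Ioo, hz.eventually (gt_mem_nhds hz₀)] with q hq hzq
    exact (qPochInf_ratio_bounds hq hr hr1 hzq).2

/-- `(q^r z;q)_∞ / (z;q)_∞ → (1 - z)^(-r)` as `q ↑ 1`, for `z < 1`. -/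
theorem tendsto_qPochInf_ratio (r : ℝ) {z : ℝ → ℝ} {z₀ : ℝ}
    (hz : Tendsto z (𝓝[<] 1) (𝓝 z₀)) (hz₀ : z₀ < 1) :
    Tendsto (fun q => qPochInf (q ^ r * z q) q / qPochInf (z q) q) (𝓝[<] 1)
      (𝓝 ((1 - z₀) ^ (-r))) := by
  have h1 : 0 < 1 - z₀ := by linarith
  have hne : ∀ s : ℝ, Tendsto (fun q => 1 - q ^ s * z q) (𝓝[<] 1) (𝓝 (1 - z₀)) := fun s => by
    simpa using ((tendsto_rpow_nhdsLT_one s).mul hz).const_sub 1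
  have shift : ∀ {q : ℝ} (s : ℝ), 0 < q ∧ q < 1 → q * (q ^ s * z q) = q ^ (s + 1) * z q := by
    intro q s hq
    rw [Real.rpow_add hq.1, Real.rpow_one]
    ring
  -- The squeeze covers the fractional part of `r`; each integer step multiplies or divides the
  -- quotient by one factor tending to `1 - z₀`.
  have key : ∀ k : ℤ, Tendsto (fun q => qPochInf (q ^ (Int.fract r + k) * z q) q / qPochInf (z q) q)
      (𝓝[<] 1) (𝓝 ((1 - z₀) ^ (-(Int.fract r + k)))) := by
    intro k
    induction k using Int.induction_on with
    | zero =>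
      simpa using tendsto_qPochInf_ratio_aux (Int.fract_nonneg r) (Int.fract_lt_one r).le hz hz₀
    | succ k ih =>
      have := ih.div (hne (Int.fract r + k)) h1.ne'
      have e : (1 - z₀) ^ (-(Int.fract r + ((k : ℤ) : ℝ))) / (1 - z₀) =
          (1 - z₀) ^ (-(Int.fract r + ((k + 1 : ℤ) : ℝ))) := by
        rw [div_eq_mul_inv, ← Real.rpow_neg_one (1 - z₀), ← Real.rpow_add h1]
        congr 1
        push_cast
        ring
      rw [e] at this
      refine this.congr' ?_
      filter_upwards [eventually_mem_Ioo, (hne (Int.fract r + k)).eventually (lt_mem_nhds h1)]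
        with q hq hpos
      have s := shift (Int.fract r + k) hq
      have st := qPochInf_step hq (q ^ (Int.fract r + k) * z q)
      rw [s] at st
      have e2 : Int.fract r + ((k + 1 : ℤ) : ℝ) = Int.fract r + k + 1 := by push_cast; ring
      rw [Pi.div_apply, e2, Int.cast_natCast, st, div_right_comm, mul_div_cancel_left₀ _ hpos.ne']
    | pred k ih =>
      have := ih.mul (hne (Int.fract r - k - 1))
      have e : (1 - z₀) ^ (-(Int.fract r + ((-k : ℤ) : ℝ))) * (1 - z₀) =
          (1 - z₀) ^ (-(Int.fract r + ((-k - 1 : ℤ) : ℝ))) := by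
        conv_lhs => rw [← Real.rpow_one (1 - z₀), ← Real.rpow_mul h1.le, one_mul,
          ← Real.rpow_add h1]
        congr 1
        push_cast
        ring
      rw [e] at this
      refine this.congr' ?_
      filter_upwards [eventually_mem_Ioo] with q hq
      have s := shift (Int.fract r - k - 1) hq
      have st := qPochInf_step hq (q ^ (Int.fract r - k - 1) * z q)
      have e2 : Int.fract r - k - 1 + 1 = Int.fract r + ((-k : ℤ) : ℝ) := by push_cast; ring
      rw [s, e2] at st
      have e3 : Int.fract r + ((-k - 1 : ℤ) : ℝ) = Int.fract r - k - 1 := by push_cast; ring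
      rw [e3, st]
      ring
  simpa using key ⌊r⌋

/-- A version of `tendsto_qPochInf_ratio` for two families of arguments. -/
theorem tendsto_qPochInf_div (r : ℝ) {z z' : ℝ → ℝ} {z₀ : ℝ}
    (hz : Tendsto z (𝓝[<] 1) (𝓝 z₀)) (hz₀ : z₀ < 1)
    (h : ∀ q, 0 < q → q < 1 → z' q = q ^ r * z q) :
    Tendsto (fun q => qPochInf (z' q) q / qPochInf (z q) q) (𝓝[<] 1)
      (𝓝 ((1 - z₀) ^ (-r))) := by
  refine (tendsto_qPochInf_ratio r hz hz₀).congr' ?_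
  filter_upwards [eventually_mem_Ioo] with q hq
  rw [h q hq.1 hq.2]

/-! ### The limit of the weight -/

/-- The ten infinite products pair into five quotients whose arguments differ by the powers `1+γ,
-γ, -β, -α, -(1+γ)` of `q`. Positivity of `y` makes `d/(cy)` and `x/y` tend to limits below `1`; in
the product of the limits all powers of `1+y` and of `y` cancel. -/
theorem tendsto_qWeight (α β γ δ : ℝ) (x y : ℝ) (hx : -1 < x) (hxy : x < y) (hy : y < 1)
    (hy0 : 0 < y) :
    Tendsto (fun q : ℝ => qWeight x y (q ^ α) (q ^ β) (q ^ γ) (-(q ^ δ)) q)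
        (𝓝[<] 1) (𝓝 (jacobiWeight α β γ x y)) := by
  have td := (tendsto_rpow_nhdsLT_one δ).neg
  have tb := tendsto_rpow_nhdsLT_one β
  have tc := tendsto_rpow_nhdsLT_one γ
  have tq := tendsto_id_nhdsLT_one
  have t1 := tendsto_qPochInf_div (1 + γ) (z := fun q => (q ^ γ)⁻¹ * -(q ^ δ) / y)
    (z' := fun q => -(q ^ δ) * q / y) (((tc.inv₀ one_ne_zero).mul td).div_const y)
    (by
      have : 0 < 1 / y := by positivity
      rw [inv_one, one_mul, neg_div]; linarith)
    (fun q h0 h1 => by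
      have := (Real.rpow_pos_of_pos h0 γ).ne'
      rw [Real.rpow_add h0, Real.rpow_one]; field_simp)
  have t2 := tendsto_qPochInf_div (-γ) (z := fun _ => x / y)
    (z' := fun q => (q ^ γ)⁻¹ * x / y) tendsto_const_nhds ((div_lt_one hy0).2 hxy)
    (fun q h0 h1 => by rw [Real.rpow_neg h0.le]; ring)
  have t3 := tendsto_qPochInf_div (-β) (z := fun q => q ^ β * x / -(q ^ δ))
    (z' := fun q => x / -(q ^ δ)) ((tb.mul_const x).div td (by norm_num))
    (by rw [one_mul, div_neg, div_one]; linarith)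
    (fun q h0 h1 => by
      have := (Real.rpow_pos_of_pos h0 β).ne'
      rw [Real.rpow_neg h0.le]; field_simp)
  have t4 := tendsto_qPochInf_div (-α) (z := fun _ => y)
    (z' := fun q => y / q ^ α) tendsto_const_nhds hy
    (fun q h0 h1 => by rw [Real.rpow_neg h0.le]; ring)
  have t5 := tendsto_qPochInf_div (-(1 + γ)) (z := fun q => q ^ γ * q * y / -(q ^ δ))
    (z' := fun q => y / -(q ^ δ)) (((tc.mul tq).mul_const y).div td (by norm_num))
    (by rw [one_mul, one_mul, div_neg, div_one]; linarith)
    (fun q h0 h1 => by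
      have := (Real.rpow_pos_of_pos h0 γ).ne'
      rw [Real.rpow_neg h0.le, Real.rpow_add h0, Real.rpow_one]; field_simp)
  have := ((((t1.mul t2).mul t3).mul t4).mul t5).div_const y
  refine (this.congr fun q => ?_).trans_eq (congrArg 𝓝 ?_)
  · simp only [qWeight]
    ring
  · have hyx : 0 < y - x := by linarith
    have h1y : 0 < 1 + y := by linarith
    have e1 : 1 - 1⁻¹ * -1 / y = (1 + y) / y := by field_simp; ring
    have e2 : 1 - x / y = (y - x) / y := by field_simp
    have e3 : 1 - 1 * x / -1 = x + 1 := by ring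
    have e5 : 1 - 1 * 1 * y / -1 = 1 + y := by ring
    rw [e1, e2, e3, e5, neg_neg, neg_neg, neg_neg, neg_neg, jacobiWeight,
      Real.div_rpow h1y.le hy0.le, Real.div_rpow hyx.le hy0.le, Real.rpow_neg h1y.le,
      Real.rpow_neg hy0.le, Real.rpow_add hy0, Real.rpow_one]
    have := (Real.rpow_pos_of_pos hy0 γ).ne'
    have := (Real.rpow_pos_of_pos h1y (1 + γ)).ne'
    field_simp

/-! ### The weight at the nodes of the `q`-integral -/

theorem qPoch_reverse {A q : ℝ} (hA : A ≠ 0) (hq : q ≠ 0) (n : ℕ) :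
    qPoch A q n = (-A) ^ n * (∏ j ∈ Finset.range n, q ^ j) * qPoch (A⁻¹ * q / q ^ n) q n := by
  rw [← Finset.card_range n, ← Finset.prod_const, Finset.card_range, ← Finset.prod_mul_distrib]
  -- Extracting `-A q^j` from each factor leaves `1 - A⁻¹ q^(-j)`; read in reverse order, these are
  -- the factors of a factorial with base `A⁻¹ q^(1-n)`.
  have : qPoch (A⁻¹ * q / q ^ n) q n = ∏ j ∈ Finset.range n, (1 - A⁻¹ / q ^ j) := by
    rw [qPoch, ← Finset.prod_range_reflect]
    refine Finset.prod_congr rfl fun j hj => ?_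
    have hj' := Finset.mem_range.1 hj
    obtain ⟨i, rfl⟩ : ∃ i, n = i + 1 + j := ⟨n - 1 - j, by omega⟩
    have : i + 1 + j - 1 - j = i := by omega
    rw [this]
    field_simp
    ring
  rw [this, ← Finset.prod_mul_distrib, qPoch]
  refine Finset.prod_congr rfl fun j _ => ?_
  have := pow_ne_zero j hq
  field_simp
  ring

/-- The zeros are the points `C q^j`, which accumulate only at `0`. Near `Y ≠ 0` there are finitely
many, so a punctured neighbourhood avoids them all. -/
theorem eventually_qPochInf_div_ne_zero {q : ℝ} (hq : 0 < q ∧ q < 1) (C : ℝ) {Y : ℝ} (hY : Y ≠ 0) :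
    ∀ᶠ t in 𝓝[≠] Y, t ≠ 0 ∧ qPochInf (C / t) q ≠ 0 := by
  have hlim : Tendsto (fun j : ℕ => |C * q ^ j|) atTop (𝓝 0) := by
    simpa using ((tendsto_pow_atTop_nhds_zero_of_lt_one hq.1.le hq.2).const_mul C).abs
  have hY2 : 0 < |Y| / 2 := by positivity
  obtain ⟨n, hn⟩ := eventually_atTop.1 (hlim.eventually (gt_mem_nhds hY2))
  have hfin : ∀ᶠ t in 𝓝[≠] Y, ∀ j ∈ Finset.range n, t ≠ C * q ^ j := by
    rw [Filter.eventually_all_finset]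
    intro j _
    by_cases h : Y = C * q ^ j
    · filter_upwards [self_mem_nhdsWithin] with t ht using h ▸ ht
    · exact nhdsWithin_le_nhds (isOpen_ne.mem_nhds h)
  have hbig : ∀ᶠ t in 𝓝[≠] Y, |Y| / 2 < |t| :=
    nhdsWithin_le_nhds ((continuous_abs.tendsto Y).eventually
      (lt_mem_nhds (half_lt_self (abs_pos.2 hY))))
  filter_upwards [hfin, hbig] with t h1 h2
  have ht : t ≠ 0 := fun h => by
    rw [h, abs_zero] at h2
    linarith
  refine ⟨ht, qPochInf_ne_zero hq fun j hj => ?_⟩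
  have hj' : t = C * q ^ j := by
    field_simp at hj
    exact hj.symm
  rcases lt_or_ge j n with h | h
  · exact h1 j (Finset.mem_range.2 h) hj'
  · have := hn j h
    rw [← hj'] at this
    linarith

/-- At the node both `(dq/t;q)_∞` and `(x/t;q)_∞` vanish. Since `x = dq^(l+1)`, one has `(dq/t;q)_∞
= (dq/t;q)_l (x/t;q)_∞`, and likewise `(d/(ct);q)_∞ = (d/(ct);q)_(l+1) (x/(ct);q)_∞`. Cancelling the
common infinite factors leaves an expression continuous at the node. Reversing the finite products
then gives bases with positive powers of `q`, whose limits can be handled as before. -/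
theorem tendsto_qWeight_node {q a b c d : ℝ} (hq : 0 < q ∧ q < 1) (hc : 0 < c)
    (hd : d < 0) {l e : ℕ} (hce : c * q ^ (e + 1) < 1) (hb : b * q ^ (l + 1) < 1) :
    Tendsto (fun t : ℝ => qWeight (d * q ^ (l + 1)) t a b c d q)
      (𝓝[≠] (d * q ^ (l + e + 1)))
      (𝓝 (c ^ (l + 1) / -d * (qPochInf (q ^ (e + 1)) q / qPochInf (c * q ^ (e + 1)) q) *
        (qPochInf (q ^ (l + 1)) q / qPochInf (b * q ^ (l + 1)) q) *
        (qPochInf (d * q ^ (l + e + 1) / a) q / qPochInf (d * q ^ (l + e + 1)) q))) := by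
  have hq0 := hq.1.ne'
  set Y := d * q ^ (l + e + 1) with hYdef
  have hYneg : Y < 0 := mul_neg_of_neg_of_pos hd (pow_pos hq.1 _)
  have hY : Y ≠ 0 := hYneg.ne
  have hYd : Y / d = q ^ (l + e + 1) := mul_div_cancel_left₀ _ hd.ne
  have cont := continuous_qPochInf hq
  have h1 := (qPochInf_pos hq hce).ne'
  have h2 : 0 < qPochInf (c * q * Y / d) q := qPochInf_pos hq (by
    rw [mul_div_assoc, hYd]
    have : c * q * q ^ (l + e + 1) = c * q ^ (e + 1) * q ^ (l + 1) := by ring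
    rw [this]
    have h3 : q ^ (l + 1) ≤ 1 := pow_le_one₀ hq.1.le hq.2.le
    have h4 : 0 < c * q ^ (e + 1) := mul_pos hc (pow_pos hq.1 _)
    nlinarith)
  have hbx : b * (d * q ^ (l + 1)) / d = b * q ^ (l + 1) := by
    have := hd.ne
    field_simp
  have h3 : 0 < qPochInf (b * (d * q ^ (l + 1)) / d) q := qPochInf_pos hq (by rwa [hbx])
  have h4 : 0 < qPochInf Y q := qPochInf_pos hq (by linarith)
  have eA : d * q / Y = (q ^ (l + e))⁻¹ := by
    have := hd.ne
    rw [hYdef]; field_simp; try ring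
  have eA' : c⁻¹ * d / Y = (c * q ^ (l + e + 1))⁻¹ := by
    have := hd.ne
    rw [hYdef]; field_simp
  have r1 := qPoch_reverse (A := d * q / Y) (by rw [eA]; positivity) hq0 l
  have r2 := qPoch_reverse (A := c⁻¹ * d / Y) (by rw [eA']; positivity) hq0 (l + 1)
  have z1 : (d * q / Y)⁻¹ * q / q ^ l = q ^ (e + 1) := by
    rw [eA, inv_inv, div_eq_iff (by positivity)]; ring
  have z2 : (c⁻¹ * d / Y)⁻¹ * q / q ^ (l + 1) = c * q ^ (e + 1) := by
    rw [eA', inv_inv, div_eq_iff (by positivity)]; ring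
  rw [z1] at r1
  rw [z2] at r2
  have s1 := qPochInf_split hq (q ^ (e + 1)) l
  have s2 := qPochInf_split hq (c * q ^ (e + 1)) (l + 1)
  have u1 : q ^ (e + 1) * q ^ l = Y / d := by rw [hYd]; ring
  have u2 : c * q ^ (e + 1) * q ^ (l + 1) = c * q * Y / d := by rw [mul_div_assoc, hYd]; ring
  rw [u1] at s1
  rw [u2] at s2
  have p1 : 0 < qPoch (c * q ^ (e + 1)) q (l + 1) := qPoch_pos hq hce _
  have hprod : 0 < ∏ j ∈ Finset.range l, q ^ j := Finset.prod_pos fun j _ => pow_pos hq.1 j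
  have hden : qPoch (c⁻¹ * d / Y) q (l + 1) ≠ 0 := by
    rw [r2, eA', Finset.prod_range_succ]
    have : (c * q ^ (l + e + 1))⁻¹ ≠ 0 := by positivity
    exact mul_ne_zero (mul_ne_zero (pow_ne_zero _ (neg_ne_zero.2 this))
      (mul_ne_zero hprod.ne' (pow_ne_zero _ hq0))) p1.ne'
  have contPoch : ∀ n : ℕ, Continuous fun z => qPoch z q n := fun n => by
    unfold qPoch; fun_prop
  have lim : Tendsto (fun t => qPoch (d * q / t) q l / qPoch (c⁻¹ * d / t) q (l + 1) *
      (qPochInf (d * q ^ (l + 1) / d) q * qPochInf (t / a) q * qPochInf (t / d) q /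
        (t * (qPochInf (c * q * t / d) q * qPochInf (b * (d * q ^ (l + 1)) / d) q *
          qPochInf t q)))) (𝓝[≠] Y)
      (𝓝 (qPoch (d * q / Y) q l / qPoch (c⁻¹ * d / Y) q (l + 1) *
      (qPochInf (d * q ^ (l + 1) / d) q * qPochInf (Y / a) q * qPochInf (Y / d) q /
        (Y * (qPochInf (c * q * Y / d) q * qPochInf (b * (d * q ^ (l + 1)) / d) q *
          qPochInf Y q))))) := by
    have div1 : ∀ K : ℝ, ContinuousAt (fun t => K / t) Y := fun K => continuousAt_const.div
      continuousAt_id hY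
    have c1 : ContinuousAt (fun t => qPoch (d * q / t) q l) Y :=
      (contPoch l).continuousAt.comp (div1 (d * q))
    have c2 : ContinuousAt (fun t => qPoch (c⁻¹ * d / t) q (l + 1)) Y :=
      (contPoch (l + 1)).continuousAt.comp (div1 (c⁻¹ * d))
    have c3 : Continuous (fun t => qPochInf (t / a) q) := cont.comp (by fun_prop)
    have c4 : Continuous (fun t => qPochInf (t / d) q) := cont.comp (by fun_prop)
    have c5 : Continuous (fun t => qPochInf (c * q * t / d) q) := cont.comp (by fun_prop)
    have : ContinuousAt (fun t => qPoch (d * q / t) q l / qPoch (c⁻¹ * d / t) q (l + 1) *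
      (qPochInf (d * q ^ (l + 1) / d) q * qPochInf (t / a) q * qPochInf (t / d) q /
        (t * (qPochInf (c * q * t / d) q * qPochInf (b * (d * q ^ (l + 1)) / d) q *
          qPochInf t q)))) Y :=
      (c1.div c2 hden).mul (((continuousAt_const.mul c3.continuousAt).mul c4.continuousAt).div
        (continuousAt_id.mul ((c5.continuousAt.mul continuousAt_const).mul cont.continuousAt))
        (mul_ne_zero hY (mul_ne_zero (mul_ne_zero h2.ne' h3.ne') h4.ne')))
    exact this.tendsto.mono_left nhdsWithin_le_nhds
  have e : qPoch (d * q / Y) q l / qPoch (c⁻¹ * d / Y) q (l + 1) *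
      (qPochInf (d * q ^ (l + 1) / d) q * qPochInf (Y / a) q * qPochInf (Y / d) q /
        (Y * (qPochInf (c * q * Y / d) q * qPochInf (b * (d * q ^ (l + 1)) / d) q *
          qPochInf Y q))) =
      c ^ (l + 1) / -d * (qPochInf (q ^ (e + 1)) q / qPochInf (c * q ^ (e + 1)) q) *
        (qPochInf (q ^ (l + 1)) q / qPochInf (b * q ^ (l + 1)) q) *
        (qPochInf (Y / a) q / qPochInf Y q) := by
    rw [hbx] at h3 ⊢
    rw [mul_div_cancel_left₀ _ hd.ne, s1, s2, r1, r2, eA, eA', Finset.prod_range_succ]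
    have hYd' : 0 < qPochInf (Y / d) q := qPochInf_pos hq (by
      rw [hYd]; exact pow_lt_one₀ hq.1.le hq.2 (by omega))
    generalize qPochInf (c * q * Y / d) q = V2 at h2 ⊢
    generalize qPochInf (b * q ^ (l + 1)) q = V3 at h3 ⊢
    generalize qPochInf Y q = V4 at h4 ⊢
    generalize qPochInf (Y / d) q = V5 at hYd' ⊢
    generalize qPoch (c * q ^ (e + 1)) q (l + 1) = V6 at p1 ⊢
    generalize ∏ j ∈ Finset.range l, q ^ j = V7 at hprod ⊢
    generalize qPochInf (Y / a) q = V8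
    generalize qPochInf (q ^ (l + 1)) q = V9
    generalize qPoch (q ^ (e + 1)) q l = V10
    have hd0 := hd.ne
    have hql : (q ^ (l + e)) = q ^ l * q ^ e := pow_add _ _ _
    have hqle : q ^ (l + e + 1) = q ^ l * q ^ e * q := by rw [pow_succ, pow_add]
    -- The prefactors of the two reversals: the products of powers of `q` agree up to the factor
    -- `q^l`, and what remains together with `Y` is `c^(l+1)/(-d)`.
    have key : (-(q ^ (l + e))⁻¹) ^ l / ((-(c * q ^ (l + e + 1))⁻¹) ^ (l + 1) * q ^ l * Y) =
        c ^ (l + 1) / -d := by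
      have k1 : (-(q ^ (l + e))⁻¹) = (-(c * q ^ (l + e + 1))⁻¹) * (c * q) := by
        rw [hql, hqle]; field_simp
      have hB : (-(c * q ^ (l + e + 1))⁻¹) ≠ 0 := neg_ne_zero.2 (by positivity)
      rw [k1, mul_pow, pow_succ (-(c * q ^ (l + e + 1))⁻¹) l, mul_assoc, mul_assoc,
        mul_div_mul_left _ _ (pow_ne_zero l hB), hYdef]
      field_simp
      try ring
    rw [← key]
    have hB : (-(c * q ^ (l + e + 1))⁻¹) ^ (l + 1) ≠ 0 :=
      pow_ne_zero _ (neg_ne_zero.2 (by positivity))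
    generalize (-(c * q ^ (l + e + 1))⁻¹) ^ (l + 1) = B at hB ⊢
    generalize (-(q ^ (l + e))⁻¹) ^ l = A
    field_simp
  rw [e] at lim
  refine lim.congr' ?_
  filter_upwards [eventually_qPochInf_div_ne_zero hq (d * q ^ (l + 1)) hY,
    eventually_qPochInf_div_ne_zero hq (c⁻¹ * (d * q ^ (l + 1))) hY] with t ht1 ht2
  have f1 := qPochInf_split hq (d * q / t) l
  have f2 := qPochInf_split hq (c⁻¹ * d / t) (l + 1)
  have g1 : d * q / t * q ^ l = d * q ^ (l + 1) / t := by ring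
  have g2 : c⁻¹ * d / t * q ^ (l + 1) = c⁻¹ * (d * q ^ (l + 1)) / t := by ring
  rw [g1] at f1
  rw [g2] at f2
  rw [qWeight, f1, f2]
  have n1 := ht1.2
  have n2 := ht2.2
  generalize qPochInf (d * q ^ (l + 1) / t) q = U1 at n1 ⊢
  generalize qPochInf (c⁻¹ * (d * q ^ (l + 1)) / t) q = U2 at n2 ⊢
  generalize qPoch (c⁻¹ * d / t) q (l + 1) = U3
  generalize qPoch (d * q / t) q l = U4
  rw [div_mul_div_comm, ← mul_div_mul_right _ _ (mul_ne_zero n1 n2)]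
  congr 1 <;> ring

/-- The node conditions say `q^(l+1) → -x` and `q^(k-l) → y/x`. Three quotients of infinite products
give the powers of `1-y/x`, `1+x` and `1-y`, while `(q^γ)^(l+1) = (q^(l+1))^γ` gives `(-x)^γ`;
finally `y-x = (-x)(1-y/x)`. -/
theorem tendsto_qWeight_nodes (α β γ δ : ℝ) (hβ : -1 < β) (hγ : -1 < γ) (x y : ℝ)
    (hx : -1 < x) (hxy : x < y) (hy : y ≤ 0) (k l : ℝ → ℕ)
    (hl : Tendsto (fun q : ℝ => -(q ^ δ) * q ^ (l q + 1)) (𝓝[<] 1) (𝓝 x))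
    (hk : Tendsto (fun q : ℝ => -(q ^ δ) * q ^ (k q + 1)) (𝓝[<] 1) (𝓝 y)) :
    ∃ w : ℝ → ℝ,
      (∀ᶠ q : ℝ in 𝓝[<] 1,
        Tendsto (fun t : ℝ => qWeight (-(q ^ δ) * q ^ (l q + 1)) t
            (q ^ α) (q ^ β) (q ^ γ) (-(q ^ δ)) q)
          (𝓝[≠] (-(q ^ δ) * q ^ (k q + 1))) (𝓝 (w q))) ∧
      Tendsto w (𝓝[<] 1) (𝓝 (jacobiWeight α β γ x y)) := by
  have hx0 : x < 0 := by linarith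
  have td := tendsto_rpow_nhdsLT_one δ
  have tb := tendsto_rpow_nhdsLT_one β
  have tc := tendsto_rpow_nhdsLT_one γ
  have tq := tendsto_id_nhdsLT_one
  -- Nodes increase towards `0` with the exponent, so `x < y` forces this order and makes the
  -- natural subtraction `k - l` exact.
  have hkl : ∀ᶠ q : ℝ in 𝓝[<] 1, l q < k q := by
    filter_upwards [hl.eventually_lt hk hxy, eventually_mem_Ioo] with q h hq
    have hd := Real.rpow_pos_of_pos hq.1 δ
    have h2 : q ^ (k q + 1) < q ^ (l q + 1) := by nlinarith
    have := (pow_lt_pow_iff_right_of_lt_one₀ hq.1 hq.2).1 h2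
    omega
  have tl : Tendsto (fun q : ℝ => q ^ (l q + 1)) (𝓝[<] 1) (𝓝 (-x)) := by
    have := hl.neg.div td one_ne_zero
    rw [div_one] at this
    refine this.congr' ?_
    filter_upwards [eventually_mem_Ioo] with q hq
    have := (Real.rpow_pos_of_pos hq.1 δ).ne'
    simp only [Pi.div_apply]
    field_simp
    try ring
  have tk : Tendsto (fun q : ℝ => q ^ (k q + 1)) (𝓝[<] 1) (𝓝 (-y)) := by
    have := hk.neg.div td one_ne_zero
    rw [div_one] at this
    refine this.congr' ?_
    filter_upwards [eventually_mem_Ioo] with q hq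
    have := (Real.rpow_pos_of_pos hq.1 δ).ne'
    simp only [Pi.div_apply]
    field_simp
    try ring
  have te : Tendsto (fun q : ℝ => q ^ (k q - l q)) (𝓝[<] 1) (𝓝 (y / x)) := by
    have := tk.div tl (neg_ne_zero.2 hx0.ne)
    rw [neg_div_neg_eq] at this
    refine this.congr' ?_
    filter_upwards [eventually_mem_Ioo, hkl] with q hq hlt
    have e : k q + 1 = (k q - l q) + (l q + 1) := by omega
    rw [Pi.div_apply, e, pow_add, mul_div_cancel_right₀ _ (pow_pos hq.1 _).ne']
  have hyx1 : y / x < 1 := by rw [div_lt_one_of_neg hx0]; exact hxy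
  refine ⟨fun q => (q ^ γ) ^ (l q + 1) / -(-(q ^ δ)) *
        (qPochInf (q ^ (k q - l q + 1)) q / qPochInf (q ^ γ * q ^ (k q - l q + 1)) q) *
        (qPochInf (q ^ (l q + 1)) q / qPochInf (q ^ β * q ^ (l q + 1)) q) *
        (qPochInf (-(q ^ δ) * q ^ (k q + 1) / q ^ α) q / qPochInf (-(q ^ δ) * q ^ (k q + 1)) q),
    ?_, ?_⟩
  · filter_upwards [eventually_mem_Ioo, hkl] with q hq hlt
    have hlt1 : ∀ (s : ℝ) (n : ℕ), -1 < s → q ^ s * q ^ (n + 1) < 1 := fun s n hs => by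
      rw [← Real.rpow_natCast, ← Real.rpow_add hq.1]
      refine Real.rpow_lt_one hq.1.le hq.2 ?_
      have : (0 : ℝ) ≤ n := Nat.cast_nonneg n
      push_cast
      linarith
    have := tendsto_qWeight_node (a := q ^ α) (b := q ^ β) (c := q ^ γ) (d := -(q ^ δ))
      (l := l q) (e := k q - l q) hq
      (Real.rpow_pos_of_pos hq.1 γ)
      (neg_neg_of_pos (Real.rpow_pos_of_pos hq.1 δ)) (hlt1 γ _ hγ) (hlt1 β _ hβ)
    rwa [show l q + (k q - l q) + 1 = k q + 1 by omega] at this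
  · have t1 := tendsto_qPochInf_div (-γ) (z := fun q => q ^ γ * q ^ (k q - l q + 1))
      (z' := fun q => q ^ (k q - l q + 1))
      (by simpa [pow_succ] using tc.mul (te.mul tq)) hyx1
      (fun q h0 _ => by
        have := (Real.rpow_pos_of_pos h0 γ).ne'
        rw [Real.rpow_neg h0.le]; field_simp)
    have t2 := tendsto_qPochInf_div (-β) (z := fun q => q ^ β * q ^ (l q + 1))
      (z' := fun q => q ^ (l q + 1))
      (by simpa using tb.mul tl) (by linarith)
      (fun q h0 _ => by
        have := (Real.rpow_pos_of_pos h0 β).ne'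
        rw [Real.rpow_neg h0.le]; field_simp)
    have t3 := tendsto_qPochInf_div (-α) (z := fun q => -(q ^ δ) * q ^ (k q + 1))
      (z' := fun q => -(q ^ δ) * q ^ (k q + 1) / q ^ α) hk (by linarith)
      (fun q h0 _ => by rw [Real.rpow_neg h0.le]; ring)
    have t0 : Tendsto (fun q : ℝ => (q ^ γ) ^ (l q + 1) / -(-(q ^ δ))) (𝓝[<] 1)
        (𝓝 ((-x) ^ γ / 1)) := by
      have hne : -x ≠ 0 := neg_ne_zero.2 hx0.ne
      refine Tendsto.div ?_ (by simpa using td) one_ne_zero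
      refine (tl.rpow_const (p := γ) (Or.inl hne)).congr' ?_
      filter_upwards [eventually_mem_Ioo] with q hq
      rw [← Real.rpow_natCast, ← Real.rpow_natCast, ← Real.rpow_mul hq.1.le,
        ← Real.rpow_mul hq.1.le, mul_comm]
    refine (((t0.mul t1).mul t2).mul t3).trans_eq (congrArg 𝓝 ?_)
    have hxy' : y - x = (-x) * (1 - y / x) := by
      have := hx0.ne
      field_simp
      try ring
    rw [jacobiWeight, hxy', Real.mul_rpow (by linarith) (by linarith)]
    simp only [neg_neg, div_one, sub_neg_eq_add]
    ring_nf

/-! ### Polynomials in two variables as functions on the plane -/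

/-- Polynomials in two real variables. -/
abbrev Poly2 := MvPolynomial (Fin 2) ℝ

section evalPt

variable (p r : Poly2) (x y : ℝ)

@[simp] theorem evalPt_add : evalPt (p + r) x y = evalPt p x y + evalPt r x y := by simp [evalPt]
@[simp] theorem evalPt_sub : evalPt (p - r) x y = evalPt p x y - evalPt r x y := by simp [evalPt]
@[simp] theorem evalPt_mul : evalPt (p * r) x y = evalPt p x y * evalPt r x y := by simp [evalPt]
@[simp] theorem evalPt_pow (n : ℕ) : evalPt (p ^ n) x y = evalPt p x y ^ n := by simp [evalPt]
@[simp] theorem evalPt_C (c : ℝ) : evalPt (MvPolynomial.C c) x y = c := by simp [evalPt]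
@[simp] theorem evalPt_smul (c : ℝ) : evalPt (c • p) x y = c * evalPt p x y := by simp [evalPt]
@[simp] theorem evalPt_one : evalPt 1 x y = 1 := by simp [evalPt]
@[simp] theorem evalPt_zero : evalPt 0 x y = 0 := by simp [evalPt]
@[simp] theorem evalPt_X0 : evalPt (MvPolynomial.X 0) x y = x := by simp [evalPt]
@[simp] theorem evalPt_X1 : evalPt (MvPolynomial.X 1) x y = y := by simp [evalPt]
@[simp] theorem evalPt_sum {ι : Type*} (s : Finset ι) (f : ι → Poly2) :
    evalPt (∑ i ∈ s, f i) x y = ∑ i ∈ s, evalPt (f i) x y := by simp [evalPt]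
@[simp] theorem evalPt_prod {ι : Type*} (s : Finset ι) (f : ι → Poly2) :
    evalPt (∏ i ∈ s, f i) x y = ∏ i ∈ s, evalPt (f i) x y := by simp [evalPt, map_prod]

theorem continuous_evalPt : Continuous fun z : ℝ × ℝ => evalPt p z.1 z.2 := by
  unfold evalPt
  refine (MvPolynomial.continuous_eval p).comp (continuous_pi fun i => ?_)
  fin_cases i
  · exact continuous_fst
  · exact continuous_snd

theorem hasDerivAt_evalPt_fst :
    HasDerivAt (fun s => evalPt p s y) (evalPt (MvPolynomial.pderiv 0 p) x y) x := by
  induction p using MvPolynomial.induction_on with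
  | C a => simpa using hasDerivAt_const x a
  | add p r hp hr =>
    simp only [evalPt_add, map_add]
    exact hp.add hr
  | mul_X p i hp =>
    obtain rfl | rfl : i = 0 ∨ i = 1 := by fin_cases i <;> simp
    · simp only [evalPt_mul, evalPt_X0]
      refine (hp.mul (hasDerivAt_id x)).congr_deriv ?_
      simp [Derivation.leibniz, MvPolynomial.pderiv_X, add_comm, mul_comm]
    · simp only [evalPt_mul, evalPt_X1]
      refine (hp.mul_const y).congr_deriv ?_
      simp [Derivation.leibniz, MvPolynomial.pderiv_X, mul_comm]

theorem hasDerivAt_evalPt_snd :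
    HasDerivAt (fun t => evalPt p x t) (evalPt (MvPolynomial.pderiv 1 p) x y) y := by
  induction p using MvPolynomial.induction_on with
  | C a => simpa using hasDerivAt_const y a
  | add p r hp hr =>
    simp only [evalPt_add, map_add]
    exact hp.add hr
  | mul_X p i hp =>
    obtain rfl | rfl : i = 0 ∨ i = 1 := by fin_cases i <;> simp
    · simp only [evalPt_mul, evalPt_X0]
      refine (hp.mul_const x).congr_deriv ?_
      simp [Derivation.leibniz, MvPolynomial.pderiv_X, mul_comm]
    · simp only [evalPt_mul, evalPt_X1]
      refine (hp.mul (hasDerivAt_id y)).congr_deriv ?_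
      simp [Derivation.leibniz, MvPolynomial.pderiv_X, add_comm, mul_comm]

end evalPt

/-! ### Integrability of the weight on the triangle -/

theorem isCompact_triangle : IsCompact triangle := by
  refine (isCompact_Icc (a := ((-1 : ℝ), (-1 : ℝ))) (b := ((1 : ℝ), (1 : ℝ)))).of_isClosed_subset
    ?_ ?_
  · have e : triangle = {p : ℝ × ℝ | p.1 ≤ p.2} ∩ {p | p.2 ≤ 1} ∩ {p | -1 ≤ p.1} ∩ {p | p.1 ≤ 1} := by
      ext p
      simp [triangle, and_assoc]
    rw [e]
    exact (((isClosed_le continuous_fst continuous_snd).inter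
      (isClosed_le continuous_snd continuous_const)).inter
      (isClosed_le continuous_const continuous_fst)).inter
      (isClosed_le continuous_fst continuous_const)
  · rintro ⟨x, y⟩ ⟨h1, h2, h3, h4⟩
    exact ⟨⟨h3, h3.trans h1⟩, ⟨h4, h2⟩⟩

theorem integrableOn_rpow_Icc {r : ℝ} (hr : -1 < r) :
    Integrable (Set.indicator (Set.Icc 0 2) fun t : ℝ => t ^ r) := by
  rw [integrable_indicator_iff measurableSet_Icc, integrableOn_Icc_iff_integrableOn_Ioc,
    ← intervalIntegrable_iff_integrableOn_Ioc_of_le (by norm_num)]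
  exact intervalIntegral.intervalIntegrable_rpow' hr

theorem rpow_le_of_mem {r t : ℝ} (h1 : 2 / 3 ≤ t) (h2 : t ≤ 2) :
    t ^ r ≤ (2 / 3) ^ r + 2 ^ r := by
  have p1 : (0 : ℝ) ≤ (2 / 3) ^ r := by positivity
  have p2 : (0 : ℝ) ≤ 2 ^ r := by positivity
  rcases le_total 0 r with h | h
  · have := Real.rpow_le_rpow (by linarith) h2 h
    linarith
  · have := Real.rpow_le_rpow_of_nonpos (by norm_num) h1 h
    linarith

theorem measurable_jacobiWeight (α β γ : ℝ) :
    Measurable fun z : ℝ × ℝ => jacobiWeight α β γ z.1 z.2 := by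
  unfold jacobiWeight
  fun_prop

/-- On the triangle `x+1`, `1-y` and `y-x` are nonnegative with sum 2, so at least one is at least
`2/3` and its power is bounded. The weight is thus dominated by a sum of three products of two
one-variable powers, each integrable after a shear or a product decomposition. -/
theorem integrableOn_jacobiWeight {α β γ : ℝ} (hα : -1 < α) (hβ : -1 < β) (hγ : -1 < γ) :
    IntegrableOn (fun z : ℝ × ℝ => jacobiWeight α β γ z.1 z.2) triangle := by
  set k : ℝ → ℝ → ℝ := fun r => Set.indicator (Set.Icc 0 2) fun t : ℝ => t ^ r with hk
  have kint : ∀ {r : ℝ}, -1 < r → Integrable (k r) := fun hr => integrableOn_rpow_Icc hr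
  have kval : ∀ {r t : ℝ}, 0 ≤ t → t ≤ 2 → k r t = t ^ r := fun h0 h2 =>
    Set.indicator_of_mem (show _ ∈ Set.Icc (0 : ℝ) 2 from ⟨h0, h2⟩) _
  have i1 : Integrable (fun z : ℝ × ℝ => k β (z.1 + 1) * k α (1 - z.2)) :=
    ((kint hβ).comp_add_right 1).mul_prod ((kint hα).comp_sub_left 1)
  have i2 : Integrable (fun z : ℝ × ℝ => k β (z.1 + 1) * k γ (z.2 - z.1)) := by
    have h : Integrable (fun z : ℝ × ℝ => k β (z.1 + 1) * k γ z.2) :=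
      ((kint hβ).comp_add_right 1).mul_prod (kint hγ)
    have mp := measurePreserving_prod_neg_add (volume : Measure ℝ) (volume : Measure ℝ)
    have := mp.integrable_comp_of_integrable h
    refine this.congr (Eventually.of_forall fun z => ?_)
    simp only [Function.comp]
    rw [neg_add_eq_sub]
  have i3 : Integrable (fun z : ℝ × ℝ => k α (1 - z.2) * k γ (z.2 - z.1)) := by
    have h : Integrable (fun z : ℝ × ℝ => k α (1 - z.1) * k γ (-z.2)) :=
      ((kint hα).comp_sub_left 1).mul_prod (kint hγ).comp_neg
    have mp := measurePreserving_prod_neg_add_swap (volume : Measure ℝ) (volume : Measure ℝ)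
    have := mp.integrable_comp_of_integrable h
    refine this.congr (Eventually.of_forall fun z => ?_)
    simp only [Function.comp]
    congr 2
    ring
  set cst : ℝ → ℝ := fun r => (2 / 3) ^ r + 2 ^ r with hcst
  refine Integrable.mono' (((i1.const_mul (cst γ)).add (i2.const_mul (cst α))).add
    (i3.const_mul (cst β))).integrableOn (measurable_jacobiWeight α β γ).aestronglyMeasurable ?_
  refine (ae_restrict_iff' isCompact_triangle.isClosed.measurableSet).2
    (Eventually.of_forall fun z hz => ?_)
  obtain ⟨h1, h2, h3, h4⟩ := hz
  have u0 : 0 ≤ z.1 + 1 := by linarith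
  have v0 : 0 ≤ 1 - z.2 := by linarith
  have w0 : 0 ≤ z.2 - z.1 := by linarith
  have u2 : z.1 + 1 ≤ 2 := by linarith
  have v2 : 1 - z.2 ≤ 2 := by linarith
  have w2 : z.2 - z.1 ≤ 2 := by linarith
  simp only [Pi.add_apply, kval u0 u2, kval v0 v2, kval w0 w2, jacobiWeight]
  have pu := Real.rpow_nonneg u0 β
  have pv := Real.rpow_nonneg v0 α
  have pw := Real.rpow_nonneg w0 γ
  have cpos : ∀ r, 0 ≤ cst r := fun r => by positivity
  rw [Real.norm_of_nonneg (by positivity)]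
  have q1 : 0 ≤ cst γ * ((z.1 + 1) ^ β * (1 - z.2) ^ α) := by have := cpos γ; positivity
  have q2 : 0 ≤ cst α * ((z.1 + 1) ^ β * (z.2 - z.1) ^ γ) := by have := cpos α; positivity
  have q3 : 0 ≤ cst β * ((1 - z.2) ^ α * (z.2 - z.1) ^ γ) := by have := cpos β; positivity
  by_cases hu : 2 / 3 ≤ z.1 + 1
  · have := mul_le_mul_of_nonneg_right (rpow_le_of_mem (r := β) hu u2) (mul_nonneg pv pw)
    simp only [hcst] at *
    linarith
  · by_cases hv : 2 / 3 ≤ 1 - z.2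
    · have := mul_le_mul_of_nonneg_right (rpow_le_of_mem (r := α) hv v2) (mul_nonneg pu pw)
      simp only [hcst] at *
      linarith
    · have hw : 2 / 3 ≤ z.2 - z.1 := by linarith
      have := mul_le_mul_of_nonneg_right (rpow_le_of_mem (r := γ) hw w2) (mul_nonneg pu pv)
      simp only [hcst] at *
      linarith

/-- Admissible parameters of the weight. -/
def Admissible (α β γ : ℝ) : Prop := -1 < α ∧ -1 < β ∧ -1 < γ

theorem integrableOn_evalPt_mul_jacobiWeight {α β γ : ℝ} (h : Admissible α β γ) (p : Poly2) :
    IntegrableOn (fun z : ℝ × ℝ => evalPt p z.1 z.2 * jacobiWeight α β γ z.1 z.2) triangle :=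
  IntegrableOn.continuousOn_mul (continuous_evalPt p).continuousOn
    (integrableOn_jacobiWeight h.1 h.2.1 h.2.2) isCompact_triangle

/-- Integration of polynomials against the weight on the triangle. -/
def jacobiInt (α β γ : ℝ) (h : Admissible α β γ) : Poly2 →ₗ[ℝ] ℝ where
  toFun p := ∫ z in triangle, evalPt p z.1 z.2 * jacobiWeight α β γ z.1 z.2
  map_add' p r := by
    rw [← integral_add (integrableOn_evalPt_mul_jacobiWeight h p)
      (integrableOn_evalPt_mul_jacobiWeight h r)]
    simp [add_mul]
  map_smul' c p := by
    simp [mul_assoc, integral_const_mul]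

theorem jacobiInt_apply {α β γ : ℝ} (h : Admissible α β γ) (p : Poly2) :
    jacobiInt α β γ h p = ∫ z in triangle, evalPt p z.1 z.2 * jacobiWeight α β γ z.1 z.2 := rfl

theorem jacobiInt_one_pos {α β γ : ℝ} (h : Admissible α β γ) : 0 < jacobiInt α β γ h 1 := by
  rw [jacobiInt_apply]
  have hm := isCompact_triangle.isClosed.measurableSet
  rw [setIntegral_pos_iff_support_of_nonneg_ae _ (integrableOn_evalPt_mul_jacobiWeight h 1)]
  · have hU : IsOpen {z : ℝ × ℝ | -1 < z.1 ∧ z.1 < z.2 ∧ z.2 < 1} :=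
      (isOpen_lt continuous_const continuous_fst).inter
        ((isOpen_lt continuous_fst continuous_snd).inter (isOpen_lt continuous_snd continuous_const))
    refine lt_of_lt_of_le (hU.measure_pos volume ⟨(-(1 / 2), 0), by norm_num⟩) (measure_mono ?_)
    rintro ⟨x, y⟩ ⟨h1, h2, h3⟩
    simp only at h1 h2 h3
    refine ⟨?_, h2.le, h3.le, h1.le, (h2.trans h3).le⟩
    have a1 := Real.rpow_pos_of_pos (show 0 < 1 - y by linarith) α
    have a2 := Real.rpow_pos_of_pos (show 0 < x + 1 by linarith) β
    have a3 := Real.rpow_pos_of_pos (show 0 < y - x by linarith) γ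
    simp only [Function.mem_support, evalPt_one, one_mul, jacobiWeight]
    positivity
  · refine (ae_restrict_iff' hm).2 (Eventually.of_forall fun z hz => ?_)
    obtain ⟨h1, h2, h3, h4⟩ := hz
    have a1 := Real.rpow_nonneg (show 0 ≤ 1 - z.2 by linarith) α
    have a2 := Real.rpow_nonneg (show 0 ≤ z.1 + 1 by linarith) β
    have a3 := Real.rpow_nonneg (show 0 ≤ z.2 - z.1 by linarith) γ
    simp only [evalPt_one, one_mul, jacobiWeight, Pi.zero_apply]
    positivity

/-! ### Integration by parts -/

/-- `x + 1` -/
def pU : Poly2 := MvPolynomial.X 0 + 1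
/-- `1 - y` -/
def pV : Poly2 := 1 - MvPolynomial.X 1
/-- `y - x` -/
def pW : Poly2 := MvPolynomial.X 1 - MvPolynomial.X 0

/-- `∂/∂x` -/
abbrev dX (p : Poly2) : Poly2 := MvPolynomial.pderiv 0 p
/-- `∂/∂y` -/
abbrev dY (p : Poly2) : Poly2 := MvPolynomial.pderiv 1 p

@[simp] theorem evalPt_pU (x y : ℝ) : evalPt pU x y = x + 1 := by simp [pU]
@[simp] theorem evalPt_pV (x y : ℝ) : evalPt pV x y = 1 - y := by simp [pV]
@[simp] theorem evalPt_pW (x y : ℝ) : evalPt pW x y = y - x := by simp [pW]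

theorem integral_deriv_eq_zero {F f : ℝ → ℝ} {a b : ℝ} (hab : a ≤ b)
    (hF : ContinuousOn F (Set.Icc a b)) (hd : ∀ x ∈ Set.Ioo a b, HasDerivAt F (f x) x)
    (ha : F a = 0) (hb : F b = 0) (hint : Integrable (Set.indicator (Set.Icc a b) f)) :
    ∫ x, Set.indicator (Set.Icc a b) f x = 0 := by
  rw [integrable_indicator_iff measurableSet_Icc, integrableOn_Icc_iff_integrableOn_Ioc,
    ← intervalIntegrable_iff_integrableOn_Ioc_of_le hab] at hint
  rw [integral_indicator measurableSet_Icc, integral_Icc_eq_integral_Ioc,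
    ← intervalIntegral.integral_of_le hab,
    intervalIntegral.integral_eq_sub_of_hasDerivAt_of_le hab hF hd hint, ha, hb, sub_zero]

/-- Formal derivative of `u^β w^γ p` in the direction of `x`. -/
def raiseX (β γ : ℝ) (p : Poly2) : Poly2 :=
  (MvPolynomial.C β * pW - MvPolynomial.C γ * pU) * p + pU * pW * dX p

/-- Formal derivative of `v^α w^γ p` in the direction of `y`. -/
def raiseY (α γ : ℝ) (p : Poly2) : Poly2 :=
  (MvPolynomial.C γ * pV - MvPolynomial.C α * pW) * p + pV * pW * dY p

theorem hasDerivAt_raiseX (α β γ : ℝ) (p : Poly2) {x y : ℝ} (hx : -1 < x) (hxy : x < y) :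
    HasDerivAt (fun s => (1 - y) ^ α * (s + 1) ^ (β + 1) * (y - s) ^ (γ + 1) * evalPt p s y)
      (evalPt (raiseX (β + 1) (γ + 1) p) x y * jacobiWeight α β γ x y) x := by
  have hu : 0 < x + 1 := by linarith
  have hw : 0 < y - x := by linarith
  have d1 : HasDerivAt (fun s : ℝ => (s + 1) ^ (β + 1)) ((β + 1) * (x + 1) ^ β) x := by
    simpa using ((hasDerivAt_id x).add_const 1).rpow_const (p := β + 1) (Or.inl hu.ne')
  have d2 : HasDerivAt (fun s : ℝ => (y - s) ^ (γ + 1)) (-((γ + 1) * (y - x) ^ γ)) x := by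
    exact (((hasDerivAt_id x).const_sub y).rpow_const (p := γ + 1) (Or.inl hw.ne')).congr_deriv
      (by simp; ring)
  have := ((d1.const_mul ((1 - y) ^ α)).mul d2).mul (hasDerivAt_evalPt_fst p x y)
  refine this.congr_deriv ?_
  simp only [raiseX, jacobiWeight, dX, evalPt_add, evalPt_mul, evalPt_sub, evalPt_C, evalPt_pU,
    evalPt_pW, Real.rpow_add hu, Real.rpow_add hw, Real.rpow_one, Pi.mul_apply]
  ring

theorem hasDerivAt_raiseY (α β γ : ℝ) (p : Poly2) {x y : ℝ} (hxy : x < y) (hy : y < 1) :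
    HasDerivAt (fun t => (1 - t) ^ (α + 1) * (x + 1) ^ β * (t - x) ^ (γ + 1) * evalPt p x t)
      (evalPt (raiseY (α + 1) (γ + 1) p) x y * jacobiWeight α β γ x y) y := by
  have hv : 0 < 1 - y := by linarith
  have hw : 0 < y - x := by linarith
  have d1 : HasDerivAt (fun t : ℝ => (1 - t) ^ (α + 1)) (-((α + 1) * (1 - y) ^ α)) y := by
    exact (((hasDerivAt_id y).const_sub 1).rpow_const (p := α + 1) (Or.inl hv.ne')).congr_deriv
      (by simp; ring)
  have d2 : HasDerivAt (fun t : ℝ => (t - x) ^ (γ + 1)) ((γ + 1) * (y - x) ^ γ) y := by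
    simpa using ((hasDerivAt_id y).sub_const x).rpow_const (p := γ + 1) (Or.inl hw.ne')
  have := ((d1.mul_const ((x + 1) ^ β)).mul d2).mul (hasDerivAt_evalPt_snd p x y)
  refine this.congr_deriv ?_
  simp only [raiseY, jacobiWeight, dY, evalPt_add, evalPt_mul, evalPt_sub, evalPt_C, evalPt_pV,
    evalPt_pW, Real.rpow_add hv, Real.rpow_add hw, Real.rpow_one, Pi.mul_apply]
  ring

/-- On each horizontal chord the integrand is the `x`-derivative of `(1-y)^α (x+1)^(β+1) (y-x)^(γ+1)
p`, which vanishes at the ends `x = -1` and `x = y` because `β+1` and `γ+1` are positive. Fubini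
concludes. -/
theorem jacobiInt_raiseX {α β γ : ℝ} (h : Admissible α β γ) (p : Poly2) :
    jacobiInt α β γ h (raiseX (β + 1) (γ + 1) p) = 0 := by
  obtain ⟨hα, hβ, hγ⟩ := id h
  have hm := isCompact_triangle.isClosed.measurableSet
  set F : ℝ × ℝ → ℝ := fun z =>
    evalPt (raiseX (β + 1) (γ + 1) p) z.1 z.2 * jacobiWeight α β γ z.1 z.2 with hF
  have hint : Integrable (triangle.indicator F) :=
    (integrableOn_evalPt_mul_jacobiWeight h _).integrable_indicator hm
  rw [jacobiInt_apply, ← integral_indicator hm, Measure.volume_eq_prod, integral_prod_symm _ hint]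
  refine integral_eq_zero_of_ae ?_
  filter_upwards [hint.prod_left_ae] with y hy
  by_cases hy1 : -1 ≤ y ∧ y ≤ 1
  · have e : (fun x => triangle.indicator F (x, y)) =
        Set.indicator (Set.Icc (-1) y) fun x => F (x, y) := by
      funext x
      by_cases hx : x ∈ Set.Icc (-1) y
      · rw [Set.indicator_of_mem hx,
          Set.indicator_of_mem (show (x, y) ∈ triangle from ⟨hx.2, hy1.2, hx.1, hx.2.trans hy1.2⟩)]
      · rw [Set.indicator_of_notMem hx, Set.indicator_of_notMem]
        exact fun h => hx ⟨h.2.2.1, h.1⟩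
    rw [e] at hy
    simp only [Pi.zero_apply]
    rw [e]
    refine integral_deriv_eq_zero (F := fun s => (1 - y) ^ α * (s + 1) ^ (β + 1) *
      (y - s) ^ (γ + 1) * evalPt p s y) hy1.1 ?_
      (fun x hx => hasDerivAt_raiseX α β γ p hx.1 hx.2) ?_ ?_ hy
    · have c1 : Continuous fun s : ℝ => (s + 1) ^ (β + 1) :=
        Continuous.rpow_const (by fun_prop) fun _ => Or.inr (by linarith)
      have c2 : Continuous fun s : ℝ => (y - s) ^ (γ + 1) :=
        Continuous.rpow_const (by fun_prop) fun _ => Or.inr (by linarith)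
      have c3 : Continuous fun s : ℝ => evalPt p s y :=
        continuous_iff_continuousAt.2 fun s => (hasDerivAt_evalPt_fst p s y).continuousAt
      exact (((continuous_const.mul c1).mul c2).mul c3).continuousOn
    · rw [neg_add_cancel, Real.zero_rpow (by linarith)]
      ring
    · rw [sub_self, Real.zero_rpow (by linarith)]
      ring
  · have e : (fun x => triangle.indicator F (x, y)) = fun _ => 0 := by
      funext x
      refine Set.indicator_of_notMem (fun hz => hy1 ?_) _
      obtain ⟨h1, h2, h3, h4⟩ := hz
      exact ⟨h3.trans h1, h2⟩
    rw [e]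
    simp

/-- The same argument on vertical chords, whose ends are `y = x` and `y = 1`. -/
theorem jacobiInt_raiseY {α β γ : ℝ} (h : Admissible α β γ) (p : Poly2) :
    jacobiInt α β γ h (raiseY (α + 1) (γ + 1) p) = 0 := by
  obtain ⟨hα, hβ, hγ⟩ := id h
  have hm := isCompact_triangle.isClosed.measurableSet
  set F : ℝ × ℝ → ℝ := fun z =>
    evalPt (raiseY (α + 1) (γ + 1) p) z.1 z.2 * jacobiWeight α β γ z.1 z.2 with hF
  have hint : Integrable (triangle.indicator F) :=
    (integrableOn_evalPt_mul_jacobiWeight h _).integrable_indicator hm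
  rw [jacobiInt_apply, ← integral_indicator hm, Measure.volume_eq_prod, integral_prod _ hint]
  refine integral_eq_zero_of_ae ?_
  filter_upwards [hint.prod_right_ae] with x hx
  by_cases hx1 : -1 ≤ x ∧ x ≤ 1
  · have e : (fun y => triangle.indicator F (x, y)) =
        Set.indicator (Set.Icc x 1) fun y => F (x, y) := by
      funext y
      by_cases hy : y ∈ Set.Icc x 1
      · rw [Set.indicator_of_mem hy,
          Set.indicator_of_mem (show (x, y) ∈ triangle from ⟨hy.1, hy.2, hx1⟩)]
      · rw [Set.indicator_of_notMem hy, Set.indicator_of_notMem]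
        exact fun h => hy ⟨h.1, h.2.1⟩
    rw [e] at hx
    simp only [Pi.zero_apply]
    rw [e]
    refine integral_deriv_eq_zero (F := fun t => (1 - t) ^ (α + 1) * (x + 1) ^ β *
      (t - x) ^ (γ + 1) * evalPt p x t) hx1.2 ?_
      (fun y hy => hasDerivAt_raiseY α β γ p hy.1 hy.2) ?_ ?_ hx
    · have c1 : Continuous fun t : ℝ => (1 - t) ^ (α + 1) :=
        Continuous.rpow_const (by fun_prop) fun _ => Or.inr (by linarith)
      have c2 : Continuous fun t : ℝ => (t - x) ^ (γ + 1) :=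
        Continuous.rpow_const (by fun_prop) fun _ => Or.inr (by linarith)
      have c3 : Continuous fun t : ℝ => evalPt p x t :=
        continuous_iff_continuousAt.2 fun t => (hasDerivAt_evalPt_snd p x t).continuousAt
      exact (((c1.mul continuous_const).mul c2).mul c3).continuousOn
    · rw [sub_self, Real.zero_rpow (by linarith : γ + 1 ≠ 0)]
      ring
    · rw [sub_self, Real.zero_rpow (by linarith : α + 1 ≠ 0)]
      ring
  · have e : (fun y => triangle.indicator F (x, y)) = fun _ => 0 := by
      funext y
      exact Set.indicator_of_notMem (fun hz => hx1 hz.2.2) _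
    rw [e]
    simp

/-! ### The Appell operator on polynomials -/


@[simp] theorem dX_pU : dX pU = 1 := by simp [pU, MvPolynomial.pderiv_X]
@[simp] theorem dY_pU : dY pU = 0 := by simp [pU, MvPolynomial.pderiv_X]
@[simp] theorem dX_pV : dX pV = 0 := by simp [pV, MvPolynomial.pderiv_X]
@[simp] theorem dY_pV : dY pV = -1 := by simp [pV, MvPolynomial.pderiv_X]

/-- Removes the linear dependence between the three boundary forms, so that `ring` can compare
polynomials in them. -/
theorem pW_eq : pW = 2 - pU - pV := by simp only [pU, pV, pW]; ring

theorem C_two : (C 2 : Poly2) = 2 := map_ofNat _ 2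
theorem C_three : (C 3 : Poly2) = 3 := map_ofNat _ 3

theorem dX_C (c : ℝ) : dX (C c) = 0 := MvPolynomial.pderiv_C
theorem dY_C (c : ℝ) : dY (C c) = 0 := MvPolynomial.pderiv_C

@[simp] theorem dX_two : dX 2 = 0 := C_two ▸ dX_C 2
@[simp] theorem dY_two : dY 2 = 0 := C_two ▸ dY_C 2

theorem dX_mul (p r : Poly2) : dX (p * r) = dX p * r + p * dX r := by
  simp [dX, Derivation.leibniz]; ring

theorem dY_mul (p r : Poly2) : dY (p * r) = dY p * r + p * dY r := by
  simp [dY, Derivation.leibniz]; ring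

theorem dX_C_mul (a : ℝ) (p : Poly2) : dX (C a * p) = C a * dX p := by
  rw [dX_mul, dX_C, zero_mul, zero_add]

theorem dY_C_mul (a : ℝ) (p : Poly2) : dY (C a * p) = C a * dY p := by
  rw [dY_mul, dY_C, zero_mul, zero_add]

theorem dY_dX (p : Poly2) : dY (dX p) = dX (dY p) := by
  induction p using MvPolynomial.induction_on with
  | C a => simp [dX, dY]
  | add p r hp hr => simp only [dX, dY, map_add] at *; rw [hp, hr]
  | mul_X p i hp =>
    have h : ∀ a b : Fin 2, MvPolynomial.pderiv a (MvPolynomial.pderiv b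
        (MvPolynomial.X i : Poly2)) = 0 := fun a b => by
      rw [MvPolynomial.pderiv_X]
      by_cases hib : i = b
      · subst hib; simp
      · simp [Ne.symm hib]
    simp only [dX_mul, dY_mul, map_add] at *
    have h1 : dY (dX (MvPolynomial.X i)) = 0 := h 1 0
    have h2 : dX (dY (MvPolynomial.X i)) = 0 := h 0 1
    rw [hp, h1, h2]
    ring

/-- The coefficient of the zeroth order term of the Appell equation. -/
def appellEigen (α β γ : ℝ) (N : ℕ) : ℝ := N * (α + β + γ + N + 2)

/-- The differential operator of the Appell equation. -/
def appellOp (α β γ : ℝ) : Poly2 →ₗ[ℝ] Poly2 where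
  toFun p := pU * (pU - 2) * dX (dX p) + pV * (pV - 2) * dY (dY p) - 2 * (pU * pV) * dX (dY p)
    + (C (α + β + γ + 3) * pU - C (2 * β + 2)) * dX p
    - (C (α + β + γ + 3) * pV - C (2 * α + 2)) * dY p
  map_add' p r := by simp only [map_add]; ring
  map_smul' c p := by
    simp only [dX_C_mul, dY_C_mul, MvPolynomial.smul_eq_C_mul, RingHom.id_apply]; ring

theorem appellOp_apply (α β γ : ℝ) (p : Poly2) : appellOp α β γ p =
    pU * (pU - 2) * dX (dX p) + pV * (pV - 2) * dY (dY p) - 2 * (pU * pV) * dX (dY p)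
    + (C (α + β + γ + 3) * pU - C (2 * β + 2)) * dX p
    - (C (α + β + γ + 3) * pV - C (2 * α + 2)) * dY p := rfl

theorem deriv_evalPt_fst (p : Poly2) (x y : ℝ) :
    deriv (fun s => evalPt p s y) x = evalPt (dX p) x y := (hasDerivAt_evalPt_fst p x y).deriv

theorem deriv_evalPt_snd (p : Poly2) (x y : ℝ) :
    deriv (fun t => evalPt p x t) y = evalPt (dY p) x y := (hasDerivAt_evalPt_snd p x y).deriv

theorem appellEquation_evalPt (α β γ : ℝ) (N : ℕ) (p : Poly2) (x y : ℝ) :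
    appellEquation N α β γ (evalPt p) x y =
      evalPt (appellOp α β γ p - C (appellEigen α β γ N) * p) x y := by
  have h2 : evalPt 2 x y = 2 := by
    rw [← C_two, evalPt_C]
  simp only [appellEquation, deriv_evalPt_fst, deriv_evalPt_snd, appellOp_apply, evalPt_add,
    evalPt_sub, evalPt_mul, evalPt_C, evalPt_pU, evalPt_pV, h2, appellEigen]
  ring

/-! ### Expansions in powers of `x + 1` and `1 - y` -/

theorem totalDegree_pU_pow_mul_pV_pow (i j : ℕ) : (pU ^ i * pV ^ j).totalDegree ≤ i + j := by
  have hU : pU.totalDegree ≤ 1 := (MvPolynomial.totalDegree_add _ _).trans (by simp)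
  have hV : pV.totalDegree ≤ 1 := (MvPolynomial.totalDegree_sub _ _).trans (by simp)
  refine (MvPolynomial.totalDegree_mul _ _).trans (add_le_add ?_ ?_)
  · exact (MvPolynomial.totalDegree_pow _ _).trans (by nlinarith)
  · exact (MvPolynomial.totalDegree_pow _ _).trans (by nlinarith)

theorem totalDegree_C_mul_le (a : ℝ) (p : Poly2) : (C a * p).totalDegree ≤ p.totalDegree :=
  (MvPolynomial.totalDegree_mul _ _).trans (by simp)

theorem aeval_eq_sum (f g : Poly2) (p : Poly2) : MvPolynomial.aeval ![f, g] p =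
    ∑ s ∈ p.support, C (p.coeff s) * (f ^ s 0 * g ^ s 1) := by
  rw [MvPolynomial.aeval_def, MvPolynomial.eval₂_eq']
  simp [Fin.prod_univ_two, MvPolynomial.algebraMap_eq]

theorem le_totalDegree_of_mem {p : Poly2} {s : Fin 2 →₀ ℕ} (hs : s ∈ p.support) :
    s 0 + s 1 ≤ p.totalDegree := by
  have := MvPolynomial.le_totalDegree hs
  rwa [Finsupp.sum_fintype _ _ (fun _ => rfl), Fin.sum_univ_two] at this

/-- A polynomial of total degree at most `M` is a combination of `(x + 1)^i (1 - y)^j`,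
`i + j ≤ M`. -/
theorem poly2_induction {M : ℕ} {P : Poly2 → Prop} (h0 : P 0)
    (hadd : ∀ p r, P p → P r → P (p + r))
    (hmon : ∀ (a : ℝ) (i j : ℕ), i + j ≤ M → P (C a * (pU ^ i * pV ^ j)))
    (p : Poly2) (hp : p.totalDegree ≤ M) : P p := by
  set r := MvPolynomial.aeval ![(MvPolynomial.X 0 - 1 : Poly2), 1 - MvPolynomial.X 1] p with hr
  have hpr : p = MvPolynomial.aeval ![pU, pV] r := by
    rw [hr, ← AlgHom.comp_apply]
    have : (MvPolynomial.aeval ![pU, pV]).comp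
        (MvPolynomial.aeval ![(MvPolynomial.X 0 - 1 : Poly2), 1 - MvPolynomial.X 1]) =
        AlgHom.id ℝ Poly2 := by
      refine MvPolynomial.algHom_ext fun i => ?_
      fin_cases i <;> simp [pU, pV]
    rw [this]
    rfl
  have hrd : r.totalDegree ≤ M := by
    rw [hr, aeval_eq_sum]
    refine MvPolynomial.totalDegree_finsetSum_le fun s hs => ?_
    have h1 : (MvPolynomial.X 0 - 1 : Poly2).totalDegree ≤ 1 :=
      (MvPolynomial.totalDegree_sub _ _).trans (by simp)
    have h2 : (1 - MvPolynomial.X 1 : Poly2).totalDegree ≤ 1 :=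
      (MvPolynomial.totalDegree_sub _ _).trans (by simp)
    have h3 := le_totalDegree_of_mem hs
    refine (totalDegree_C_mul_le _ _).trans ((MvPolynomial.totalDegree_mul _ _).trans ?_)
    have h4 := MvPolynomial.totalDegree_pow (MvPolynomial.X 0 - 1 : Poly2) (s 0)
    have h5 := MvPolynomial.totalDegree_pow (1 - MvPolynomial.X 1 : Poly2) (s 1)
    nlinarith
  rw [hpr, aeval_eq_sum]
  have : ∀ t : Finset (Fin 2 →₀ ℕ), t ⊆ r.support →
      P (∑ s ∈ t, C (r.coeff s) * (pU ^ s 0 * pV ^ s 1)) := by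
    classical
    intro t
    induction t using Finset.induction_on with
    | empty => intro _; simpa using h0
    | insert s t hs ih =>
      intro ht
      rw [Finset.sum_insert hs]
      exact hadd _ _ (hmon _ _ _ ((le_totalDegree_of_mem (ht (Finset.mem_insert_self s t))).trans
        hrd)) (ih fun a ha => ht (Finset.mem_insert_of_mem ha))
  exact this _ (Finset.Subset.refl _)

theorem dX_uv (i j : ℕ) : dX (pU ^ i * pV ^ j) = C (i : ℝ) * (pU ^ (i - 1) * pV ^ j) := by
  have h1 : MvPolynomial.pderiv 0 pU = 1 := dX_pU
  have h2 : MvPolynomial.pderiv 0 pV = 0 := dX_pV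
  rw [dX_mul, dX, dX, Derivation.leibniz_pow, Derivation.leibniz_pow, h1, h2]
  simp [mul_assoc]

theorem dY_uv (i j : ℕ) : dY (pU ^ i * pV ^ j) = -(C (j : ℝ) * (pU ^ i * pV ^ (j - 1))) := by
  have h1 : MvPolynomial.pderiv 1 pU = 0 := dY_pU
  have h2 : MvPolynomial.pderiv 1 pV = -1 := dY_pV
  rw [dY_mul, dY, dY, Derivation.leibniz_pow, Derivation.leibniz_pow, h1, h2]
  simp
  ring

theorem dX_neg (p : Poly2) : dX (-p) = -dX p := map_neg _ _
theorem dY_neg (p : Poly2) : dY (-p) = -dY p := map_neg _ _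

/-- The operator is triangular in this basis, with diagonal entry depending only on `i+j`. This
yields both the degree statements and the recurrences of the monic family. -/
theorem appellOp_uv (α β γ : ℝ) (i j : ℕ) : appellOp α β γ (pU ^ i * pV ^ j) =
    C (appellEigen α β γ (i + j)) * (pU ^ i * pV ^ j)
      - C (2 * i * (i + β)) * (pU ^ (i - 1) * pV ^ j)
      - C (2 * j * (j + α)) * (pU ^ i * pV ^ (j - 1)) := by
  rw [appellOp_apply]
  simp only [dX_uv, dY_uv, dX_neg, dY_neg, dX_C_mul, dY_C_mul, appellEigen]
  -- Exponents such as `i - 1` are truncated, so `0`, `1` and larger values are separate cases.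
  rcases i with _ | _ | i <;> rcases j with _ | _ | j <;>
    simp only [Nat.cast_zero, Nat.cast_add, Nat.cast_one, map_add, map_mul, map_one, map_zero,
      map_natCast, Nat.add_sub_cancel, pow_succ, pow_zero, zero_tsub, zero_add, C_two, C_three] <;> ring

/-! ### Symmetry of the operator and its consequences -/

theorem jacobiInt_C_mul {α β γ : ℝ} (h : Admissible α β γ) (c : ℝ) (p : Poly2) :
    jacobiInt α β γ h (C c * p) = c * jacobiInt α β γ h p := by
  rw [← MvPolynomial.smul_eq_C_mul, map_smul, smul_eq_mul]

/-- Integration by parts in the direction `∂x + ∂y`, which is tangent to the side `x = y`, so the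
boundary factor is `uv` without `w`. On monomials it follows algebraically: eliminating the integral
of `w u^i v^j` between the two coordinate identities leaves `γ+1` times the claim. -/
theorem jacobiInt_raiseXY {α β γ : ℝ} (h : Admissible α β γ) (p : Poly2) :
    jacobiInt α β γ h ((C (β + 1) * pV - C (α + 1) * pU) * p + pU * pV * (dX p + dY p)) = 0 := by
  refine poly2_induction (M := p.totalDegree) (P := fun p => jacobiInt α β γ h
    ((C (β + 1) * pV - C (α + 1) * pU) * p + pU * pV * (dX p + dY p)) = 0) ?_ ?_ ?_ p le_rfl
  · simp
  · intro p r hp hr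
    have : (C (β + 1) * pV - C (α + 1) * pU) * (p + r) + pU * pV * (dX (p + r) + dY (p + r)) =
      ((C (β + 1) * pV - C (α + 1) * pU) * p + pU * pV * (dX p + dY p)) +
      ((C (β + 1) * pV - C (α + 1) * pU) * r + pU * pV * (dX r + dY r)) := by
      simp only [map_add]; ring
    rw [this, map_add, hp, hr, add_zero]
  · intro a i j _
    have h1 := jacobiInt_raiseX h (pU ^ i * pV ^ j)
    have h2 := jacobiInt_raiseY h (pU ^ i * pV ^ j)
    have hUi : ∀ i : ℕ, pU * (C (i : ℝ) * pU ^ (i - 1)) = C (i : ℝ) * pU ^ i := by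
      rintro (_ | i)
      · simp
      · rw [Nat.add_sub_cancel, pow_succ]; ring
    have hVj : ∀ i : ℕ, pV * (C (i : ℝ) * pV ^ (i - 1)) = C (i : ℝ) * pV ^ i := by
      rintro (_ | i)
      · simp
      · rw [Nat.add_sub_cancel, pow_succ]; ring
    have e1 : raiseX (β + 1) (γ + 1) (pU ^ i * pV ^ j) =
        C (β + 1 + i) * (pW * (pU ^ i * pV ^ j)) - C (γ + 1) * (pU * (pU ^ i * pV ^ j)) := by
      rw [raiseX, dX_uv, map_add C (β + 1)]
      linear_combination pW * pV ^ j * hUi i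
    have e2 : raiseY (α + 1) (γ + 1) (pU ^ i * pV ^ j) =
        C (γ + 1) * (pV * (pU ^ i * pV ^ j)) - C (α + 1 + j) * (pW * (pU ^ i * pV ^ j)) := by
      rw [raiseY, dY_uv, map_add C (α + 1)]
      linear_combination -pW * pU ^ i * hVj j
    have e3 : (C (β + 1) * pV - C (α + 1) * pU) * (C a * (pU ^ i * pV ^ j)) +
        pU * pV * (dX (C a * (pU ^ i * pV ^ j)) + dY (C a * (pU ^ i * pV ^ j))) =
        C a * (C (β + 1 + i) * (pV * (pU ^ i * pV ^ j)) -
          C (α + 1 + j) * (pU * (pU ^ i * pV ^ j))) := by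
      rw [dX_C_mul, dY_C_mul, dX_uv, dY_uv, map_add C (α + 1), map_add C (β + 1)]
      linear_combination C a * pV * pV ^ j * hUi i - C a * pU * pU ^ i * hVj j
    rw [e1, map_sub, jacobiInt_C_mul, jacobiInt_C_mul] at h1
    rw [e2, map_sub, jacobiInt_C_mul, jacobiInt_C_mul] at h2
    rw [e3, jacobiInt_C_mul, map_sub, jacobiInt_C_mul, jacobiInt_C_mul]
    have hγ : γ + 1 ≠ 0 := by have := h.2.2; intro h; linarith
    have : (γ + 1) * ((β + 1 + i) * jacobiInt α β γ h (pV * (pU ^ i * pV ^ j)) -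
        (α + 1 + j) * jacobiInt α β γ h (pU * (pU ^ i * pV ^ j))) = 0 := by
      linear_combination (α + 1 + j) * h1 + (β + 1 + i) * h2
    rw [(mul_eq_zero.1 this).resolve_left hγ, mul_zero]

/-- The Wronskian `p·Lr - Lp·r`, with `L` the Appell operator, is a sum of three divergences along
`∂x`, `∂y` and `∂x+∂y` with boundary factors `uw`, `vw`, `uv`. Each integrates to zero. -/
theorem jacobiInt_appellOp_symm {α β γ : ℝ} (h : Admissible α β γ) (p r : Poly2) :
    jacobiInt α β γ h (appellOp α β γ p * r) = jacobiInt α β γ h (p * appellOp α β γ r) := by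
  have h1 := jacobiInt_raiseX h (dX p * r - p * dX r)
  have h2 := jacobiInt_raiseY h (dY p * r - p * dY r)
  have h3 := jacobiInt_raiseXY h ((dX p * r - p * dX r) + (dY p * r - p * dY r))
  have e : p * appellOp α β γ r - appellOp α β γ p * r =
      raiseX (β + 1) (γ + 1) (dX p * r - p * dX r) + raiseY (α + 1) (γ + 1) (dY p * r - p * dY r) +
      ((C (β + 1) * pV - C (α + 1) * pU) * ((dX p * r - p * dX r) + (dY p * r - p * dY r)) +
        pU * pV * (dX ((dX p * r - p * dX r) + (dY p * r - p * dY r)) +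
          dY ((dX p * r - p * dX r) + (dY p * r - p * dY r)))) := by
    simp only [raiseX, raiseY, appellOp_apply, map_add, map_sub, dX_mul, dY_mul, dY_dX, pW_eq,
      map_mul, map_one, C_two, C_three]
    ring
  have := congrArg (jacobiInt α β γ h) e
  rw [map_add, map_add, h1, h2, h3, map_sub] at this
  linarith

/-! ### Degree and orthogonality from the eigenvalue equation -/

theorem appellEigen_injective {α β γ : ℝ} (h : Admissible α β γ) {M N : ℕ}
    (e : appellEigen α β γ M = appellEigen α β γ N) : M = N := by
  obtain ⟨h1, h2, h3⟩ := h
  by_contra hne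
  have h4 : (1 : ℝ) ≤ (M : ℝ) + N := by
    have : 1 ≤ M + N := by omega
    exact_mod_cast this
  -- The second factor is positive: distinct indices have sum at least `1`, and `α+β+γ+3 > 0`.
  have h5 : ((M : ℝ) - N) * (M + N + (α + β + γ + 2)) = 0 := by
    simp only [appellEigen] at e
    linear_combination e
  rcases mul_eq_zero.1 h5 with h | h
  · exact hne (by exact_mod_cast sub_eq_zero.1 h)
  · linarith

theorem appellOp_C (α β γ c : ℝ) : appellOp α β γ (C c) = 0 := by
  simp [appellOp_apply]

theorem totalDegree_appellOp_sub (α β γ : ℝ) {M : ℕ} {p : Poly2} (hp : p.totalDegree ≤ M + 1) :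
    (appellOp α β γ p - C (appellEigen α β γ (M + 1)) * p).totalDegree ≤ M := by
  simp only [← MvPolynomial.mem_restrictTotalDegree]
  refine poly2_induction (M := M + 1) (P := fun p => appellOp α β γ p -
    C (appellEigen α β γ (M + 1)) * p ∈ MvPolynomial.restrictTotalDegree (Fin 2) ℝ M)
    ?_ ?_ ?_ p hp
  · simp
  · intro p r hp hr
    have := add_mem hp hr
    rwa [map_add, mul_add, add_sub_add_comm]
  · intro a i j hij
    rw [← MvPolynomial.smul_eq_C_mul (pU ^ i * pV ^ j) a, map_smul, appellOp_uv, mul_smul_comm,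
      ← smul_sub]
    refine Submodule.smul_mem _ _ ?_
    have mono : ∀ (c : ℝ) (i j : ℕ), i + j ≤ M →
        C c * (pU ^ i * pV ^ j) ∈ MvPolynomial.restrictTotalDegree (Fin 2) ℝ M := by
      intro c i j hij
      rw [MvPolynomial.mem_restrictTotalDegree]
      exact (totalDegree_C_mul_le _ _).trans ((totalDegree_pU_pow_mul_pV_pow i j).trans hij)
    have e : ∀ A B D : Poly2, A - B - D - C (appellEigen α β γ (M + 1)) * (pU ^ i * pV ^ j) =
        (A - C (appellEigen α β γ (M + 1)) * (pU ^ i * pV ^ j)) - B - D := fun A B D => by ring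
    rw [e, ← sub_mul, ← map_sub]
    refine sub_mem (sub_mem ?_ ?_) ?_
    · rcases Nat.lt_or_ge (i + j) (M + 1) with hlt | hge
      · exact mono _ _ _ (by omega)
      · rw [le_antisymm hij hge, sub_self]
        simp
    · rcases i with _ | i
      · simp
      · exact mono _ _ _ (by omega)
    · rcases j with _ | j
      · simp
      · exact mono _ _ _ (by omega)

/-- Polynomial solutions of the Appell equation are orthogonal to polynomials of lower degree. -/
theorem jacobiInt_mul_eq_zero {α β γ : ℝ} (h : Admissible α β γ) {N : ℕ} {p : Poly2}
    (hp : appellOp α β γ p = C (appellEigen α β γ N) * p) (r : Poly2) (hr : r.totalDegree < N) :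
    jacobiInt α β γ h (p * r) = 0 := by
  suffices H : ∀ M, M < N → ∀ r : Poly2, r.totalDegree ≤ M → jacobiInt α β γ h (p * r) = 0 from
    H _ hr r le_rfl
  -- By symmetry, pairing `p` with `(L - λ_M) r` gives `(λ_N - λ_M)` times its pairing with `r`.
  -- When `r` has degree at most `M` the operator `L - λ_M` lowers the degree, so induction on `M`
  -- applies.
  have reduce : ∀ (M : ℕ) (r : Poly2), M < N →
      jacobiInt α β γ h (p * (appellOp α β γ r - C (appellEigen α β γ M) * r)) = 0 →
      jacobiInt α β γ h (p * r) = 0 := by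
    intro M r hM h0
    have hs := jacobiInt_appellOp_symm h p r
    have e1 : C (appellEigen α β γ N) * p * r = C (appellEigen α β γ N) * (p * r) := by ring
    have e2 : p * (appellOp α β γ r - C (appellEigen α β γ M) * r) =
        p * appellOp α β γ r - C (appellEigen α β γ M) * (p * r) := by ring
    rw [hp, e1, jacobiInt_C_mul] at hs
    rw [e2, map_sub, jacobiInt_C_mul, ← hs, ← sub_mul] at h0
    refine (mul_eq_zero.1 h0).resolve_left fun h' => ?_
    exact hM.ne' (appellEigen_injective h (sub_eq_zero.1 h'))
  intro M
  induction M with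
  | zero =>
    intro hM r hr
    refine reduce 0 r hM ?_
    rw [(MvPolynomial.totalDegree_eq_zero_iff_eq_C (p := r)).1 (Nat.le_zero.1 hr), appellOp_C]
    simp [appellEigen]
  | succ M ih =>
    intro hM r hr
    exact reduce (M + 1) r hM (ih (by omega) _ (totalDegree_appellOp_sub α β γ hr))

/-- Nonzero polynomial solutions of the Appell equation have total degree `N`. -/
theorem totalDegree_eq_of_appellOp {α β γ : ℝ} (h : Admissible α β γ) {N : ℕ} {p : Poly2}
    (hp : appellOp α β γ p = C (appellEigen α β γ N) * p) (hp0 : p ≠ 0) : p.totalDegree = N := by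
  refine (appellEigen_injective h (M := N) (N := p.totalDegree) ?_).symm
  by_contra hne
  rcases hM : p.totalDegree with _ | M
  · rw [hM] at hne
    rw [(MvPolynomial.totalDegree_eq_zero_iff_eq_C (p := p)).1 hM, appellOp_C] at hp
    have h0 : MvPolynomial.coeff 0 p ≠ 0 := fun h0 => hp0 (by
      rw [(MvPolynomial.totalDegree_eq_zero_iff_eq_C (p := p)).1 hM, h0, map_zero])
    rw [← map_mul, eq_comm, MvPolynomial.C_eq_zero] at hp
    refine hne (((mul_eq_zero.1 hp).resolve_right h0).trans ?_)
    simp [appellEigen]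
  -- If the eigenvalues differed, `(λ_N - λ_{M+1}) p` would have degree at most `M`, contradicting
  -- that `p` has degree `M+1`.
  · rw [hM] at hne
    have := totalDegree_appellOp_sub α β γ hM.le
    rw [hp, ← sub_mul, ← map_sub, ← MvPolynomial.smul_eq_C_mul] at this
    have h2 : p.totalDegree ≤ M := by
      have h3 := MvPolynomial.totalDegree_smul_le
        (appellEigen α β γ N - appellEigen α β γ (M + 1))⁻¹
        ((appellEigen α β γ N - appellEigen α β γ (M + 1)) • p)
      rw [inv_smul_smul₀ (sub_ne_zero.2 hne)] at h3
      exact h3.trans this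
    omega

theorem isOrthogonalSolutionSystem_of {α β γ : ℝ} (h : Admissible α β γ) {P : ℕ → ℕ → Poly2}
    (hind : ∀ N, LinearIndependent ℝ fun k : Fin (N + 1) => P N k)
    (hP : ∀ N, ∀ k ≤ N, appellOp α β γ (P N k) = C (appellEigen α β γ N) * P N k) :
    IsOrthogonalSolutionSystem α β γ P := by
  intro N
  refine ⟨hind N, fun k hk => ⟨?_, fun x y => ?_, fun r => ⟨?_, fun hr => ?_⟩⟩⟩
  · exact totalDegree_eq_of_appellOp h (hP N k hk) ((hind N).ne_zero ⟨k, by omega⟩)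
  · rw [appellEquation_evalPt, hP N k hk, sub_self, evalPt_zero]
  · simpa using integrableOn_evalPt_mul_jacobiWeight h (P N k * r)
  · have := jacobiInt_mul_eq_zero h (hP N k hk) r hr
    simpa [jacobiInt_apply] using this

/-! ### The monic family -/

theorem poch_neg (n i : ℕ) : poch (-(n : ℝ)) i = (-1) ^ i * i.factorial * n.choose i := by
  induction i with
  | zero => simp [poch_zero]
  | succ i ih =>
    have h : (n.choose (i + 1) : ℝ) * (i + 1) = n.choose i * (n - i) := by
      rcases le_or_gt i n with hi | hi
      · have := Nat.choose_succ_right_eq n i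
        rw [← Nat.cast_sub hi]
        exact_mod_cast this
      · rw [Nat.choose_eq_zero_of_lt hi, Nat.choose_eq_zero_of_lt (by omega)]
        simp
    rw [poch_succ, ih, Nat.factorial_succ, pow_succ]
    push_cast
    linear_combination (-1) ^ i * (i.factorial : ℝ) * h

theorem poch_neg_eq_zero {n i : ℕ} (h : n < i) : poch (-(n : ℝ)) i = 0 := by
  rw [poch_neg, Nat.choose_eq_zero_of_lt h]
  simp

/-- The coefficient of `(x + 1)^i (1 - y)^j` in the monic Jacobi polynomial. -/
def monicCoeff (n m : ℕ) (α β γ : ℝ) (i j : ℕ) : ℝ :=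
  (-1) ^ n * 2 ^ (n + m) * (poch (α + 1) m * poch (β + 1) n /
      poch (α + β + γ + m + n + 2) (n + m)) *
    (poch (α + β + γ + m + n + 2) (i + j) * poch (-(n : ℝ)) i * poch (-(m : ℝ)) j /
      (poch (β + 1) i * poch (α + 1) j) / (2 ^ (i + j) * i.factorial * j.factorial))

/-- The monic Jacobi polynomials as elements of the polynomial ring. -/
def monicPoly (α β γ : ℝ) (n m : ℕ) : Poly2 :=
  ∑ i ∈ Finset.range (n + 1), ∑ j ∈ Finset.range (m + 1),
    C (monicCoeff n m α β γ i j) * (pU ^ i * pV ^ j)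

theorem evalPt_monicPoly (α β γ : ℝ) (n m : ℕ) (x y : ℝ) :
    evalPt (monicPoly α β γ n m) x y = monicJacobi n m α β γ x y := by
  rw [monicJacobi, kampeDeFeriet, tsum_eq_sum (s := Finset.range (n + 1) ×ˢ Finset.range (m + 1)),
    Finset.sum_product, Finset.mul_sum, monicPoly, evalPt_sum]
  · refine Finset.sum_congr rfl fun i _ => ?_
    rw [Finset.mul_sum, evalPt_sum]
    refine Finset.sum_congr rfl fun j _ => ?_
    simp only [evalPt_mul, evalPt_C, evalPt_pow, evalPt_pU, evalPt_pV, monicCoeff, List.map_cons,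
      List.map_nil, List.prod_cons, List.prod_nil, mul_one, one_mul, div_pow, pow_add]
    ring
  · rintro ⟨i, j⟩ hij
    simp only [Finset.mem_product, Finset.mem_range, not_and_or, not_lt] at hij
    rcases hij with h | h
    · simp [poch_neg_eq_zero (show n < i by omega)]
    · simp [poch_neg_eq_zero (show m < j by omega)]

theorem sum_range_shift {M : Type*} [AddCommGroup M] {n : ℕ} (f : ℕ → M) (h0 : f 0 = 0)
    (hn : f (n + 1) = 0) : ∑ i ∈ Finset.range (n + 1), f i = ∑ i ∈ Finset.range (n + 1), f (i + 1) := by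
  rw [Finset.sum_range_succ', h0, add_zero, Finset.sum_range_succ, hn, add_zero]

/-- With `s = α+β+γ+m+n+2`, the coefficient identity in `u^i v^j` reads `λ_{i+j} - (s+i+j)(i-n) -
(s+i+j)(j-m) = λ_{n+m}`. The two subtracted terms come from the one-step recurrences of the
hypergeometric coefficients in `i` and in `j`. -/
theorem appellOp_monicPoly {α β γ : ℝ} (h : Admissible α β γ) (n m : ℕ) :
    appellOp α β γ (monicPoly α β γ n m) =
      C (appellEigen α β γ (n + m)) * monicPoly α β γ n m := by
  set c := monicCoeff n m α β γ with hc
  have cn : ∀ j, c (n + 1) j = 0 := fun j => by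
    simp [hc, monicCoeff, poch_neg_eq_zero (Nat.lt_succ_self n)]
  have cm : ∀ i, c i (m + 1) = 0 := fun i => by
    simp [hc, monicCoeff, poch_neg_eq_zero (Nat.lt_succ_self m)]
  have rec1 : ∀ i j, 2 * ((i + 1 : ℕ) : ℝ) * ((i + 1 : ℕ) + β) * c (i + 1) j =
      (α + β + γ + m + n + 2 + (i + j : ℕ)) * (i - n) * c i j := fun i j => by
    have h1 : poch (β + 1) i ≠ 0 := (poch_pos (by linarith [h.2.1]) i).ne'
    have h2 : β + 1 + i ≠ 0 := by
      have := h.2.1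
      have : (0:ℝ) ≤ i := Nat.cast_nonneg i
      linarith
    have h3 : poch (α + 1) j ≠ 0 := (poch_pos (by linarith [h.1]) j).ne'
    simp only [hc, monicCoeff, poch_succ, Nat.factorial_succ, show i + 1 + j = i + j + 1 by ring]
    generalize (-1) ^ n * 2 ^ (n + m) * (poch (α + 1) m * poch (β + 1) n /
      poch (α + β + γ + m + n + 2) (n + m)) = K
    push_cast
    field_simp
    ring
  have rec2 : ∀ i j, 2 * ((j + 1 : ℕ) : ℝ) * ((j + 1 : ℕ) + α) * c i (j + 1) =
      (α + β + γ + m + n + 2 + (i + j : ℕ)) * (j - m) * c i j := fun i j => by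
    have h1 : poch (β + 1) i ≠ 0 := (poch_pos (by linarith [h.2.1]) i).ne'
    have h2 : α + 1 + j ≠ 0 := by
      have := h.1
      have : (0:ℝ) ≤ j := Nat.cast_nonneg j
      linarith
    have h3 : poch (α + 1) j ≠ 0 := (poch_pos (by linarith [h.1]) j).ne'
    simp only [hc, monicCoeff, poch_succ, Nat.factorial_succ, show i + (j + 1) = i + j + 1 by ring]
    generalize (-1) ^ n * 2 ^ (n + m) * (poch (α + 1) m * poch (β + 1) n /
      poch (α + β + γ + m + n + 2) (n + m)) = K
    push_cast
    field_simp
    ring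
  have s1 : ∑ i ∈ Finset.range (n + 1), ∑ j ∈ Finset.range (m + 1),
      C (2 * i * (i + β) * c i j) * (pU ^ (i - 1) * pV ^ j) =
      ∑ i ∈ Finset.range (n + 1), ∑ j ∈ Finset.range (m + 1),
      C (2 * ((i + 1 : ℕ) : ℝ) * ((i + 1 : ℕ) + β) * c (i + 1) j) * (pU ^ i * pV ^ j) :=
    sum_range_shift (fun i => ∑ j ∈ Finset.range (m + 1),
      C (2 * (i : ℝ) * (i + β) * c i j) * (pU ^ (i - 1) * pV ^ j)) (by simp) (by simp [cn])
  have s2 : ∑ i ∈ Finset.range (n + 1), ∑ j ∈ Finset.range (m + 1),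
      C (2 * j * (j + α) * c i j) * (pU ^ i * pV ^ (j - 1)) =
      ∑ i ∈ Finset.range (n + 1), ∑ j ∈ Finset.range (m + 1),
      C (2 * ((j + 1 : ℕ) : ℝ) * ((j + 1 : ℕ) + α) * c i (j + 1)) * (pU ^ i * pV ^ j) :=
    Finset.sum_congr rfl fun i _ => sum_range_shift (fun j =>
      C (2 * (j : ℝ) * (j + α) * c i j) * (pU ^ i * pV ^ (j - 1))) (by simp) (by simp [cm])
  have e : appellOp α β γ (monicPoly α β γ n m) =
      ∑ i ∈ Finset.range (n + 1), ∑ j ∈ Finset.range (m + 1),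
        C (appellEigen α β γ (i + j) * c i j) * (pU ^ i * pV ^ j) -
      ∑ i ∈ Finset.range (n + 1), ∑ j ∈ Finset.range (m + 1),
        C (2 * i * (i + β) * c i j) * (pU ^ (i - 1) * pV ^ j) -
      ∑ i ∈ Finset.range (n + 1), ∑ j ∈ Finset.range (m + 1),
        C (2 * j * (j + α) * c i j) * (pU ^ i * pV ^ (j - 1)) := by
    simp only [monicPoly, map_sum, ← Finset.sum_sub_distrib]
    refine Finset.sum_congr rfl fun i _ => Finset.sum_congr rfl fun j _ => ?_
    rw [← MvPolynomial.smul_eq_C_mul (pU ^ i * pV ^ j) (monicCoeff n m α β γ i j), map_smul,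
      appellOp_uv, MvPolynomial.smul_eq_C_mul]
    simp only [map_mul, hc]
    ring
  -- Re-indexing is free of boundary terms: the coefficient vanishes at `i = 0` through the factor
  -- `i` and at `i = n+1` through `(-n)_{n+1} = 0`, and likewise in `j`.
  rw [e, s1, s2, ← Finset.sum_sub_distrib, ← Finset.sum_sub_distrib, monicPoly, Finset.mul_sum]
  refine Finset.sum_congr rfl fun i _ => ?_
  rw [← Finset.sum_sub_distrib, ← Finset.sum_sub_distrib, Finset.mul_sum]
  refine Finset.sum_congr rfl fun j _ => ?_
  rw [rec1, rec2, ← sub_mul, ← sub_mul, ← map_sub, ← map_sub,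
    ← mul_assoc (C (appellEigen α β γ (n + m))), ← map_mul C]
  congr 2
  simp only [appellEigen]
  push_cast
  ring

/-- The exponent of `x^k y^l`. -/
def expo (k l : ℕ) : Fin 2 →₀ ℕ := Finsupp.single 0 k + Finsupp.single 1 l

theorem expo_eq_iff (k l : ℕ) (s : Fin 2 →₀ ℕ) : expo k l = s ↔ k = s 0 ∧ l = s 1 := by
  constructor
  · rintro rfl
    simp [expo]
  · rintro ⟨rfl, rfl⟩
    ext i
    fin_cases i <;> simp [expo]

theorem coeff_uv (i j : ℕ) (s : Fin 2 →₀ ℕ) : (pU ^ i * pV ^ j).coeff s =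
    i.choose (s 0) * (j.choose (s 1) * (-1) ^ s 1) := by
  have e : pU ^ i * pV ^ j = ∑ k ∈ Finset.range (i + 1), ∑ l ∈ Finset.range (j + 1),
      MvPolynomial.monomial (expo k l) ((i.choose k : ℝ) * (j.choose l * (-1) ^ l)) := by
    have hV : pV = -MvPolynomial.X 1 + 1 := by rw [pV]; ring
    rw [hV, pU, add_pow, add_pow, Finset.sum_mul_sum]
    refine Finset.sum_congr rfl fun k _ => Finset.sum_congr rfl fun l _ => ?_
    have : MvPolynomial.monomial (expo k l) ((i.choose k : ℝ) * (j.choose l * (-1) ^ l)) =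
        C ((i.choose k : ℝ) * (j.choose l * (-1) ^ l)) *
          (MvPolynomial.X 0 ^ k * MvPolynomial.X 1 ^ l) := by
      rw [MvPolynomial.X_pow_eq_monomial, MvPolynomial.X_pow_eq_monomial,
        MvPolynomial.monomial_mul, MvPolynomial.C_mul_monomial, expo]
      simp
    rw [this, neg_pow]
    simp only [map_mul, map_natCast, map_pow, map_neg, map_one, one_pow]
    ring
  rw [e]
  simp only [MvPolynomial.coeff_sum, MvPolynomial.coeff_monomial, expo_eq_iff]
  rw [Finset.sum_eq_single (s 0), Finset.sum_eq_single (s 1)]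
  · simp
  · intro l _ hl
    simp [hl]
  · intro hl
    simp only [Finset.mem_range, not_lt] at hl
    simp [Nat.choose_eq_zero_of_lt (show j < s 1 by omega)]
  · intro k _ hk
    simp [hk]
  · intro hk
    simp only [Finset.mem_range, not_lt] at hk
    simp [Nat.choose_eq_zero_of_lt (show i < s 0 by omega)]

/-- Only the term `i = n`, `j = m` reaches total degree `n+m`, and the normalizing constant is the
inverse of its leading coefficient. -/
theorem coeff_monicPoly {α β γ : ℝ} (h : Admissible α β γ) (n m : ℕ) (s : Fin 2 →₀ ℕ)
    (hs : n + m ≤ s 0 + s 1) :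
    (monicPoly α β γ n m).coeff s = if s 0 = n ∧ s 1 = m then 1 else 0 := by
  simp only [monicPoly, MvPolynomial.coeff_sum, MvPolynomial.coeff_C_mul, coeff_uv]
  rw [Finset.sum_eq_single n, Finset.sum_eq_single m]
  · by_cases h0 : s 0 = n
    · by_cases h1 : s 1 = m
      · have p1 := (poch_pos (show 0 < α + 1 by linarith [h.1]) m).ne'
        have p2 := (poch_pos (show 0 < β + 1 by linarith [h.2.1]) n).ne'
        -- For `n+m = 0` the base may be nonpositive, but then the product is empty.
        have p3 : poch (α + β + γ + m + n + 2) (n + m) ≠ 0 := by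
          rcases Nat.eq_zero_or_pos (n + m) with h0 | hpos
          · rw [h0, poch_zero]; exact one_ne_zero
          · refine (poch_pos ?_ _).ne'
            have : (1 : ℝ) ≤ m + n := by
              have : 1 ≤ m + n := by omega
              exact_mod_cast this
            linarith [h.1, h.2.1, h.2.2]
        have q1 : (n.factorial : ℝ) ≠ 0 := by exact_mod_cast n.factorial_ne_zero
        have q2 : (m.factorial : ℝ) ≠ 0 := by exact_mod_cast m.factorial_ne_zero
        rw [h0, h1, if_pos ⟨rfl, rfl⟩, monicCoeff, poch_neg, poch_neg, Nat.choose_self,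
          Nat.choose_self]
        field_simp
        rw [← pow_mul, ← pow_mul]
        simp
      · rw [if_neg (fun hh => h1 hh.2)]
        have : m < s 1 := by omega
        simp [Nat.choose_eq_zero_of_lt this]
    · rw [if_neg (fun hh => h0 hh.1)]
      rcases Nat.lt_or_ge n (s 0) with hlt | hge
      · simp [Nat.choose_eq_zero_of_lt hlt]
      · have : m < s 1 := by omega
        simp [Nat.choose_eq_zero_of_lt this]
  · intro j hj hjm
    have := Finset.mem_range.1 hj
    rcases Nat.lt_or_ge n (s 0) with hlt | hge
    · simp [Nat.choose_eq_zero_of_lt hlt]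
    · simp [Nat.choose_eq_zero_of_lt (show j < s 1 by omega)]
  · intro hm
    simp at hm
  · intro i hi hin
    refine Finset.sum_eq_zero fun j hj => ?_
    have := Finset.mem_range.1 hj
    have := Finset.mem_range.1 hi
    rcases Nat.lt_or_ge i (s 0) with hlt | hge
    · simp [Nat.choose_eq_zero_of_lt hlt]
    · simp [Nat.choose_eq_zero_of_lt (show j < s 1 by omega)]
  · intro hn
    simp at hn

theorem isOrthogonalSolutionSystem_monicPoly {α β γ : ℝ} (h : Admissible α β γ) :
    IsOrthogonalSolutionSystem α β γ fun N k => monicPoly α β γ (N - k) k := by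
  refine isOrthogonalSolutionSystem_of h (fun N => ?_) fun N k hk => ?_
  · rw [Fintype.linearIndependent_iff]
    intro g hg k
    have := congrArg (MvPolynomial.coeff (expo (N - k) k)) hg
    have hk := k.2
    rw [MvPolynomial.coeff_sum, MvPolynomial.coeff_zero, Finset.sum_eq_single k] at this
    · rw [MvPolynomial.coeff_smul, coeff_monicPoly h] at this
      · simpa [expo] using this
      · simp [expo]
    · intro l _ hl
      have hl' := l.2
      have hne : (l : ℕ) ≠ k := fun e => hl (Fin.ext e)
      rw [MvPolynomial.coeff_smul, coeff_monicPoly h, if_neg, smul_zero]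
      · simp only [expo, Finsupp.add_apply]
        simp
        omega
      · simp [expo]
        omega
    · simp
  · have := appellOp_monicPoly h (N - k) k
    rwa [Nat.sub_add_cancel hk] at this

/-! ### The limit of the monic family -/

theorem tendsto_qBinom {n k : ℕ} (hk : k ≤ n) :
    Tendsto (fun q : ℝ => qBinom q n k) (𝓝[<] 1) (𝓝 (n.choose k)) := by
  have t := fun j : ℕ => tendsto_qPoch_div (z := fun q => q) (r := 1)
    (Eventually.of_forall fun q => (Real.rpow_one q).symm) j
  simp only [poch_one] at t
  have h1 : (k.factorial : ℝ) * (n - k).factorial ≠ 0 := by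
    exact_mod_cast mul_ne_zero k.factorial_ne_zero (n - k).factorial_ne_zero
  have := (t n).div ((t k).mul (t (n - k))) h1
  have e : (n.factorial : ℝ) / (k.factorial * (n - k).factorial) = n.choose k := by
    rw [div_eq_iff h1, ← Nat.choose_mul_factorial_mul_factorial hk]
    push_cast
    ring
  rw [e] at this
  refine this.congr' ?_
  filter_upwards [eventually_mem_Ioo] with q hq
  have hq1 : 1 - q ≠ 0 := by linarith [hq.2]
  have hp : (1 - q) ^ n = (1 - q) ^ k * (1 - q) ^ (n - k) := by
    rw [← pow_add, Nat.add_sub_cancel' hk]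
  simp only [Pi.div_apply, qBinom, hp]
  rw [div_mul_div_comm, div_div_div_cancel_right₀]
  exact mul_ne_zero (pow_ne_zero _ hq1) (pow_ne_zero _ hq1)

/-- The powers of `1-q` balance separately in the prefactor (`m+n` against `n+m`) and in each
summand (`i+j` against `j` and `i`). Bases tending to `-1` contribute powers of 2, and `(bx/d;q)_i`,
`(y;q)_j` give `(x+1)^i`, `(1-y)^j`. -/
theorem tendsto_monicBigQJacobi {α β γ : ℝ} (δ : ℝ) (h : Admissible α β γ) (n m : ℕ) (x y : ℝ) :
    Tendsto (fun q : ℝ => monicBigQJacobi n m x y (q ^ α) (q ^ β) (q ^ γ) (-(q ^ δ)) q)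
          (𝓝[<] 1) (𝓝 (monicJacobi n m α β γ x y)) := by
  have ta := tendsto_rpow_nhdsLT_one α
  have tb := tendsto_rpow_nhdsLT_one β
  have tc := tendsto_rpow_nhdsLT_one γ
  have td := (tendsto_rpow_nhdsLT_one δ).neg
  have tp := tendsto_pow_nhdsLT_one
  have rp : ∀ (r : ℝ), ∀ᶠ q : ℝ in 𝓝[<] 1, q ^ r * q = q ^ (r + 1) := fun r => by
    filter_upwards [eventually_mem_Ioo] with q hq
    rw [Real.rpow_add hq.1, Real.rpow_one]
  have tA := fun k => tendsto_qPoch_div (rp α) k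
  have tB := fun k => tendsto_qPoch_div (rp β) k
  have tS := fun k => tendsto_qPoch_div (z := fun q : ℝ => q ^ α * q ^ β * q ^ γ * q ^ (m + n + 2))
    (r := α + β + γ + m + n + 2) (by
      filter_upwards [eventually_mem_Ioo] with q hq
      rw [← Real.rpow_natCast, ← Real.rpow_add hq.1, ← Real.rpow_add hq.1, ← Real.rpow_add hq.1]
      congr 1
      push_cast
      ring) k
  have tD := fun k => tendsto_qPoch (td.mul (tp (n + 1))) k
  have tE := fun k => tendsto_qPoch ((((ta.mul tb).mul tc).mul (tp (m + 2))).div td (by norm_num)) k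
  have tX := fun k => tendsto_qPoch ((tb.mul_const x).div td (by norm_num)) k
  have tY := fun k => tendsto_qPoch (tendsto_const_nhds (x := y)) k
  have e2 : (1 : ℝ) - -1 * 1 = 2 := by norm_num
  have e2' : (1 : ℝ) - 1 * 1 * 1 * 1 / -1 = 2 := by norm_num
  have ex : 1 - 1 * x / -1 = x + 1 := by ring
  rw [e2] at tD
  rw [e2'] at tE
  rw [ex] at tX
  have pA : ∀ k, poch (α + 1) k ≠ 0 := fun k => (poch_pos (by linarith [h.1]) k).ne'
  have pB : ∀ k, poch (β + 1) k ≠ 0 := fun k => (poch_pos (by linarith [h.2.1]) k).ne'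
  have pS : poch (α + β + γ + m + n + 2) (n + m) ≠ 0 := by
    rcases Nat.eq_zero_or_pos (n + m) with h0 | hpos
    · rw [h0, poch_zero]; exact one_ne_zero
    · refine (poch_pos ?_ _).ne'
      have : (1 : ℝ) ≤ m + n := by
        have : 1 ≤ m + n := by omega
        exact_mod_cast this
      linarith [h.1, h.2.1, h.2.2]
  have hpow : ∀ k : ℕ, (2 : ℝ) ^ k ≠ 0 := fun k => by positivity
  have pre := ((((((td.div tb one_ne_zero).pow n).mul (tA m)).mul (tB n)).mul (tD m)).mul
    (tE n)).div (tS (n + m)) pS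
  have terms : ∀ i ∈ Finset.range (n + 1), ∀ j ∈ Finset.range (m + 1),
      Tendsto (fun q : ℝ => (-1) ^ (i + j) * qBinom q n i * qBinom q m j *
        q ^ (((i : ℤ) * (i - 2 * n + 1) + (j : ℤ) * (j - 2 * m + 1)) / 2) *
        (qPoch (q ^ α * q ^ β * q ^ γ * q ^ (m + n + 2)) q (i + j) / (1 - q) ^ (i + j)) /
        (qPoch (q ^ α * q) q j / (1 - q) ^ j * (qPoch (q ^ β * q) q i / (1 - q) ^ i) *
          qPoch (-(q ^ δ) * q ^ (n + 1)) q j *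
          qPoch (q ^ α * q ^ β * q ^ γ * q ^ (m + 2) / -(q ^ δ)) q i) *
        qPoch (q ^ β * x / -(q ^ δ)) q i * qPoch y q j) (𝓝[<] 1)
      (𝓝 ((-1) ^ (i + j) * n.choose i * m.choose j * 1 *
        poch (α + β + γ + m + n + 2) (i + j) /
        (poch (α + 1) j * poch (β + 1) i * 2 ^ j * 2 ^ i) * (x + 1) ^ i * (1 - y) ^ j)) := by
    intro i hi j hj
    have hi' := Finset.mem_range.1 hi
    have hj' := Finset.mem_range.1 hj
    exact (((((((tendsto_const_nhds (x := (-1 : ℝ) ^ (i + j))).mul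
      (tendsto_qBinom (show i ≤ n by omega))).mul (tendsto_qBinom (show j ≤ m by omega))).mul
      (tendsto_zpow_nhdsLT_one _)).mul (tS (i + j))).div ((((tA j).mul (tB i)).mul (tD j)).mul
      (tE i)) (mul_ne_zero (mul_ne_zero (mul_ne_zero (pA j) (pB i)) (hpow j)) (hpow i))).mul
      (tX i)).mul (tY j)
  have all := pre.mul (tendsto_finsetSum _ fun i hi => tendsto_finsetSum _ fun j hj =>
    terms i hi j hj)
  refine (all.congr' ?_).trans_eq (congrArg 𝓝 ?_)
  · filter_upwards [eventually_mem_Ioo] with q hq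
    have hq1 : 1 - q ≠ 0 := by linarith [hq.2]
    have hε : ∀ k : ℕ, (1 - q) ^ k ≠ 0 := fun k => pow_ne_zero k hq1
    simp only [Pi.div_apply, monicBigQJacobi]
    congr 1
    · have := hε (n + m)
      have e : (1 - q) ^ (n + m) = (1 - q) ^ n * (1 - q) ^ m := pow_add _ _ _
      have h1 := hε n
      have h2 := hε m
      rw [div_div_eq_mul_div, e]
      congr 1
      field_simp
    · refine Finset.sum_congr rfl fun i _ => Finset.sum_congr rfl fun j _ => ?_
      congr 2
      have e : (1 - q) ^ (i + j) = (1 - q) ^ i * (1 - q) ^ j := pow_add _ _ _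
      have h1 := hε i
      have h2 := hε j
      rw [e]
      generalize qPoch (q ^ α * q) q j = a1
      generalize qPoch (q ^ β * q) q i = a2
      generalize qPoch (-(q ^ δ) * q ^ (n + 1)) q j = a3
      generalize qPoch (q ^ α * q ^ β * q ^ γ * q ^ (m + 2) / -(q ^ δ)) q i = a4
      have e3 : a1 / (1 - q) ^ j * (a2 / (1 - q) ^ i) * a3 * a4 =
          a1 * a2 * a3 * a4 / ((1 - q) ^ i * (1 - q) ^ j) := by
        field_simp
      rw [e3, ← mul_div_assoc, div_div_div_cancel_right₀ (mul_ne_zero h1 h2)]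
  · rw [← evalPt_monicPoly, monicPoly, evalPt_sum, Finset.mul_sum]
    refine Finset.sum_congr rfl fun i _ => ?_
    rw [evalPt_sum, Finset.mul_sum]
    refine Finset.sum_congr rfl fun j _ => ?_
    simp only [evalPt_mul, evalPt_C, evalPt_pow, evalPt_pU, evalPt_pV, monicCoeff, poch_neg]
    have q1 : (i.factorial : ℝ) ≠ 0 := by exact_mod_cast i.factorial_ne_zero
    have q2 : (j.factorial : ℝ) ≠ 0 := by exact_mod_cast j.factorial_ne_zero
    have r1 := pA j
    have r2 := pB i
    generalize poch (α + β + γ + m + n + 2) (i + j) = S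
    have e1 : S * ((-1) ^ i * i.factorial * n.choose i) * ((-1) ^ j * j.factorial * m.choose j) /
        (poch (β + 1) i * poch (α + 1) j) / (2 ^ (i + j) * i.factorial * j.factorial) =
        (-1) ^ (i + j) * n.choose i * m.choose j * S /
          (poch (α + 1) j * poch (β + 1) i * 2 ^ j * 2 ^ i) := by
      rw [div_div, div_eq_div_iff (by simp [pA, pB, q1, q2]) (by simp [pA, pB])]
      ring
    rw [e1]
    ring

/-! ### The non-monic family -/

/-- The coefficients of the terminating series `₂F₁(-n, b; c; z)`. -/
def hypCoeff (n : ℕ) (b c : ℝ) (i : ℕ) : ℝ :=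
  poch (-(n : ℝ)) i * poch b i / (poch c i * i.factorial)

theorem hypCoeff_zero (n : ℕ) (b c : ℝ) : hypCoeff n b c 0 = 1 := by simp [hypCoeff, poch_zero]

theorem hypCoeff_eq_zero {n i : ℕ} (b c : ℝ) (h : n < i) : hypCoeff n b c i = 0 := by
  simp [hypCoeff, poch_neg_eq_zero h]

theorem hypCoeff_succ (n : ℕ) (b : ℝ) {c : ℝ} (hc : 0 < c) (i : ℕ) :
    ((i + 1 : ℕ) : ℝ) * (c + i) * hypCoeff n b c (i + 1) = (i - n) * (b + i) * hypCoeff n b c i := by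
  have h1 := (poch_pos hc i).ne'
  have h2 : c + i ≠ 0 := by positivity
  simp only [hypCoeff, poch_succ, Nat.factorial_succ]
  push_cast
  field_simp
  ring

theorem hypergeometric_eq_sum (n : ℕ) (b c z : ℝ) :
    ₂F₁ (-(n : ℝ)) b c z = ∑ i ∈ Finset.range (n + 1), hypCoeff n b c i * z ^ i := by
  have e : ∀ i, ordinaryHypergeometricCoefficient (-(n : ℝ)) b c i = hypCoeff n b c i := fun i => by
    simp only [ordinaryHypergeometricCoefficient, hypCoeff, poch]
    rw [div_eq_mul_inv, mul_inv]
    ring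
  rw [ordinaryHypergeometric_eq_tsum]
  simp only [smul_eq_mul]
  rw [tsum_eq_sum (s := Finset.range (n + 1))]
  · refine Finset.sum_congr rfl fun i _ => ?_
    rw [← e]
  · intro i hi
    rw [Finset.mem_range, not_lt] at hi
    have := (e i).trans (hypCoeff_eq_zero b c (show n < i by omega))
    simp only [ordinaryHypergeometricCoefficient] at this
    rw [this, zero_mul]

/-- `y + 1` -/
def pT : Poly2 := MvPolynomial.X 1 + 1

@[simp] theorem evalPt_pT (x y : ℝ) : evalPt pT x y = y + 1 := by simp [pT]
@[simp] theorem dX_pT : dX pT = 0 := by simp [pT, MvPolynomial.pderiv_X]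
@[simp] theorem dY_pT : dY pT = 1 := by simp [pT, MvPolynomial.pderiv_X]
@[simp] theorem dX_pW : dX pW = -1 := by simp [pW, MvPolynomial.pderiv_X]
@[simp] theorem dY_pW : dY pW = 1 := by simp [pW, MvPolynomial.pderiv_X]

theorem pU_eq : pU = pT - pW := by simp only [pU, pT, pW]; ring
theorem pV_eq : pV = 2 - pT := by simp only [pV, pT]; ring

/-- The factor of `J_{n,m}` which is homogeneous in `x + 1`, `y + 1`. -/
def homJacobi (β γ : ℝ) (m : ℕ) : Poly2 :=
  ∑ i ∈ Finset.range (m + 1), C (hypCoeff m (β + γ + m + 1) (γ + 1) i) * (pW ^ i * pT ^ (m - i))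

/-- The factor of `J_{n,m}` depending on `y` only. -/
def radJacobi (α β γ : ℝ) (n m : ℕ) : Poly2 :=
  ∑ i ∈ Finset.range (n - m + 1),
    C (hypCoeff (n - m) (α + β + γ + m + n + 2) (α + 1) i / 2 ^ i) * pV ^ i

/-- The polynomials `J_{n,m}`. -/
def nonmonicPoly (α β γ : ℝ) (n m : ℕ) : Poly2 := homJacobi β γ m * radJacobi α β γ n m

/-- The Jacobi operator in the first variable. -/
def jacobiOpX (β γ : ℝ) : Poly2 →ₗ[ℝ] Poly2 where
  toFun p := raiseX (β + 1) (γ + 1) (dX p)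
  map_add' p r := by simp only [raiseX, map_add]; ring
  map_smul' c p := by
    simp only [raiseX, dX_C_mul, MvPolynomial.smul_eq_C_mul, RingHom.id_apply]; ring

theorem jacobiOpX_apply (β γ : ℝ) (p : Poly2) :
    jacobiOpX β γ p = raiseX (β + 1) (γ + 1) (dX p) := rfl

theorem dX_pow (p : Poly2) (n : ℕ) : dX (p ^ n) = C (n : ℝ) * p ^ (n - 1) * dX p := by
  rw [dX, Derivation.leibniz_pow]
  simp [mul_assoc]

theorem dY_pow (p : Poly2) (n : ℕ) : dY (p ^ n) = C (n : ℝ) * p ^ (n - 1) * dY p := by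
  rw [dY, Derivation.leibniz_pow]
  simp [mul_assoc]

theorem dX_wt (i j : ℕ) : dX (pW ^ i * pT ^ j) = -(C (i : ℝ) * (pW ^ (i - 1) * pT ^ j)) := by
  rw [dX_mul, dX_pow, dX_pow, dX_pW, dX_pT]
  ring

theorem dY_wt (i j : ℕ) : dY (pW ^ i * pT ^ j) =
    C (i : ℝ) * (pW ^ (i - 1) * pT ^ j) + C (j : ℝ) * (pW ^ i * pT ^ (j - 1)) := by
  rw [dY_mul, dY_pow, dY_pow, dY_pW, dY_pT]
  ring

theorem dX_pV_pow (i : ℕ) : dX (pV ^ i) = 0 := by rw [dX_pow, dX_pV, mul_zero]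

theorem dY_pV_pow (i : ℕ) : dY (pV ^ i) = -(C (i : ℝ) * pV ^ (i - 1)) := by
  rw [dY_pow, dY_pV]
  ring

theorem jacobiOpX_wt (β γ : ℝ) (i j : ℕ) : jacobiOpX β γ (pW ^ i * pT ^ j) =
    C (i * (i + γ)) * (pW ^ (i - 1) * pT ^ (j + 1)) -
      C (i * (i + β + γ + 1)) * (pW ^ i * pT ^ j) := by
  rw [jacobiOpX_apply, raiseX]
  simp only [dX_wt, dX_neg, dX_C_mul, pU_eq]
  rcases i with _ | _ | i <;>
    simp only [Nat.cast_zero, Nat.cast_add, Nat.cast_one, map_add, map_mul, map_one, map_zero,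
      map_natCast, Nat.add_sub_cancel, pow_succ, pow_zero, zero_tsub, zero_add] <;> ring

/-- Because `u = t - w` with `t = y+1`, the operator sends `w^i t^(m-i)` to a combination of itself
and `w^(i-1) t^(m-i+1)`. The eigenvalue equation is then the two-term recurrence of the
hypergeometric coefficients. -/
theorem jacobiOpX_homJacobi {β γ : ℝ} (hγ : -1 < γ) (m : ℕ) :
    jacobiOpX β γ (homJacobi β γ m) = C (-(m * (m + β + γ + 1))) * homJacobi β γ m := by
  set c := hypCoeff m (β + γ + m + 1) (γ + 1) with hc
  have s1 := sum_range_shift (n := m) (fun i => C (i * (i + γ) * c i) *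
    (pW ^ (i - 1) * pT ^ (m - i + 1))) (by simp) (by simp [hc, hypCoeff_eq_zero])
  have e : jacobiOpX β γ (homJacobi β γ m) =
      ∑ i ∈ Finset.range (m + 1), C (i * (i + γ) * c i) * (pW ^ (i - 1) * pT ^ (m - i + 1)) -
      ∑ i ∈ Finset.range (m + 1), C (i * (i + β + γ + 1) * c i) * (pW ^ i * pT ^ (m - i)) := by
    simp only [homJacobi, map_sum, ← Finset.sum_sub_distrib]
    refine Finset.sum_congr rfl fun i _ => ?_
    rw [← MvPolynomial.smul_eq_C_mul, map_smul, jacobiOpX_wt, MvPolynomial.smul_eq_C_mul]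
    simp only [map_mul, hc]
    ring
  rw [e, s1, ← Finset.sum_sub_distrib, homJacobi, Finset.mul_sum]
  refine Finset.sum_congr rfl fun i hi => ?_
  have hi' := Finset.mem_range.1 hi
  have hr := hypCoeff_succ m (β + γ + m + 1) (show 0 < γ + 1 by linarith) i
  rw [← hc] at hr
  rcases Nat.lt_or_ge i m with hlt | hge
  · rw [Nat.add_sub_cancel, show m - (i + 1) + 1 = m - i by omega, ← sub_mul, ← map_sub,
      ← mul_assoc (C (-(m * (m + β + γ + 1)))), ← map_mul C]
    congr 2
    push_cast at hr ⊢
    linear_combination hr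
  -- Here the truncated exponent `m - (i+1) + 1` is `1` instead of `0`, which is harmless because
  -- the next coefficient vanishes.
  · obtain rfl : i = m := by omega
    rw [show c (i + 1) = 0 from hypCoeff_eq_zero _ _ (Nat.lt_succ_self i)]
    simp only [mul_zero, map_zero, zero_mul, zero_sub, map_neg, map_mul]
    ring

/-- Euler's identity for a form of degree `m` in `x+1` and `y+1`. -/
theorem euler_homJacobi (β γ : ℝ) (m : ℕ) : pU * dX (homJacobi β γ m) + pT * dY (homJacobi β γ m) =
    C (m : ℝ) * homJacobi β γ m := by
  simp only [homJacobi, map_sum, Finset.mul_sum, ← Finset.sum_add_distrib]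
  refine Finset.sum_congr rfl fun i hi => ?_
  have hi' := Finset.mem_range.1 hi
  obtain ⟨j, rfl⟩ : ∃ j, m = i + j := ⟨m - i, by omega⟩
  rw [Nat.add_sub_cancel_left]
  generalize hypCoeff _ _ _ _ = c
  simp only [dX_C_mul, dY_C_mul, dX_wt, dY_wt, pU_eq]
  rcases i with _ | i <;> rcases j with _ | j <;>
    simp only [Nat.cast_zero, Nat.cast_add, Nat.cast_one, map_add, map_one, map_zero,
      map_natCast, Nat.add_sub_cancel, pow_succ, pow_zero, zero_tsub, zero_add] <;> ring

theorem dX_radJacobi (α β γ : ℝ) (n m : ℕ) : dX (radJacobi α β γ n m) = 0 := by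
  simp only [radJacobi, map_sum, dX_C_mul, dX_pV_pow, mul_zero, Finset.sum_const_zero]

theorem radJacobi_ode {α : ℝ} (hα : -1 < α) (β γ : ℝ) {n m : ℕ} (hmn : m ≤ n) :
    pV * (2 - pV) * dY (dY (radJacobi α β γ n m)) -
      (C (2 * (α + 1)) - C (α + β + γ + 2 * m + 3) * pV) * dY (radJacobi α β γ n m) +
      C ((n - m) * (α + β + γ + m + n + 2)) * radJacobi α β γ n m = 0 := by
  set c : ℕ → ℝ := fun i => hypCoeff (n - m) (α + β + γ + m + n + 2) (α + 1) i / 2 ^ i with hc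
  have hcz : c (n - m + 1) = 0 := by simp [hc, hypCoeff_eq_zero]
  have s1 := sum_range_shift (n := n - m) (fun i => C (2 * i * (i + α) * c i) * pV ^ (i - 1))
    (by simp) (by simp [hcz])
  have e : pV * (2 - pV) * dY (dY (radJacobi α β γ n m)) -
      (C (2 * (α + 1)) - C (α + β + γ + 2 * m + 3) * pV) * dY (radJacobi α β γ n m) +
      C ((n - m) * (α + β + γ + m + n + 2)) * radJacobi α β γ n m =
      ∑ i ∈ Finset.range (n - m + 1), C (2 * i * (i + α) * c i) * pV ^ (i - 1) +
      ∑ i ∈ Finset.range (n - m + 1),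
        C (((n - m) * (α + β + γ + m + n + 2) - i * (i + α + β + γ + 2 * m + 2)) * c i) *
          pV ^ i := by
    simp only [radJacobi, map_sum, Finset.mul_sum, ← Finset.sum_sub_distrib,
      ← Finset.sum_add_distrib]
    refine Finset.sum_congr rfl fun i hi => ?_
    change _ * dY (dY (C (c i) * _)) - _ * dY (C (c i) * _) + _ * (C (c i) * _) = _
    generalize c i = c
    simp only [dY_C_mul, dY_pV_pow, dY_neg]
    rcases i with _ | _ | i <;>
      simp only [Nat.cast_zero, Nat.cast_add, Nat.cast_one, map_add, map_mul, map_one, map_zero,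
        map_natCast, Nat.add_sub_cancel, pow_succ, pow_zero, zero_tsub, zero_add, map_sub, C_two,
        C_three] <;> ring
  rw [e, s1, ← Finset.sum_add_distrib]
  refine Finset.sum_eq_zero fun i _ => ?_
  have hr := hypCoeff_succ (n - m) (α + β + γ + m + n + 2) (show 0 < α + 1 by linarith) i
  rw [Nat.cast_sub hmn] at hr
  rw [Nat.add_sub_cancel, ← add_mul, ← map_add]
  have : 2 * ((i + 1 : ℕ) : ℝ) * ((i + 1 : ℕ) + α) * c (i + 1) +
      ((n - m) * (α + β + γ + m + n + 2) - i * (i + α + β + γ + 2 * m + 2)) * c i = 0 := by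
    simp only [hc]
    have h2 : (2 : ℝ) ^ i ≠ 0 := by positivity
    rw [pow_succ]
    field_simp
    push_cast at hr ⊢
    linear_combination hr
  rw [this, map_zero, zero_mul]

/-- Separation of variables for `H·g`: Euler's identity and its derivatives eliminate `H_y`, `H_xy`
and `H_yy`, the equation in `x` eliminates `H_xx`, and what remains is `H` times the hypergeometric
equation of `g`. -/
theorem appellOp_nonmonicPoly {α β γ : ℝ} (h : Admissible α β γ) {n m : ℕ} (hmn : m ≤ n) :
    appellOp α β γ (nonmonicPoly α β γ n m) =
      C (appellEigen α β γ n) * nonmonicPoly α β γ n m := by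
  have hT : pT ≠ 0 := fun h0 => by
    have := congrArg (fun p => evalPt p 0 0) h0
    simp at this
  have hD := jacobiOpX_homJacobi (β := β) h.2.2 m
  have hE := euler_homJacobi β γ m
  have hG := radJacobi_ode h.1 β γ hmn
  have hgx := dX_radJacobi α β γ n m
  have hgxy : dX (dY (radJacobi α β γ n m)) = 0 := by rw [← dY_dX, hgx]; simp
  have hEx := congrArg (fun p => dX p) hE
  have hEy := congrArg (fun p => dY p) hE
  rw [nonmonicPoly]
  -- Euler's identity determines only `(y+1)·H_y`, so the elimination is carried out after
  -- multiplication by `y+1`.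
  refine mul_left_cancel₀ hT (sub_eq_zero.1 ?_)
  rw [jacobiOpX_apply, raiseX] at hD
  rw [appellOp_apply]
  generalize homJacobi β γ m = H at *
  generalize radJacobi α β γ n m = g at *
  have hHX : ∀ p r : Poly2, dX (p + r) = dX p + dX r := fun p r => map_add _ p r
  have hHY : ∀ p r : Poly2, dY (p + r) = dY p + dY r := fun p r => map_add _ p r
  have h0 : dX (0 : Poly2) = 0 := map_zero _
  simp only [hHX, hHY, dX_mul, dY_mul, dX_C, dY_C, dX_pU, dX_pT, dY_pU, dY_pT, hgx, hgxy, h0,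
    dY_dX] at hEx hEy ⊢
  simp only [pU_eq, pV_eq, map_mul, map_add, map_sub, map_neg, map_one, map_natCast, C_two, C_three,
    appellEigen] at hD hE hEx hEy hG ⊢
  linear_combination (-2 * g) * hD - pT * (2 - pT) * g * hEy - (pT - pW) * (2 - pT) * g * hEx +
    (- ((C α + C β + C γ + 3) * (2 - pT) - 2 * C α - 2) * g - (2 - pT) * ((m : Poly2) - 1) * g -
      2 * pT * (2 - pT) * dY g) * hE - pT * H * hG

/-- At `(1,1)` both `w` and `v` vanish and only the constant terms of the two series survive. This
shows that the polynomials are nonzero, as eigenvectors must be. -/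
theorem evalPt_nonmonicPoly_one (α β γ : ℝ) (n m : ℕ) :
    evalPt (nonmonicPoly α β γ n m) 1 1 = 2 ^ m := by
  have h1 : evalPt (homJacobi β γ m) 1 1 = 2 ^ m := by
    rw [homJacobi, evalPt_sum, Finset.sum_eq_single 0]
    · norm_num [hypCoeff_zero]
    · intro i _ hi
      simp [hi]
    · simp
  have h2 : evalPt (radJacobi α β γ n m) 1 1 = 1 := by
    rw [radJacobi, evalPt_sum, Finset.sum_eq_single 0]
    · norm_num [hypCoeff_zero]
    · intro i _ hi
      simp [hi]
    · simp
  rw [nonmonicPoly, evalPt_mul, h1, h2, mul_one]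

theorem jacobiOpX_nonmonicPoly (α : ℝ) {β γ : ℝ} (hγ : -1 < γ) (n m : ℕ) :
    jacobiOpX β γ (nonmonicPoly α β γ n m) =
      C (-(m * (m + β + γ + 1))) * nonmonicPoly α β γ n m := by
  have hD := jacobiOpX_homJacobi (β := β) hγ m
  have hgx := dX_radJacobi α β γ n m
  rw [nonmonicPoly, ← mul_assoc, ← hD]
  simp only [jacobiOpX_apply, raiseX, dX_mul, hgx, map_add, map_zero]
  ring

theorem jacobiOpX_eigen_injective {β γ : ℝ} (hβ : -1 < β) (hγ : -1 < γ) {m k : ℕ}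
    (e : -((m : ℝ) * (m + β + γ + 1)) = -(k * (k + β + γ + 1))) : m = k := by
  by_contra hne
  have h4 : (1 : ℝ) ≤ (m : ℝ) + k := by
    have : 1 ≤ m + k := by omega
    exact_mod_cast this
  have h5 : ((m : ℝ) - k) * (m + k + (β + γ + 1)) = 0 := by linear_combination -e
  rcases mul_eq_zero.1 h5 with h | h
  · exact hne (by exact_mod_cast sub_eq_zero.1 h)
  · linarith

/-- For fixed `N` the polynomials are eigenvectors of the operator in `x` with distinct eigenvalues,
hence independent. -/
theorem isOrthogonalSolutionSystem_nonmonicPoly {α β γ : ℝ} (h : Admissible α β γ) :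
    IsOrthogonalSolutionSystem α β γ (nonmonicPoly α β γ) := by
  refine isOrthogonalSolutionSystem_of h (fun N => ?_) fun N k hk => appellOp_nonmonicPoly h hk
  refine Module.End.eigenvectors_linearIndependent' (jacobiOpX β γ)
    (fun k : Fin (N + 1) => -((k : ℝ) * (k + β + γ + 1)))
    (fun k l e => Fin.ext (jacobiOpX_eigen_injective h.2.1 h.2.2 e)) _ fun k => ?_
  rw [Module.End.hasEigenvector_iff, Module.End.mem_eigenspace_iff]
  refine ⟨?_, fun h0 => ?_⟩
  · rw [jacobiOpX_nonmonicPoly α h.2.2, MvPolynomial.smul_eq_C_mul]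
  · have := evalPt_nonmonicPoly_one α β γ N k
    rw [h0, evalPt_zero] at this
    exact pow_ne_zero _ two_ne_zero this.symm

theorem jacobiInt_jacobiOpX_symm {α β γ : ℝ} (h : Admissible α β γ) (p r : Poly2) :
    jacobiInt α β γ h (jacobiOpX β γ p * r) = jacobiInt α β γ h (p * jacobiOpX β γ r) := by
  have e : jacobiOpX β γ p * r - p * jacobiOpX β γ r =
      raiseX (β + 1) (γ + 1) (dX p * r - p * dX r) := by
    simp only [jacobiOpX_apply, raiseX, map_sub, dX_mul]
    ring
  have := jacobiInt_raiseX h (dX p * r - p * dX r)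
  rw [← e, map_sub] at this
  linarith

/-- Different total degrees are separated by the Appell operator; equal degrees are separated by the
symmetric operator in `x`, whose eigenvalues distinguish the second index. -/
theorem jacobiInt_nonmonicPoly_mul {α β γ : ℝ} (h : Admissible α β γ) {n m k l : ℕ} (hmn : m ≤ n)
    (hlk : l ≤ k) (hne : (n, m) ≠ (k, l)) :
    jacobiInt α β γ h (nonmonicPoly α β γ n m * nonmonicPoly α β γ k l) = 0 := by
  have deg : ∀ n m, m ≤ n → (nonmonicPoly α β γ n m).totalDegree = n := fun n m hm =>
    ((isOrthogonalSolutionSystem_nonmonicPoly h n).2 m hm).1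
  rcases lt_trichotomy n k with hlt | rfl | hlt
  · rw [mul_comm]
    exact jacobiInt_mul_eq_zero h (appellOp_nonmonicPoly h hlk) _ (by rwa [deg n m hmn])
  · have hs := jacobiInt_jacobiOpX_symm h (nonmonicPoly α β γ n m) (nonmonicPoly α β γ n l)
    rw [jacobiOpX_nonmonicPoly α h.2.2, jacobiOpX_nonmonicPoly α h.2.2, mul_left_comm, mul_assoc,
      jacobiInt_C_mul, jacobiInt_C_mul, ← sub_eq_zero, ← sub_mul] at hs
    refine (mul_eq_zero.1 hs).resolve_left fun h0 => hne ?_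
    rw [jacobiOpX_eigen_injective h.2.1 h.2.2 (sub_eq_zero.1 h0)]
  · exact jacobiInt_mul_eq_zero h (appellOp_nonmonicPoly h hmn) _ (by rwa [deg k l hlk])

theorem evalPt_homJacobi (β γ : ℝ) (m : ℕ) (x : ℝ) {y : ℝ} (hy : y ≠ -1) :
    evalPt (homJacobi β γ m) x y =
      (y + 1) ^ m * ₂F₁ (-(m : ℝ)) (β + γ + m + 1) (γ + 1) ((y - x) / (y + 1)) := by
  have hy1 : y + 1 ≠ 0 := fun h => hy (by linarith)
  rw [hypergeometric_eq_sum, homJacobi, evalPt_sum, Finset.mul_sum]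
  refine Finset.sum_congr rfl fun i hi => ?_
  obtain ⟨j, rfl⟩ : ∃ j, m = i + j := ⟨m - i, by have := Finset.mem_range.1 hi; omega⟩
  simp only [evalPt_mul, evalPt_C, evalPt_pow, evalPt_pW, evalPt_pT, Nat.add_sub_cancel_left]
  rw [pow_add, div_pow]
  field_simp

theorem evalPt_radJacobi (α β γ : ℝ) {n m : ℕ} (hmn : m ≤ n) (x y : ℝ) :
    evalPt (radJacobi α β γ n m) x y =
      ₂F₁ ((m : ℝ) - n) (α + β + γ + m + n + 2) (α + 1) ((1 - y) / 2) := by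
  rw [show (m : ℝ) - n = -((n - m : ℕ) : ℝ) by rw [Nat.cast_sub hmn]; ring,
    hypergeometric_eq_sum, radJacobi, evalPt_sum]
  refine Finset.sum_congr rfl fun i _ => ?_
  simp only [evalPt_mul, evalPt_C, evalPt_pow, evalPt_pV, div_pow]
  ring

theorem evalPt_nonmonicPoly (α β γ : ℝ) {n m : ℕ} (hmn : m ≤ n) (x : ℝ) {y : ℝ} (hy : y ≠ -1) :
    evalPt (nonmonicPoly α β γ n m) x y = jacobiJ n m α β γ x y := by
  rw [nonmonicPoly, evalPt_mul, evalPt_homJacobi β γ m x hy, evalPt_radJacobi α β γ hmn, jacobiJ]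

theorem jacobiJ_eq_jacobiP {α γ : ℝ} (hα : -1 < α) (β : ℝ) (hγ : -1 < γ) {n m : ℕ} (hmn : m ≤ n)
    (x : ℝ) {y : ℝ} (hy : y ≠ -1) :
    jacobiJ n m α β γ x y =
          (m.factorial : ℝ) * (y + 1) ^ m * ((n - m).factorial : ℝ) /
              (poch (γ + 1) m * poch (α + 1) (n - m)) *
            jacobiP m γ β ((2 * x - y + 1) / (y + 1)) *
            jacobiP (n - m) α (β + γ + 2 * m + 1) y := by
  have hy1 : y + 1 ≠ 0 := fun h => hy (by linarith)
  have e1 : (1 - (2 * x - y + 1) / (y + 1)) / 2 = (y - x) / (y + 1) := by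
    field_simp
    ring
  have h1 := (poch_pos (show 0 < γ + 1 by linarith) m).ne'
  have h2 := (poch_pos (show 0 < α + 1 by linarith) (n - m)).ne'
  rw [jacobiJ, jacobiP, jacobiP, e1, Nat.cast_sub hmn,
    show (m : ℝ) + γ + β + 1 = β + γ + m + 1 by ring,
    show (n : ℝ) - m + α + (β + γ + 2 * m + 1) + 1 = α + β + γ + m + n + 2 by ring, neg_sub]
  field_simp

/-! ### The limit of the non-monic family -/

theorem qPoch_inv_pow_eq_zero {q : ℝ} (hq : q ≠ 0) {n i : ℕ} (h : n < i) :
    qPoch (q ^ n)⁻¹ q i = 0 := by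
  refine Finset.prod_eq_zero (Finset.mem_range.2 h) ?_
  rw [inv_mul_cancel₀ (pow_ne_zero _ hq), sub_self]

/-- The coefficients of a terminating basic hypergeometric series. -/
def qHypCoeff (n : ℕ) (B C q : ℝ) (i : ℕ) : ℝ :=
  qPoch (q ^ n)⁻¹ q i * qPoch B q i / (qPoch C q i * qPoch q q i) * q ^ i

theorem phi32_eq_sum {q : ℝ} (hq : q ≠ 0) (n : ℕ) (B t C D : ℝ) :
    phi32 (q ^ n)⁻¹ B t C D q q =
      ∑ i ∈ Finset.range (n + 1), qHypCoeff n B C q i * (qPoch t q i / qPoch D q i) := by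
  rw [phi32, tsum_eq_sum (s := Finset.range (n + 1))]
  · refine Finset.sum_congr rfl fun i _ => ?_
    simp only [qHypCoeff, div_eq_mul_inv, mul_inv]
    ring
  · intro i hi
    rw [Finset.mem_range, not_lt] at hi
    rw [qPoch_inv_pow_eq_zero hq (show n < i by omega)]
    simp

/-- Two factorials above and two below vanish to order `i`, so the powers of `1-q` cancel. -/
theorem tendsto_qHypCoeff (n : ℕ) {B D : ℝ → ℝ} {b c : ℝ} (hc : 0 < c)
    (hB : ∀ᶠ q in 𝓝[<] 1, B q = q ^ b) (hD : ∀ᶠ q in 𝓝[<] 1, D q = q ^ c) (i : ℕ) :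
    Tendsto (fun q : ℝ => qHypCoeff n (B q) (D q) q i) (𝓝[<] 1) (𝓝 (hypCoeff n b c i)) := by
  have t1 := tendsto_qPoch_div (z := fun q : ℝ => (q ^ n)⁻¹) (r := -(n : ℝ)) (by
    filter_upwards [eventually_mem_Ioo] with q hq
    rw [Real.rpow_neg hq.1.le, Real.rpow_natCast]) i
  have t2 := tendsto_qPoch_div hB i
  have t3 := tendsto_qPoch_div hD i
  have t4 := tendsto_qPoch_div (z := fun q => q) (r := 1)
    (Eventually.of_forall fun q => (Real.rpow_one q).symm) i
  rw [poch_one] at t4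
  have h1 : poch c i * i.factorial ≠ 0 :=
    mul_ne_zero (poch_pos hc i).ne' (by exact_mod_cast i.factorial_ne_zero)
  have := ((t1.mul t2).div (t3.mul t4) h1).mul (tendsto_pow_nhdsLT_one i)
  rw [mul_one] at this
  refine this.congr' ?_
  filter_upwards [eventually_mem_Ioo] with q hq
  have hq1 : (1 - q) ^ i ≠ 0 := pow_ne_zero _ (by linarith [hq.2])
  simp only [Pi.div_apply, qHypCoeff]
  rw [div_mul_div_comm, div_mul_div_comm, div_div_div_cancel_right₀ (mul_ne_zero hq1 hq1)]

/-- The polynomial extension of the non-monic bivariate big `q`-Jacobi polynomials. -/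
def nonmonicQPoly (n m : ℕ) (a b c d q : ℝ) : Poly2 :=
  (∑ i ∈ Finset.range (n - m + 1),
    C (qHypCoeff (n - m) (a * (b * c * q ^ (2 * m + 1)) * q ^ (n - m + 1)) (a * q) q i /
      qPoch (d * q ^ m * q) q i) *
      ∏ j ∈ Finset.range i, (1 - MvPolynomial.X 1 * C (q ^ j))) *
  ∑ i ∈ Finset.range (m + 1), C (qHypCoeff m (c * b * q ^ (m + 1)) (c * q) q i) *
    ((∏ j ∈ Finset.range i, (MvPolynomial.X 1 - MvPolynomial.X 0 * C (q ^ j))) *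
      ∏ j ∈ Finset.Ico i m, (MvPolynomial.X 1 - C (d * q * q ^ j)))

theorem evalPt_nonmonicQPoly_factors (n m : ℕ) (a b c d q x y : ℝ) :
    evalPt (nonmonicQPoly n m a b c d q) x y =
    (∑ i ∈ Finset.range (n - m + 1),
      qHypCoeff (n - m) (a * (b * c * q ^ (2 * m + 1)) * q ^ (n - m + 1)) (a * q) q i /
        qPoch (d * q ^ m * q) q i * ∏ j ∈ Finset.range i, (1 - y * q ^ j)) *
    ∑ i ∈ Finset.range (m + 1), qHypCoeff m (c * b * q ^ (m + 1)) (c * q) q i *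
      ((∏ j ∈ Finset.range i, (y - x * q ^ j)) * ∏ j ∈ Finset.Ico i m, (y - d * q * q ^ j)) := by
  simp only [nonmonicQPoly, evalPt_mul, evalPt_sum, evalPt_prod, evalPt_C, evalPt_sub, evalPt_one,
    evalPt_X0, evalPt_X1]

/-- In the `i`-th summand the first `i` factors of `(dq/y;q)_m` cancel the denominator `(dq/y;q)_i`,
and the powers in `y^m` clear `y` from the remaining factors. The excluded values of `y` are the
zeros of `(dq/y;q)_m`, where the literal formula can divide by zero. -/
theorem evalPt_nonmonicQPoly {n m : ℕ} {a b c d q x y : ℝ} (hq : q ≠ 0) (hy : y ≠ 0)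
    (hyd : ∀ j < m, y ≠ d * q ^ (j + 1)) :
    evalPt (nonmonicQPoly n m a b c d q) x y = bivBigQJacobi n m x y a b c d q := by
  rw [evalPt_nonmonicQPoly_factors, bivBigQJacobi, bigQJacobi, bigQJacobi, phi32_eq_sum hq,
    phi32_eq_sum hq]
  refine Eq.trans ?_ (mul_assoc _ _ _).symm
  refine congrArg₂ (· * ·) ?_ ?_
  · refine Finset.sum_congr rfl fun i _ => ?_
    rw [qPoch, qPoch]
    ring
  · rw [Finset.mul_sum]
    refine Finset.sum_congr rfl fun i hi => ?_
    have hi' : i ≤ m := by have := Finset.mem_range.1 hi; omega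
    have scale : ∀ (s : Finset ℕ) (z : ℝ), ∏ j ∈ s, (y - z * q ^ j) =
        y ^ s.card * ∏ j ∈ s, (1 - z / y * q ^ j) := fun s z => by
      rw [← Finset.prod_const, ← Finset.prod_mul_distrib]
      refine Finset.prod_congr rfl fun j _ => ?_
      field_simp
    have hne : qPoch (d / y * q) q i ≠ 0 := by
      refine Finset.prod_ne_zero_iff.2 fun j hj h0 => ?_
      have hj' := Finset.mem_range.1 hj
      refine hyd j (by omega) ?_
      field_simp at h0
      rw [pow_succ]
      linear_combination h0
    have hsplit : qPoch (d * q / y) q m = qPoch (d / y * q) q i *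
        ∏ j ∈ Finset.Ico i m, (1 - d * q / y * q ^ j) := by
      rw [div_mul_eq_mul_div, qPoch, qPoch, Finset.prod_range_mul_prod_Ico _ hi']
    rw [scale, scale, Finset.card_range, Nat.card_Ico, hsplit, ← qPoch]
    obtain ⟨k, rfl⟩ : ∃ k, m = i + k := ⟨m - i, by omega⟩
    generalize qPoch (d / y * q) q i = A at hne ⊢
    rw [Nat.add_sub_cancel_left, pow_add y, mul_div_assoc']
    generalize qHypCoeff _ _ _ _ _ = K
    generalize ∏ j ∈ Finset.Ico i (i + k), (1 - d * q / y * q ^ j) = R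
    generalize qPoch (x / y) q i = S
    field_simp

theorem tendsto_nonmonicQPoly {α β γ : ℝ} (δ : ℝ) (h : Admissible α β γ) {n m : ℕ} (hmn : m ≤ n)
    (x y : ℝ) :
    Tendsto (fun q : ℝ => evalPt (nonmonicQPoly n m (q ^ α) (q ^ β) (q ^ γ) (-(q ^ δ)) q) x y)
      (𝓝[<] 1) (𝓝 (evalPt (nonmonicPoly α β γ n m) x y)) := by
  have td := (tendsto_rpow_nhdsLT_one δ).neg
  have tp := tendsto_pow_nhdsLT_one
  have rp : ∀ (r : ℝ), ∀ᶠ q : ℝ in 𝓝[<] 1, q ^ r * q = q ^ (r + 1) := fun r => by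
    filter_upwards [eventually_mem_Ioo] with q hq
    rw [Real.rpow_add hq.1, Real.rpow_one]
  have hcast : ((n - m : ℕ) : ℝ) = n - m := Nat.cast_sub hmn
  simp only [evalPt_nonmonicQPoly_factors, nonmonicPoly, evalPt_mul, homJacobi, radJacobi,
    evalPt_sum, evalPt_C, evalPt_pow, evalPt_pV, evalPt_pW, evalPt_pT]
  rw [mul_comm (∑ i ∈ Finset.range (m + 1), _)]
  refine (tendsto_finsetSum _ fun i _ => ?_).mul (tendsto_finsetSum _ fun i hi => ?_)
  · have t1 := tendsto_qHypCoeff (n - m) (b := α + β + γ + m + n + 2) (c := α + 1)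
      (B := fun q => q ^ α * (q ^ β * q ^ γ * q ^ (2 * m + 1)) * q ^ (n - m + 1))
      (by linarith [h.1]) (by
        filter_upwards [eventually_mem_Ioo] with q hq
        rw [← Real.rpow_natCast, ← Real.rpow_natCast, ← Real.rpow_add hq.1, ← Real.rpow_add hq.1,
          ← Real.rpow_add hq.1, ← Real.rpow_add hq.1]
        congr 1
        push_cast [hcast]
        ring) (rp α) i
    have t2 := tendsto_qPoch ((td.mul (tp m)).mul tendsto_id_nhdsLT_one) i
    have e2 : (1 : ℝ) - -1 * 1 * 1 = 2 := by norm_num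
    rw [e2] at t2
    exact (t1.div t2 (by positivity)).mul (tendsto_qPoch (tendsto_const_nhds (x := y)) i)
  · have t1 := tendsto_qHypCoeff m (b := β + γ + m + 1) (c := γ + 1)
      (B := fun q => q ^ γ * q ^ β * q ^ (m + 1)) (by linarith [h.2.2]) (by
        filter_upwards [eventually_mem_Ioo] with q hq
        rw [← Real.rpow_natCast, ← Real.rpow_add hq.1, ← Real.rpow_add hq.1]
        congr 1
        push_cast
        ring) (rp γ) i
    refine t1.mul (Tendsto.mul ?_ ?_)
    · have : (y - x) ^ i = ∏ j ∈ Finset.range i, (y - x * 1) := by simp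
      rw [this]
      exact tendsto_finsetProd _ fun j _ => ((tp j).const_mul x).const_sub y
    · have : (y + 1) ^ (m - i) = ∏ j ∈ Finset.Ico i m, (y - -1 * 1 * 1) := by simp
      rw [this]
      exact tendsto_finsetProd _ fun j _ =>
        ((td.mul tendsto_id_nhdsLT_one).mul (tp j)).const_sub y

theorem tendsto_bivBigQJacobi {α β γ : ℝ} (δ : ℝ) (h : Admissible α β γ) {n m : ℕ} (hmn : m ≤ n)
    (x : ℝ) {y : ℝ} (hy : y ≠ 0) (hy1 : y ≠ -1) :
    Tendsto (fun q : ℝ => bivBigQJacobi n m x y (q ^ α) (q ^ β) (q ^ γ) (-(q ^ δ)) q)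
      (𝓝[<] 1) (𝓝 (jacobiJ n m α β γ x y)) := by
  rw [← evalPt_nonmonicPoly α β γ hmn x hy1]
  refine (tendsto_nonmonicQPoly δ h hmn x y).congr' ?_
  -- The exceptional points `dq^(j+1)` are finitely many and all tend to `-1`.
  have hne : ∀ᶠ q : ℝ in 𝓝[<] 1, ∀ j ∈ Finset.range m, y ≠ -(q ^ δ) * q ^ (j + 1) := by
    rw [Filter.eventually_all_finset]
    intro j _
    have t := (tendsto_rpow_nhdsLT_one δ).neg.mul (tendsto_pow_nhdsLT_one (j + 1))
    rw [mul_one] at t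
    filter_upwards [t.eventually_ne hy1.symm] with q hq using hq.symm
  filter_upwards [eventually_mem_Ioo, hne] with q hq hq'
  exact evalPt_nonmonicQPoly hq.1.ne' hy fun j hj => hq' j (Finset.mem_range.2 hj)

/-! ### The Rodrigues family -/

/-- The polynomial factor in the `n`-th derivative of `u^(β+n) w^(γ+n) p` with respect to `x`. -/
def rodX : ℝ → ℝ → ℕ → Poly2 → Poly2
  | _, _, 0, p => p
  | β, γ, n + 1, p => raiseX (β + 1) (γ + 1) (rodX (β + 1) (γ + 1) n p)

/-- The polynomial factor in the `m`-th derivative of `v^(α+m) w^(γ+m) p` with respect to `y`. -/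
def rodY : ℝ → ℝ → ℕ → Poly2 → Poly2
  | _, _, 0, p => p
  | α, γ, m + 1, p => raiseY (α + 1) (γ + 1) (rodY (α + 1) (γ + 1) m p)

/-- The polynomials given by the Rodrigues formula. -/
def rodriguesPoly (α β γ : ℝ) (n m : ℕ) : Poly2 := rodX β γ n (rodY α (γ + n) m 1)

theorem add_cast_succ (r : ℝ) (n : ℕ) : r + ((n + 1 : ℕ) : ℝ) = r + 1 + n := by
  push_cast
  ring

/-- The first `n` derivatives are governed by the parameters `β+1`, `γ+1` and leave a polynomial
times the weight with these exponents; the last derivative is then one application of `raiseX`. The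
identity is needed on an interval around the point in order to be differentiated. -/
theorem iteratedDeriv_rodX (α : ℝ) (n : ℕ) (β γ : ℝ) (p : Poly2) {x y : ℝ} (hx : -1 < x)
    (hxy : x < y) : iteratedDeriv n (fun s => (1 - y) ^ α * (s + 1) ^ (β + n) *
      (y - s) ^ (γ + n) * evalPt p s y) x = evalPt (rodX β γ n p) x y * jacobiWeight α β γ x y := by
  induction n generalizing β γ x with
  | zero =>
    simp only [iteratedDeriv_zero, rodX, jacobiWeight, Nat.cast_zero, add_zero]
    ring
  | succ n ih =>
    rw [iteratedDeriv_succ, rodX, ← (hasDerivAt_raiseX α β γ _ hx hxy).deriv]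
    refine Filter.EventuallyEq.deriv_eq ?_
    filter_upwards [Ioo_mem_nhds hx hxy] with s hs
    simp only [add_cast_succ]
    rw [ih (β + 1) (γ + 1) hs.1 hs.2, jacobiWeight]
    ring

theorem iteratedDeriv_rodY (β : ℝ) (m : ℕ) (α γ : ℝ) (p : Poly2) {x y : ℝ} (hxy : x < y)
    (hy : y < 1) : iteratedDeriv m (fun t => (1 - t) ^ (α + m) * (x + 1) ^ β *
      (t - x) ^ (γ + m) * evalPt p x t) y = evalPt (rodY α γ m p) x y * jacobiWeight α β γ x y := by
  induction m generalizing α γ y with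
  | zero =>
    simp only [iteratedDeriv_zero, rodY, jacobiWeight, Nat.cast_zero, add_zero]
    ring
  | succ m ih =>
    rw [iteratedDeriv_succ, rodY, ← (hasDerivAt_raiseY α β γ _ hxy hy).deriv]
    refine Filter.EventuallyEq.deriv_eq ?_
    filter_upwards [Ioo_mem_nhds hxy hy] with t ht
    simp only [add_cast_succ]
    rw [ih (α + 1) (γ + 1) ht.1 ht.2, jacobiWeight]
    ring

theorem evalPt_rodriguesPoly (α β γ : ℝ) (n m : ℕ) {x y : ℝ} (hx : -1 < x) (hxy : x < y)
    (hy : y < 1) : evalPt (rodriguesPoly α β γ n m) x y = rodriguesJacobi n m α β γ x y := by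
  have hw : jacobiWeight α β γ x y ≠ 0 := by
    have h1 := Real.rpow_pos_of_pos (show 0 < 1 - y by linarith) α
    have h2 := Real.rpow_pos_of_pos (show 0 < x + 1 by linarith) β
    have h3 := Real.rpow_pos_of_pos (show 0 < y - x by linarith) γ
    rw [jacobiWeight]
    positivity
  -- The `y`-derivatives are performed first, while the exponents `β+n` and `γ+n` are still raised
  -- on account of the later `x`-derivatives.
  have e := iteratedDeriv_rodX α n β γ (rodY α (γ + n) m 1) hx hxy
  rw [rodriguesJacobi, one_div, inv_mul_eq_div, eq_div_iff hw, rodriguesPoly, ← e]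
  refine Filter.EventuallyEq.iteratedDeriv_eq n ?_
  filter_upwards [Ioo_mem_nhds hx hxy] with s hs
  have e' := iteratedDeriv_rodY (β + n) m α (γ + n) 1 hs.2 hy
  rw [jacobiWeight] at e'
  rw [mul_comm _ (evalPt _ s y), ← e']
  congr 1
  funext t
  rw [evalPt_one]
  ring

/-- An intertwining relation: it carries solutions of index `N` for `(α, β+1, γ+1)` to solutions of
index `N+1` for `(α, β, γ)`. The constant `α+β+γ+3` is the difference of the two eigenvalues,
independent of `N`. -/
theorem appellOp_raiseX (α β γ : ℝ) (p : Poly2) :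
    appellOp α β γ (raiseX (β + 1) (γ + 1) p) = raiseX (β + 1) (γ + 1) (appellOp α (β + 1) (γ + 1) p)
      + C (α + β + γ + 3) * raiseX (β + 1) (γ + 1) p := by
  have hX : ∀ p r : Poly2, dX (p + r) = dX p + dX r := fun p r => map_add _ p r
  have hY : ∀ p r : Poly2, dY (p + r) = dY p + dY r := fun p r => map_add _ p r
  have hX' : ∀ p r : Poly2, dX (p - r) = dX p - dX r := fun p r => map_sub _ p r
  have hY' : ∀ p r : Poly2, dY (p - r) = dY p - dY r := fun p r => map_sub _ p r
  have h0 : dX (0 : Poly2) = 0 := map_zero _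
  have h0' : dY (0 : Poly2) = 0 := map_zero _
  have h1 : dX (1 : Poly2) = 0 := by simp
  have h1' : dY (1 : Poly2) = 0 := by simp
  simp only [appellOp_apply, raiseX, pW_eq, hX, hY, hX', hY', dX_mul, dY_mul, dX_C, dY_C, dX_pU,
    dY_pU, dX_pV, dY_pV, dX_two, dY_two, h0, h0', h1, h1', dY_dX, dX_neg, dY_neg]
  simp only [map_add, map_mul, C_two, C_three, map_one]
  ring

theorem appellOp_raiseY (α β γ : ℝ) (p : Poly2) :
    appellOp α β γ (raiseY (α + 1) (γ + 1) p) = raiseY (α + 1) (γ + 1) (appellOp (α + 1) β (γ + 1) p)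
      + C (α + β + γ + 3) * raiseY (α + 1) (γ + 1) p := by
  have hX : ∀ p r : Poly2, dX (p + r) = dX p + dX r := fun p r => map_add _ p r
  have hY : ∀ p r : Poly2, dY (p + r) = dY p + dY r := fun p r => map_add _ p r
  have hX' : ∀ p r : Poly2, dX (p - r) = dX p - dX r := fun p r => map_sub _ p r
  have hY' : ∀ p r : Poly2, dY (p - r) = dY p - dY r := fun p r => map_sub _ p r
  have h0 : dX (0 : Poly2) = 0 := map_zero _
  have h0' : dY (0 : Poly2) = 0 := map_zero _
  have h1 : dX (1 : Poly2) = 0 := by simp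
  have h1' : dY (1 : Poly2) = 0 := by simp
  simp only [appellOp_apply, raiseY, pW_eq, hX, hY, hX', hY', dX_mul, dY_mul, dX_C, dY_C, dX_pU,
    dY_pU, dX_pV, dY_pV, dX_two, dY_two, h0, h0', h1, h1', dY_dX, dX_neg, dY_neg]
  simp only [map_add, map_mul, C_two, C_three, map_one]
  ring

theorem raiseX_C_mul (β γ c : ℝ) (p : Poly2) : raiseX β γ (C c * p) = C c * raiseX β γ p := by
  rw [raiseX, raiseX, dX_C_mul]
  ring

theorem raiseY_C_mul (α γ c : ℝ) (p : Poly2) : raiseY α γ (C c * p) = C c * raiseY α γ p := by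
  rw [raiseY, raiseY, dY_C_mul]
  ring

theorem appellOp_rodX (α : ℝ) (n : ℕ) (β γ : ℝ) (N : ℕ) (p : Poly2)
    (hp : appellOp α (β + n) (γ + n) p = C (appellEigen α (β + n) (γ + n) N) * p) :
    appellOp α β γ (rodX β γ n p) = C (appellEigen α β γ (N + n)) * rodX β γ n p := by
  induction n generalizing β γ with
  | zero => simpa [rodX] using hp
  | succ n ih =>
    simp only [add_cast_succ] at hp
    rw [rodX, appellOp_raiseX, ih _ _ hp, raiseX_C_mul, ← add_mul, ← map_add]
    congr 2
    simp only [appellEigen]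
    push_cast
    ring

theorem appellOp_rodY (β : ℝ) (m : ℕ) (α γ : ℝ) :
    appellOp α β γ (rodY α γ m 1) = C (appellEigen α β γ m) * rodY α γ m 1 := by
  induction m generalizing α γ with
  | zero =>
    have := appellOp_C α β γ 1
    rw [map_one] at this
    simp [rodY, this, appellEigen]
  | succ n ih =>
    rw [rodY, appellOp_raiseY, ih, raiseY_C_mul, ← add_mul, ← map_add]
    congr 2
    simp only [appellEigen]
    push_cast
    ring

theorem appellOp_rodriguesPoly (α β γ : ℝ) (n m : ℕ) : appellOp α β γ (rodriguesPoly α β γ n m) =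
    C (appellEigen α β γ (n + m)) * rodriguesPoly α β γ n m := by
  rw [rodriguesPoly, appellOp_rodX α n β γ m _ (appellOp_rodY (β + n) m α (γ + n)), add_comm m n]

/-! ### Independence of the Rodrigues family -/

theorem jacobiInt_congr {α β γ α' β' γ' : ℝ} (h : Admissible α β γ) (h' : Admissible α' β' γ')
    (eα : α = α') (eβ : β = β') (eγ : γ = γ') (p : Poly2) :
    jacobiInt α β γ h p = jacobiInt α' β' γ' h' p := by
  subst eα eβ eγ
  rfl

/-- The sides of the triangle are null sets, so the integrands need only be compared in the
interior, where real powers obey the usual rules. -/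
theorem jacobiInt_congr_ae {α β γ α' β' γ' : ℝ} (h : Admissible α β γ) (h' : Admissible α' β' γ')
    {p r : Poly2} (e : ∀ x y, -1 < x → x < y → y < 1 →
      evalPt p x y * jacobiWeight α β γ x y = evalPt r x y * jacobiWeight α' β' γ' x y) :
    jacobiInt α β γ h p = jacobiInt α' β' γ' h' r := by
  have hm := isCompact_triangle.isClosed.measurableSet
  have e1 : ∀ᵐ z : ℝ × ℝ, z.1 ≠ -1 := by
    have := (Measure.quasiMeasurePreserving_fst (μ := (volume : Measure ℝ))
      (ν := (volume : Measure ℝ))).ae (p := fun x => x ≠ -1) (Measure.ae_ne volume (-1))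
    exact this
  have e2 : ∀ᵐ z : ℝ × ℝ, z.2 ≠ 1 := by
    have := (Measure.quasiMeasurePreserving_snd (μ := (volume : Measure ℝ))
      (ν := (volume : Measure ℝ))).ae (p := fun x => x ≠ 1) (Measure.ae_ne volume 1)
    exact this
  have e3 : ∀ᵐ z : ℝ × ℝ, z.1 ≠ z.2 := by
    rw [ae_iff]
    simp only [ne_eq, not_not]
    rw [Measure.volume_eq_prod, Measure.measure_prod_null (measurableSet_eq_fun measurable_fst
      measurable_snd)]
    refine Eventually.of_forall fun x => ?_
    have : Prod.mk x ⁻¹' {z : ℝ × ℝ | z.1 = z.2} = {x} := by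
      ext t
      simp [eq_comm]
    simp only [Pi.zero_apply]
    rw [this, measure_singleton]
  rw [jacobiInt_apply, jacobiInt_apply]
  refine integral_congr_ae ((ae_restrict_iff' hm).2 ?_)
  filter_upwards [e1, e2, e3] with z h1 h2 h3 hz
  obtain ⟨g1, g2, g3, g4⟩ := hz
  exact e z.1 z.2 (lt_of_le_of_ne g3 h1.symm) (lt_of_le_of_ne g1 h3) (lt_of_le_of_ne g2 h2)

theorem Admissible.addX {α β γ : ℝ} (h : Admissible α β γ) (n : ℕ) :
    Admissible α (β + n) (γ + n) := by
  have : (0 : ℝ) ≤ n := n.cast_nonneg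
  exact ⟨h.1, by linarith [h.2.1], by linarith [h.2.2]⟩

theorem Admissible.addY {α β γ : ℝ} (h : Admissible α β γ) (n : ℕ) :
    Admissible (α + n) β (γ + n) := by
  have : (0 : ℝ) ≤ n := n.cast_nonneg
  exact ⟨by linarith [h.1], h.2.1, by linarith [h.2.2]⟩

theorem Admissible.succX {α β γ : ℝ} (h : Admissible α β γ) : Admissible α (β + 1) (γ + 1) := by
  simpa using h.addX 1

theorem Admissible.succY {α β γ : ℝ} (h : Admissible α β γ) : Admissible (α + 1) β (γ + 1) := by
  simpa using h.addY 1

/-- The adjoint of `raiseX` is `-∂x` for the weight with raised parameters: the product `uw` left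
over by Leibniz' rule is absorbed into the exponents. -/
theorem jacobiInt_raiseX_mul {α β γ : ℝ} (h : Admissible α β γ) (p r : Poly2) :
    jacobiInt α β γ h (raiseX (β + 1) (γ + 1) p * r) =
      -jacobiInt α (β + 1) (γ + 1) h.succX (p * dX r) := by
  have e1 : jacobiInt α β γ h (pU * pW * (p * dX r)) =
      jacobiInt α (β + 1) (γ + 1) h.succX (p * dX r) := by
    refine jacobiInt_congr_ae _ _ fun x y hx hxy hy => ?_
    simp only [evalPt_mul, evalPt_pU, evalPt_pW, jacobiWeight,
      Real.rpow_add (show 0 < x + 1 by linarith), Real.rpow_add (show 0 < y - x by linarith),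
      Real.rpow_one]
    ring
  have e2 : raiseX (β + 1) (γ + 1) p * r =
      raiseX (β + 1) (γ + 1) (p * r) - pU * pW * (p * dX r) := by
    simp only [raiseX, dX_mul]
    ring
  rw [e2, map_sub, jacobiInt_raiseX, e1, zero_sub]

theorem jacobiInt_raiseY_mul {α β γ : ℝ} (h : Admissible α β γ) (p r : Poly2) :
    jacobiInt α β γ h (raiseY (α + 1) (γ + 1) p * r) =
      -jacobiInt (α + 1) β (γ + 1) h.succY (p * dY r) := by
  have e1 : jacobiInt α β γ h (pV * pW * (p * dY r)) =
      jacobiInt (α + 1) β (γ + 1) h.succY (p * dY r) := by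
    refine jacobiInt_congr_ae _ _ fun x y hx hxy hy => ?_
    simp only [evalPt_mul, evalPt_pV, evalPt_pW, jacobiWeight,
      Real.rpow_add (show 0 < 1 - y by linarith), Real.rpow_add (show 0 < y - x by linarith),
      Real.rpow_one]
    ring
  have e2 : raiseY (α + 1) (γ + 1) p * r =
      raiseY (α + 1) (γ + 1) (p * r) - pV * pW * (p * dY r) := by
    simp only [raiseY, dY_mul]
    ring
  rw [e2, map_sub, jacobiInt_raiseY, e1, zero_sub]

theorem jacobiInt_rodX_mul (n : ℕ) {α β γ : ℝ} (h : Admissible α β γ) (p r : Poly2) :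
    jacobiInt α β γ h (rodX β γ n p * r) =
      (-1) ^ n * jacobiInt α (β + n) (γ + n) (h.addX n) (p * dX^[n] r) := by
  induction n generalizing β γ r with
  | zero =>
    simp [rodX]
  | succ n ih =>
    rw [rodX, jacobiInt_raiseX_mul, ih, Function.iterate_succ_apply, pow_succ,
      jacobiInt_congr (h.succX.addX n) (h.addX (n + 1)) rfl (add_cast_succ β n).symm
        (add_cast_succ γ n).symm]
    ring

theorem jacobiInt_rodY_mul (m : ℕ) {α β γ : ℝ} (h : Admissible α β γ) (p r : Poly2) :
    jacobiInt α β γ h (rodY α γ m p * r) =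
      (-1) ^ m * jacobiInt (α + m) β (γ + m) (h.addY m) (p * dY^[m] r) := by
  induction m generalizing α γ r with
  | zero =>
    simp [rodY]
  | succ n ih =>
    rw [rodY, jacobiInt_raiseY_mul, ih, Function.iterate_succ_apply, pow_succ,
      jacobiInt_congr (h.succY.addY n) (h.addY (n + 1)) (add_cast_succ α n).symm rfl
        (add_cast_succ γ n).symm]
    ring

theorem iterate_dX_monomial (n i : ℕ) (r : Poly2) (hr : dX r = 0) :
    dX^[n] (MvPolynomial.X 0 ^ i * r) =
      C (i.descFactorial n : ℝ) * (MvPolynomial.X 0 ^ (i - n) * r) := by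
  induction n with
  | zero => simp
  | succ n ih =>
    have h1 : dX (MvPolynomial.X 0) = 1 := by simp [MvPolynomial.pderiv_X]
    rw [Function.iterate_succ_apply', ih, dX_C_mul, dX_mul, dX_pow, hr, h1,
      Nat.descFactorial_succ, Nat.sub_sub, Nat.cast_mul, map_mul]
    ring

theorem iterate_dY_monomial (n i : ℕ) (r : Poly2) (hr : dY r = 0) :
    dY^[n] (MvPolynomial.X 1 ^ i * r) =
      C (i.descFactorial n : ℝ) * (MvPolynomial.X 1 ^ (i - n) * r) := by
  induction n with
  | zero => simp
  | succ n ih =>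
    have h1 : dY (MvPolynomial.X 1) = 1 := by simp [MvPolynomial.pderiv_X]
    rw [Function.iterate_succ_apply', ih, dY_C_mul, dY_mul, dY_pow, hr, h1,
      Nat.descFactorial_succ, Nat.sub_sub, Nat.cast_mul, map_mul]
    ring

theorem iterate_dY_C_mul (n : ℕ) (c : ℝ) (r : Poly2) : dY^[n] (C c * r) = C c * dY^[n] r := by
  induction n with
  | zero => rfl
  | succ n ih => rw [Function.iterate_succ_apply', Function.iterate_succ_apply', ih, dY_C_mul]

/-- Moving all derivatives to the monomial gives `∂x^n ∂y^m (x^i y^j)`. For `i+j = n+m` it vanishes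
unless `i = n`, and then it is `n! m!` times a positive integral. The pairing matrix in degree `N`
is therefore diagonal and invertible. -/
theorem jacobiInt_rodriguesPoly_mul {α β γ : ℝ} (h : Admissible α β γ) {n m i j : ℕ}
    (hij : i + j = n + m) : jacobiInt α β γ h (rodriguesPoly α β γ n m *
      (MvPolynomial.X 0 ^ i * MvPolynomial.X 1 ^ j)) ≠ 0 ↔ i = n := by
  have hr : dX ((MvPolynomial.X 1 : Poly2) ^ j) = 0 := by
    have h1 : dX (MvPolynomial.X 1) = 0 := by simp [MvPolynomial.pderiv_X]
    rw [dX_pow, h1, mul_zero]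
  have hr' : dY ((MvPolynomial.X 0 : Poly2) ^ (i - n)) = 0 := by
    have h1 : dY (MvPolynomial.X 0) = 0 := by simp [MvPolynomial.pderiv_X]
    rw [dY_pow, h1, mul_zero]
  rw [rodriguesPoly, jacobiInt_rodX_mul, jacobiInt_rodY_mul, iterate_dX_monomial _ _ _ hr,
    iterate_dY_C_mul, mul_comm (MvPolynomial.X 0 ^ (i - n)), iterate_dY_monomial _ _ _ hr',
    one_mul, jacobiInt_C_mul, jacobiInt_C_mul]
  constructor
  · intro hne
    by_contra hin
    apply hne
    rcases Nat.lt_or_ge i n with hlt | hge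
    · rw [Nat.descFactorial_eq_zero_iff_lt.2 hlt]
      simp
    · rw [Nat.descFactorial_eq_zero_iff_lt.2 (show j < m by omega)]
      simp
  · rintro rfl
    obtain rfl : j = m := by omega
    simp only [Nat.sub_self, pow_zero, mul_one, Nat.descFactorial_self]
    have := jacobiInt_one_pos ((h.addX i).addY j)
    have h1 : (i.factorial : ℝ) ≠ 0 := by exact_mod_cast i.factorial_ne_zero
    have h2 : (j.factorial : ℝ) ≠ 0 := by exact_mod_cast j.factorial_ne_zero
    have h3 : ∀ k : ℕ, ((-1 : ℝ)) ^ k ≠ 0 := fun k => pow_ne_zero k (by norm_num)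
    exact mul_ne_zero (h3 _) (mul_ne_zero (h3 _) (mul_ne_zero h1 (mul_ne_zero h2 this.ne')))

theorem isOrthogonalSolutionSystem_rodriguesPoly {α β γ : ℝ} (h : Admissible α β γ) :
    IsOrthogonalSolutionSystem α β γ fun N k => rodriguesPoly α β γ (N - k) k := by
  refine isOrthogonalSolutionSystem_of h (fun N => ?_) fun N k hk => ?_
  · rw [Fintype.linearIndependent_iff]
    intro g hg k
    have hk := k.2
    have := congrArg (fun p => jacobiInt α β γ h
      (p * (MvPolynomial.X 0 ^ (N - k) * MvPolynomial.X 1 ^ (k : ℕ)))) hg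
    simp only [Finset.sum_mul, map_sum, zero_mul, map_zero, smul_mul_assoc, map_smul,
      smul_eq_mul] at this
    rw [Finset.sum_eq_single k] at this
    · refine (mul_eq_zero.1 this).resolve_right ?_
      exact (jacobiInt_rodriguesPoly_mul h rfl).2 rfl
    · intro l _ hl
      have hl' := l.2
      have hne : (l : ℕ) ≠ k := fun e => hl (Fin.ext e)
      have := mt (jacobiInt_rodriguesPoly_mul h (n := N - l) (m := l) (i := N - k) (j := k)
        (by omega)).1 (by omega)
      rw [not_not] at this
      rw [this, mul_zero]
    · simp
  · have := appellOp_rodriguesPoly α β γ (N - k) k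
    rwa [Nat.sub_add_cancel hk] at this

/-! ### Convergence of families of polynomials -/

/-- The families of polynomials built from the variables and from convergent families of
constants. -/
inductive PolyTendsto : (ℝ → Poly2) → Poly2 → Prop
  | const {c : ℝ → ℝ} {c₀ : ℝ} (h : Tendsto c (𝓝[<] 1) (𝓝 c₀)) :
      PolyTendsto (fun q => C (c q)) (C c₀)
  | var (i : Fin 2) : PolyTendsto (fun _ => MvPolynomial.X i) (MvPolynomial.X i)
  | add {p r : ℝ → Poly2} {p₀ r₀ : Poly2} (hp : PolyTendsto p p₀) (hr : PolyTendsto r r₀) :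
      PolyTendsto (fun q => p q + r q) (p₀ + r₀)
  | mul {p r : ℝ → Poly2} {p₀ r₀ : Poly2} (hp : PolyTendsto p p₀) (hr : PolyTendsto r r₀) :
      PolyTendsto (fun q => p q * r q) (p₀ * r₀)

namespace PolyTendsto

variable {p r : ℝ → Poly2} {p₀ r₀ : Poly2}

/-- Pointwise convergence is all that is finally needed. The syntactic form is kept until then
because it is stable under `q`-difference quotients. -/
theorem tendsto_evalPt (hp : PolyTendsto p p₀) (x y : ℝ) :
    Tendsto (fun q => evalPt (p q) x y) (𝓝[<] 1) (𝓝 (evalPt p₀ x y)) := by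
  induction hp with
  | const h => simpa using h
  | var i => exact tendsto_const_nhds
  | add _ _ h1 h2 => simpa using h1.add h2
  | mul _ _ h1 h2 => simpa using h1.mul h2

theorem of_eq (hp : PolyTendsto p p₀) (e : p₀ = r₀) : PolyTendsto p r₀ := e ▸ hp

theorem one : PolyTendsto (fun _ => 1) 1 := by
  simpa using const (tendsto_const_nhds (x := (1 : ℝ)))

theorem neg (hp : PolyTendsto p p₀) : PolyTendsto (fun q => -p q) (-p₀) := by
  simpa using (const (tendsto_const_nhds (x := (-1 : ℝ)))).mul hp

theorem sub (hp : PolyTendsto p p₀) (hr : PolyTendsto r r₀) :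
    PolyTendsto (fun q => p q - r q) (p₀ - r₀) := by
  simpa [sub_eq_add_neg] using hp.add hr.neg

/-- The `q`-difference quotients in the first variable. -/
theorem exists_quotient_fst (hp : PolyTendsto p p₀) : ∃ r, PolyTendsto r (dX p₀) ∧
    ∀ q x y, evalPt (p q) (q * x) y = evalPt (p q) x y + (q - 1) * x * evalPt (r q) x y := by
  induction hp with
  | const h =>
    refine ⟨_, by simpa [dX_C] using const (tendsto_const_nhds (x := (0 : ℝ))), fun q x y => ?_⟩
    simp
  | var i =>
    refine ⟨fun _ => dX (MvPolynomial.X i), ?_, fun q x y => ?_⟩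
    · fin_cases i
      · simpa [MvPolynomial.pderiv_X] using const (tendsto_const_nhds (x := (1 : ℝ)))
      · simpa [MvPolynomial.pderiv_X] using const (tendsto_const_nhds (x := (0 : ℝ)))
    · fin_cases i
      · simp [MvPolynomial.pderiv_X]
        ring
      · simp [MvPolynomial.pderiv_X]
  | @add p r p₀ r₀ _ _ h1 h2 =>
    obtain ⟨p', hp', e1⟩ := h1
    obtain ⟨r', hr', e2⟩ := h2
    refine ⟨_, by simpa using hp'.add hr', fun q x y => ?_⟩
    simp only [evalPt_add, e1, e2]
    ring
  | @mul p r p₀ r₀ hp hr h1 h2 =>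
    obtain ⟨p', hp', e1⟩ := h1
    obtain ⟨r', hr', e2⟩ := h2
    have ht : Tendsto (fun q : ℝ => q - 1) (𝓝[<] 1) (𝓝 0) := by
      simpa using tendsto_id_nhdsLT_one.sub_const 1
    -- The `q`-Leibniz rule: one factor is evaluated at `qx`, written as `r + (q-1) x r'`. The extra
    -- term disappears in the limit.
    refine ⟨_, ((hp'.mul (hr.add (((const ht).mul (var 0)).mul hr'))).add (hp.mul hr')).of_eq ?_,
      fun q x y => ?_⟩
    · rw [dX_mul, map_zero]
      ring
    simp only [evalPt_mul, evalPt_add, e1, e2, evalPt_C, evalPt_X0]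
    ring

/-- The `q`-difference quotients in the second variable. -/
theorem exists_quotient_snd (hp : PolyTendsto p p₀) : ∃ r, PolyTendsto r (dY p₀) ∧
    ∀ q x y, evalPt (p q) x (q * y) = evalPt (p q) x y + (q - 1) * y * evalPt (r q) x y := by
  induction hp with
  | const h =>
    refine ⟨_, by simpa [dY_C] using const (tendsto_const_nhds (x := (0 : ℝ))), fun q x y => ?_⟩
    simp
  | var i =>
    refine ⟨fun _ => dY (MvPolynomial.X i), ?_, fun q x y => ?_⟩
    · fin_cases i
      · simpa [MvPolynomial.pderiv_X] using const (tendsto_const_nhds (x := (0 : ℝ)))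
      · simpa [MvPolynomial.pderiv_X] using const (tendsto_const_nhds (x := (1 : ℝ)))
    · fin_cases i
      · simp [MvPolynomial.pderiv_X]
      · simp [MvPolynomial.pderiv_X]
        ring
  | @add p r p₀ r₀ _ _ h1 h2 =>
    obtain ⟨p', hp', e1⟩ := h1
    obtain ⟨r', hr', e2⟩ := h2
    refine ⟨_, by simpa using hp'.add hr', fun q x y => ?_⟩
    simp only [evalPt_add, e1, e2]
    ring
  | @mul p r p₀ r₀ hp hr h1 h2 =>
    obtain ⟨p', hp', e1⟩ := h1
    obtain ⟨r', hr', e2⟩ := h2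
    have ht : Tendsto (fun q : ℝ => q - 1) (𝓝[<] 1) (𝓝 0) := by
      simpa using tendsto_id_nhdsLT_one.sub_const 1
    refine ⟨_, ((hp'.mul (hr.add (((const ht).mul (var 1)).mul hr'))).add (hp.mul hr')).of_eq ?_,
      fun q x y => ?_⟩
    · rw [dY_mul, map_zero]
      ring
    simp only [evalPt_mul, evalPt_add, e1, e2, evalPt_C, evalPt_X1]
    ring

end PolyTendsto

/-! ### The `q`-difference operators of the Rodrigues formula -/

theorem tendsto_rpow_sub_rpow_div (r s : ℝ) :
    Tendsto (fun q : ℝ => (q ^ r - q ^ s) / (q - 1)) (𝓝[<] 1) (𝓝 (r - s)) := by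
  have := tendsto_div_sub_one ((hasDerivAt_rpow_one r).sub (hasDerivAt_rpow_one s))
  simpa using this

theorem tendsto_rpow_sub_rpow_div' {f g : ℝ → ℝ} {r s t : ℝ} (ht : r - s = t)
    (hf : ∀ q, 0 < q → f q = q ^ r) (hg : ∀ q, 0 < q → g q = q ^ s) :
    Tendsto (fun q : ℝ => (f q - g q) / (q - 1)) (𝓝[<] 1) (𝓝 t) := by
  rw [← ht]
  refine (tendsto_rpow_sub_rpow_div r s).congr' ?_
  filter_upwards [eventually_mem_Ioo] with q hq
  rw [hf q hq.1, hg q hq.1]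

/-- One step of `D_q` in `x` after the weight has been divided out. For `p = 1` the left side is a
quadratic polynomial without terms free of `x`, and the remaining coefficients are differences of
two powers of `q`; divided by `q-1` they tend to differences of exponents. The minus sign in the
limit comes from `(x+1)(x-y) = -uw`. -/
theorem exists_qRaiseX (β γ δ : ℝ) (k : ℕ) {p : ℝ → Poly2} {p₀ : Poly2} (hp : PolyTendsto p p₀) :
    ∃ r, PolyTendsto r (-raiseX (β + k + 1) (γ + k + 1) p₀) ∧
      ∀ q, 0 < q → q < 1 → ∀ x y,
        q ^ (2 * k + 2) * (q ^ γ * (y - x) * (-(q ^ δ) - q ^ β * x)) * evalPt (p q) (q * x) y -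
          (x - -(q ^ δ) * q ^ (k + 1)) * (x - q ^ γ * y * q ^ (k + 1)) * evalPt (p q) x y =
        (q - 1) * x * evalPt (r q) x y := by
  obtain ⟨p', hp', e⟩ := hp.exists_quotient_fst
  have t0 : Tendsto (fun q : ℝ => (q ^ γ * q ^ δ * q ^ (2 * k + 2) - q ^ δ * q ^ (k + 1)) / (q - 1))
      (𝓝[<] 1) (𝓝 (γ + k + 1)) := by
    refine tendsto_rpow_sub_rpow_div' (r := γ + δ + (2 * k + 2 : ℕ)) (s := δ + (k + 1 : ℕ))
      (by push_cast; ring) (fun q hq => ?_) (fun q hq => ?_)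
    · rw [Real.rpow_add hq, Real.rpow_add hq, Real.rpow_natCast]
    · rw [Real.rpow_add hq, Real.rpow_natCast]
  have t1 : Tendsto (fun q : ℝ => (q ^ β * q ^ γ * q ^ (2 * k + 2) - 1) / (q - 1))
      (𝓝[<] 1) (𝓝 (β + γ + 2 * k + 2)) := by
    refine tendsto_rpow_sub_rpow_div' (r := β + γ + (2 * k + 2 : ℕ)) (s := 0) (g := fun _ => 1)
      (by push_cast; ring) (fun q hq => ?_) (fun q hq => by simp)
    rw [Real.rpow_add hq, Real.rpow_add hq, Real.rpow_natCast]
  have t2 : Tendsto (fun q : ℝ => (q ^ γ * q ^ (k + 1) - q ^ β * q ^ γ * q ^ (2 * k + 2)) / (q - 1))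
      (𝓝[<] 1) (𝓝 (-(β + k + 1))) := by
    refine tendsto_rpow_sub_rpow_div' (r := γ + (k + 1 : ℕ)) (s := β + γ + (2 * k + 2 : ℕ))
      (by push_cast; ring) (fun q hq => ?_) (fun q hq => ?_)
    · rw [Real.rpow_add hq, Real.rpow_natCast]
    · rw [Real.rpow_add hq, Real.rpow_add hq, Real.rpow_natCast]
  have tQ : Tendsto (fun q : ℝ => q ^ (2 * k + 2) * q ^ γ) (𝓝[<] 1) (𝓝 1) := by
    simpa using (tendsto_pow_nhdsLT_one (2 * k + 2)).mul (tendsto_rpow_nhdsLT_one γ)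
  -- `hE` is the part where the coefficients are differenced, `hM` the part where `p` is; together
  -- they form the `q`-Leibniz rule.
  have hE := (((PolyTendsto.const t0).add ((PolyTendsto.const t1).mul (.var 0))).add
    ((PolyTendsto.const t2).mul (.var 1))).mul hp
  have hM := (((PolyTendsto.const tQ).mul ((PolyTendsto.var 1).sub (.var 0))).mul
    ((PolyTendsto.const (tendsto_rpow_nhdsLT_one δ).neg).sub
      ((PolyTendsto.const (tendsto_rpow_nhdsLT_one β)).mul (.var 0)))).mul hp'
  have h := hM.add hE
  refine ⟨_, h.of_eq ?_, fun q hq hq1 x y => ?_⟩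
  · simp only [raiseX, pU, pW, map_add, map_neg, map_mul, map_one, map_natCast, C_two]
    ring
  · have h1 : q - 1 ≠ 0 := by linarith
    rw [e]
    simp only [evalPt_mul, evalPt_add, evalPt_sub, evalPt_C, evalPt_X0, evalPt_X1]
    field_simp
    ring

/-- The analogous step in `y`. The power `q^(n+1)` stems from the factor of the `x`-part, which also
depends on `y`, and is responsible for the shift of `γ` by `n`. -/
theorem exists_qRaiseY (α γ : ℝ) (n k : ℕ) {p : ℝ → Poly2} {p₀ : Poly2} (hp : PolyTendsto p p₀) :
    ∃ r, PolyTendsto r (-raiseY (α + k + 1) (γ + n + k + 1) p₀) ∧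
      ∀ q, 0 < q → q < 1 → ∀ x y,
        q ^ (2 * k + 1) * (q ^ α * (1 - y) * (x - q ^ γ * y * q ^ (n + 1))) *
            evalPt (p q) x (q * y) -
          (y - q ^ α * q ^ (k + 1)) * (y - x * q ^ k) * evalPt (p q) x y =
        (q - 1) * y * evalPt (r q) x y := by
  obtain ⟨p', hp', e⟩ := hp.exists_quotient_snd
  have t0 : Tendsto (fun q : ℝ => (q ^ α * q ^ (k + 1) -
      q ^ α * q ^ γ * q ^ (n + 1) * q ^ (2 * k + 1)) / (q - 1))
      (𝓝[<] 1) (𝓝 (-(γ + n + k + 1))) := by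
    refine tendsto_rpow_sub_rpow_div' (r := α + (k + 1 : ℕ))
      (s := α + γ + (n + 1 : ℕ) + (2 * k + 1 : ℕ)) (by push_cast; ring) (fun q hq => ?_)
      (fun q hq => ?_)
    · rw [Real.rpow_add hq, Real.rpow_natCast]
    · rw [Real.rpow_add hq, Real.rpow_add hq, Real.rpow_add hq, Real.rpow_natCast,
        Real.rpow_natCast]
  have t1 : Tendsto (fun q : ℝ => (q ^ k - q ^ α * q ^ (2 * k + 1)) / (q - 1))
      (𝓝[<] 1) (𝓝 (-(α + k + 1))) := by
    refine tendsto_rpow_sub_rpow_div' (r := (k : ℕ)) (s := α + (2 * k + 1 : ℕ))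
      (by push_cast; ring) (fun q hq => ?_) (fun q hq => ?_)
    · rw [Real.rpow_natCast]
    · rw [Real.rpow_add hq, Real.rpow_natCast]
  have t2 : Tendsto (fun q : ℝ => (q ^ α * q ^ γ * q ^ (n + 1) * q ^ (2 * k + 1) - 1) / (q - 1))
      (𝓝[<] 1) (𝓝 (α + γ + 2 * k + n + 2)) := by
    refine tendsto_rpow_sub_rpow_div' (r := α + γ + (n + 1 : ℕ) + (2 * k + 1 : ℕ)) (s := 0)
      (g := fun _ => 1) (by push_cast; ring) (fun q hq => ?_) (fun q hq => by simp)
    rw [Real.rpow_add hq, Real.rpow_add hq, Real.rpow_add hq, Real.rpow_natCast,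
      Real.rpow_natCast]
  have tQ : Tendsto (fun q : ℝ => q ^ (2 * k + 1) * q ^ α) (𝓝[<] 1) (𝓝 1) := by
    simpa using (tendsto_pow_nhdsLT_one (2 * k + 1)).mul (tendsto_rpow_nhdsLT_one α)
  have tR : Tendsto (fun q : ℝ => q ^ γ * q ^ (n + 1)) (𝓝[<] 1) (𝓝 1) := by
    simpa using (tendsto_rpow_nhdsLT_one γ).mul (tendsto_pow_nhdsLT_one (n + 1))
  have hE := (((PolyTendsto.const t0).add ((PolyTendsto.const t1).mul (.var 0))).add
    ((PolyTendsto.const t2).mul (.var 1))).mul hp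
  have hM := (((PolyTendsto.const tQ).mul (PolyTendsto.one.sub (.var 1))).mul
    ((PolyTendsto.var 0).sub ((PolyTendsto.const tR).mul (.var 1)))).mul hp'
  have h := hM.add hE
  refine ⟨_, h.of_eq ?_, fun q hq hq1 x y => ?_⟩
  · simp only [raiseY, pV, pW, map_add, map_neg, map_mul, map_one, map_natCast, C_two]
    ring
  · have h1 : q - 1 ≠ 0 := by linarith
    rw [e]
    simp only [evalPt_mul, evalPt_add, evalPt_sub, evalPt_C, evalPt_X0, evalPt_X1, evalPt_one]
    field_simp
    ring

/-! ### The `q`-Pearson system -/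

section Pearson

variable {a b c d q : ℝ}

/-- Replacing `x` by `qx` removes one factor from each infinite product containing `x`. The relation
is cross-multiplied so that it stays meaningful when the Pearson quotient has a zero denominator. -/
theorem qRho_mul_fst (hq : 0 < q ∧ q < 1) (hc : c ≠ 0) (hd : d ≠ 0) {x y : ℝ} (hy : y ≠ 0)
    (h : rhoDen x y b c d q ≠ 0) (h' : rhoDen (q * x) y b c d q ≠ 0) :
    qRho (q * x) y a b c d q * ((x - d) * (x - c * y)) =
      qRho x y a b c d q * (c * (y - x) * (d - b * x)) := by
  have hN : rhoNum x y a c d q = (1 - x / d) * (1 - x / (c * y)) * rhoNum (q * x) y a c d q := by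
    rw [rhoNum, rhoNum, qPochInf_step hq (x / d), qPochInf_step hq (x / (c * y)), mul_div_assoc q,
      mul_div_assoc q]
    ring
  have hD : rhoDen x y b c d q = (1 - x / y) * (1 - b * x / d) * rhoDen (q * x) y b c d q := by
    rw [rhoDen, rhoDen, qPochInf_step hq (x / y), qPochInf_step hq (b * x / d), mul_left_comm b q,
      mul_div_assoc q, mul_div_assoc q]
    ring
  have e1 : (x - d) * (x - c * y) = c * y * d * ((1 - x / d) * (1 - x / (c * y))) := by
    field_simp
    ring
  have e2 : c * (y - x) * (d - b * x) = c * y * d * ((1 - x / y) * (1 - b * x / d)) := by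
    field_simp
  rw [qRho, qRho, div_mul_eq_mul_div, div_mul_eq_mul_div, div_eq_div_iff h' h, hN, hD, e1, e2]
  ring

theorem qRho_mul_snd (hq : 0 < q ∧ q < 1) (ha : a ≠ 0) (hc : c ≠ 0) (hd : d ≠ 0) {x y : ℝ}
    (hy : y ≠ 0) (h : rhoDen x y b c d q ≠ 0) (h' : rhoDen x (q * y) b c d q ≠ 0) :
    qRho x (q * y) a b c d q * ((y - a) * (q * y - x)) =
      qRho x y a b c d q * (a * (1 - y) * (x - c * q * y)) := by
  have hq0 := hq.1.ne'
  -- Products in `y` lose a factor under `y ↦ qy`, while those in `1/y` gain one. `K` and `L`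
  -- collect what is common to both points.
  set K := qPochInf (q * (y / a)) q * qPochInf (x / d) q * qPochInf (q * (d / y)) q *
    qPochInf (x / (c * y)) q * qPochInf (q * (y / d)) q with hK
  set L := qPochInf (q * y) q * qPochInf (x / y) q * qPochInf (b * x / d) q *
    qPochInf (q * (d / (c * y))) q * qPochInf (q * (c * y / d)) q with hL
  have n1 : rhoNum x y a c d q = (1 - y / a) * (1 - y / d) * K := by
    rw [rhoNum, qPochInf_step hq (y / a), qPochInf_step hq (y / d),
      show d * q / y = q * (d / y) by ring]
    ring
  have n2 : rhoNum x (q * y) a c d q = (1 - d / y) * (1 - x / (c * q * y)) * K := by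
    rw [rhoNum, show d * q / (q * y) = d / y by field_simp, qPochInf_step hq (d / y),
      qPochInf_step hq (x / (c * (q * y))), show q * (x / (c * (q * y))) = x / (c * y) by field_simp,
      mul_div_assoc q, mul_div_assoc q, ← mul_assoc c]
    ring
  have d1 : rhoDen x y b c d q = (1 - y) * (1 - c * y / d) * L := by
    rw [rhoDen, qPochInf_step hq y, qPochInf_step hq (c * y / d),
      show d * q / (c * y) = q * (d / (c * y)) by ring]
    ring
  have d2 : rhoDen x (q * y) b c d q = (1 - x / (q * y)) * (1 - d / (c * y)) * L := by
    rw [rhoDen, show d * q / (c * (q * y)) = d / (c * y) by field_simp,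
      qPochInf_step hq (d / (c * y)), qPochInf_step hq (x / (q * y)),
      show q * (x / (q * y)) = x / y by field_simp, mul_left_comm c q, mul_div_assoc q]
    ring
  have e : (1 - d / y) * (1 - x / (c * q * y)) * ((y - a) * (q * y - x)) *
      ((1 - y) * (1 - c * y / d)) = (1 - y / a) * (1 - y / d) * (a * (1 - y) * (x - c * q * y)) *
        ((1 - x / (q * y)) * (1 - d / (c * y))) := by
    field_simp
    ring
  rw [qRho, qRho, div_mul_eq_mul_div, div_mul_eq_mul_div, div_eq_div_iff h' h, n1, n2, d1, d2]
  linear_combination K * L * e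

variable (a c d q) in
/-- The factor of the Rodrigues formula on which the operator in the first variable acts. -/
def rodFactorX (n : ℕ) (x y : ℝ) : ℝ :=
  ∏ j ∈ Finset.range n, ((x - d * q ^ (j + 1)) * (x - c * y * q ^ (j + 1)))

variable (a q) in
/-- The factor of the Rodrigues formula on which the operator in the second variable acts. -/
def rodFactorY (m : ℕ) (x y : ℝ) : ℝ :=
  ∏ j ∈ Finset.range m, ((y - a * q ^ (j + 1)) * (y - x * q ^ j))

theorem rodFactorX_succ (n : ℕ) (x y : ℝ) : rodFactorX c d q (n + 1) x y =
    rodFactorX c d q n x y * ((x - d * q ^ (n + 1)) * (x - c * y * q ^ (n + 1))) :=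
  Finset.prod_range_succ _ _

theorem rodFactorY_succ (n : ℕ) (x y : ℝ) : rodFactorY a q (n + 1) x y =
    rodFactorY a q n x y * ((y - a * q ^ (n + 1)) * (y - x * q ^ n)) :=
  Finset.prod_range_succ _ _

theorem rodFactorX_eq (n : ℕ) {x : ℝ} (hx : x ≠ 0) (y : ℝ) : rodFactorX c d q n x y =
    x ^ (2 * n) * qPoch (d * q / x) q n * qPoch (c * q * y / x) q n := by
  induction n with
  | zero => simp [rodFactorX, qPoch]
  | succ n ih =>
    rw [rodFactorX_succ, ih, qPoch_succ, qPoch_succ]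
    generalize qPoch (d * q / x) q n = A
    generalize qPoch (c * q * y / x) q n = B
    field_simp
    ring

theorem rodFactorY_eq (n : ℕ) (x : ℝ) {y : ℝ} (hy : y ≠ 0) : rodFactorY a q n x y =
    y ^ (2 * n) * qPoch (a * q / y) q n * qPoch (x / y) q n := by
  induction n with
  | zero => simp [rodFactorY, qPoch]
  | succ n ih =>
    rw [rodFactorY_succ, ih, qPoch_succ, qPoch_succ]
    generalize qPoch (a * q / y) q n = A
    generalize qPoch (x / y) q n = B
    field_simp
    ring

/-- Scaling `x` shifts the product by one index. The new factor `(x-d)(x-cy)` is the one that the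
Pearson relation trades against the weight at `x`. -/
theorem rodFactorX_mul_fst (n : ℕ) (x y : ℝ) : rodFactorX c d q (n + 1) (q * x) y =
    q ^ (2 * n + 2) * ((x - d) * (x - c * y)) * rodFactorX c d q n x y := by
  induction n with
  | zero =>
    simp only [rodFactorX, Finset.prod_range_succ, Finset.prod_range_zero]
    ring
  | succ n ih =>
    rw [rodFactorX_succ, ih, rodFactorX_succ]
    ring

theorem rodFactorY_mul_snd (n : ℕ) (x y : ℝ) : rodFactorY a q (n + 1) x (q * y) =
    q ^ (2 * n + 1) * ((y - a) * (q * y - x)) * rodFactorY a q n x y := by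
  induction n with
  | zero =>
    simp only [rodFactorY, Finset.prod_range_succ, Finset.prod_range_zero]
    ring
  | succ n ih =>
    rw [rodFactorY_succ, ih, rodFactorY_succ]
    ring

/-- The factors linear in `y` are shifted by one index and telescope; the others do not change. -/
theorem rodFactorX_mul_snd (n : ℕ) (x y : ℝ) :
    (x - c * q * y) * rodFactorX c d q n x (q * y) =
      (x - c * y * q ^ (n + 1)) * rodFactorX c d q n x y := by
  induction n with
  | zero =>
    simp only [rodFactorX, Finset.prod_range_zero]
    ring
  | succ n ih =>
    rw [rodFactorX_succ, ← mul_assoc, ih, rodFactorX_succ]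
    ring

end Pearson

/-! ### The limit of the Rodrigues family -/

/-- The hypothesis on `f` concerns only the nodes `q^i x` reached by the iterated operator, since
the formula is meaningful only where no denominator vanishes. The index `k` counts the factors not
yet consumed, and each application of `D_q` lowers it by one at the cost of one polynomial step. -/
theorem exists_qRodX (α β γ δ : ℝ) (n k : ℕ) {p : ℝ → Poly2} {p₀ : Poly2} (hp : PolyTendsto p p₀) :
    ∃ r, PolyTendsto r (C ((-1) ^ n) * rodX (β + k) (γ + k) n p₀) ∧
      ∀ q, 0 < q → q < 1 → ∀ (f : ℝ → ℝ → ℝ) (x y : ℝ), x ≠ 0 → y ≠ 0 →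
        (∀ i ≤ n, rhoDen (q ^ i * x) y (q ^ β) (q ^ γ) (-(q ^ δ)) q ≠ 0 ∧
          f (q ^ i * x) y = qRho (q ^ i * x) y (q ^ α) (q ^ β) (q ^ γ) (-(q ^ δ)) q *
            rodFactorX (q ^ γ) (-(q ^ δ)) q (k + n) (q ^ i * x) y * evalPt (p q) (q ^ i * x) y) →
        (qDiff₁ q)^[n] f x y = qRho x y (q ^ α) (q ^ β) (q ^ γ) (-(q ^ δ)) q *
          rodFactorX (q ^ γ) (-(q ^ δ)) q k x y * evalPt (r q) x y := by
  induction n generalizing k with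
  | zero =>
    refine ⟨p, hp.of_eq (by simp [rodX]), fun q _ _ f x y _ _ h => ?_⟩
    simpa using (h 0 le_rfl).2
  | succ n ih =>
    obtain ⟨p', hp', e'⟩ := ih (k + 1)
    obtain ⟨r, hr, e⟩ := exists_qRaiseX β γ δ k hp'
    refine ⟨r, hr.of_eq ?_, fun q hq hq1 f x y hx hy h => ?_⟩
    · rw [rodX, raiseX_C_mul, ← neg_mul, ← map_neg, pow_succ, mul_neg_one]
      push_cast
      simp only [add_assoc]
    · have hqx : q * x ≠ 0 := mul_ne_zero hq.ne' hx
      have s0 := e' q hq hq1 f x y hx hy fun i hi => by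
        have := h i (by omega)
        rwa [show k + (n + 1) = k + 1 + n by ring] at this
      have s1 := e' q hq hq1 f (q * x) y hqx hy fun i hi => by
        have := h (i + 1) (by omega)
        rwa [show k + (n + 1) = k + 1 + n by ring, pow_succ, mul_assoc] at this
      have g0 := (h 0 (by omega)).1
      have g1 := (h 1 (by omega)).1
      rw [pow_zero, one_mul] at g0
      rw [pow_one] at g1
      have hρ := qRho_mul_fst (a := q ^ α) ⟨hq, hq1⟩ (Real.rpow_pos_of_pos hq γ).ne'
        (neg_ne_zero.2 (Real.rpow_pos_of_pos hq δ).ne') hy g0 g1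
      rw [Function.iterate_succ_apply', qDiff₁, qDiff, if_neg hx, s0, s1, rodFactorX_mul_fst,
        rodFactorX_succ, div_eq_iff (mul_ne_zero (by linarith) hx)]
      have e1 := e q hq hq1 x y
      generalize rodFactorX (q ^ γ) (-(q ^ δ)) q k x y = F
      -- The Pearson relation moves the weight from `qx` to `x`; the remaining polynomial identity
      -- is that of `exists_qRaiseX`.
      linear_combination q ^ (2 * k + 2) * F * evalPt (p' q) (q * x) y * hρ +
        qRho x y (q ^ α) (q ^ β) (q ^ γ) (-(q ^ δ)) q * F * e1

theorem exists_qRodY (α β γ δ : ℝ) (n m k : ℕ) :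
    ∃ r, PolyTendsto r (C ((-1) ^ m) * rodY (α + k) (γ + n + k) m 1) ∧
      ∀ q, 0 < q → q < 1 → ∀ (f : ℝ → ℝ → ℝ) (x y : ℝ), y ≠ 0 →
        (∀ i ≤ m, rhoDen x (q ^ i * y) (q ^ β) (q ^ γ) (-(q ^ δ)) q ≠ 0 ∧
          f x (q ^ i * y) = qRho x (q ^ i * y) (q ^ α) (q ^ β) (q ^ γ) (-(q ^ δ)) q *
            rodFactorX (q ^ γ) (-(q ^ δ)) q n x (q ^ i * y) *
              rodFactorY (q ^ α) q (k + m) x (q ^ i * y)) →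
        (qDiff₂ q)^[m] f x y = qRho x y (q ^ α) (q ^ β) (q ^ γ) (-(q ^ δ)) q *
          rodFactorX (q ^ γ) (-(q ^ δ)) q n x y * rodFactorY (q ^ α) q k x y *
            evalPt (r q) x y := by
  induction m generalizing k with
  | zero =>
    refine ⟨fun _ => 1, PolyTendsto.one.of_eq (by simp [rodY]), fun q _ _ f x y _ h => ?_⟩
    simpa using (h 0 le_rfl).2
  | succ m ih =>
    obtain ⟨p', hp', e'⟩ := ih (k + 1)
    obtain ⟨r, hr, e⟩ := exists_qRaiseY α γ n k hp'
    refine ⟨r, hr.of_eq ?_, fun q hq hq1 f x y hy h => ?_⟩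
    · rw [rodY, raiseY_C_mul, ← neg_mul, ← map_neg, pow_succ, mul_neg_one]
      push_cast
      simp only [add_assoc]
    · have hqy : q * y ≠ 0 := mul_ne_zero hq.ne' hy
      have s0 := e' q hq hq1 f x y hy fun i hi => by
        have := h i (by omega)
        rwa [show k + (m + 1) = k + 1 + m by ring] at this
      have s1 := e' q hq hq1 f x (q * y) hqy fun i hi => by
        have := h (i + 1) (by omega)
        rwa [show k + (m + 1) = k + 1 + m by ring, pow_succ, mul_assoc] at this
      have g0 := (h 0 (by omega)).1
      have g1 := (h 1 (by omega)).1
      rw [pow_zero, one_mul] at g0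
      rw [pow_one] at g1
      have hρ := qRho_mul_snd (a := q ^ α) ⟨hq, hq1⟩ (Real.rpow_pos_of_pos hq α).ne'
        (Real.rpow_pos_of_pos hq γ).ne' (neg_ne_zero.2 (Real.rpow_pos_of_pos hq δ).ne') hy g0 g1
      have hF := rodFactorX_mul_snd (c := q ^ γ) (d := -(q ^ δ)) (q := q) n x y
      rw [Function.iterate_succ_apply', qDiff₂, qDiff, if_neg hy, s0, s1, rodFactorY_mul_snd,
        rodFactorY_succ, div_eq_iff (mul_ne_zero (by linarith) hy)]
      have e1 := e q hq hq1 x y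
      generalize rodFactorY (q ^ α) q k x y = F
      generalize rodFactorX (q ^ γ) (-(q ^ δ)) q n x (q * y) = G' at *
      generalize rodFactorX (q ^ γ) (-(q ^ δ)) q n x y = G at *
      linear_combination q ^ (2 * k + 1) * F * G' * evalPt (p' q) x (q * y) * hρ +
        qRho x y (q ^ α) (q ^ β) (q ^ γ) (-(q ^ δ)) q * q ^ (2 * k + 1) * F *
          evalPt (p' q) x (q * y) * q ^ α * (1 - y) * hF +
        qRho x y (q ^ α) (q ^ β) (q ^ γ) (-(q ^ δ)) q * G * F * e1

theorem exists_tendsto_rodriguesPoly (α β γ δ : ℝ) (n m : ℕ) {Λ : ℝ → ℝ}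
    (hΛ : Tendsto Λ (𝓝[<] 1) (𝓝 ((-1) ^ (n + m)))) :
    ∃ p : ℝ → Poly2,
      (∀ q : ℝ, 0 < q → q < 1 → ∀ x y : ℝ,
        RodriguesRegular n m x y (q ^ α) (q ^ β) (q ^ γ) (-(q ^ δ)) q →
        evalPt (p q) x y =
          rodriguesBigQJacobi n m (Λ q) x y (q ^ α) (q ^ β) (q ^ γ) (-(q ^ δ)) q) ∧
      ∀ x y : ℝ, Tendsto (fun q => evalPt (p q) x y) (𝓝[<] 1)
        (𝓝 (evalPt (rodriguesPoly α β γ n m) x y)) := by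
  obtain ⟨r, hr, er⟩ := exists_qRodY α β γ δ n m 0
  obtain ⟨p, hp, ep⟩ := exists_qRodX α β γ δ n 0 hr
  refine ⟨_, fun q hq hq1 x y h => ?_, ((PolyTendsto.const hΛ).mul hp |>.of_eq ?_).tendsto_evalPt⟩
  · obtain ⟨hx, hy, hN, hD⟩ := h
    have hρ : qRho x y (q ^ α) (q ^ β) (q ^ γ) (-(q ^ δ)) q ≠ 0 := by
      refine div_ne_zero hN ?_
      simpa using hD 0 (Nat.zero_le n) 0 (Nat.zero_le m)
    rw [rodriguesBigQJacobi, ep q hq hq1 _ x y hx hy fun i hi => ⟨?_, ?_⟩]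
    · simp only [evalPt_mul, evalPt_C, rodFactorX, Finset.prod_range_zero, mul_one]
      field_simp
    · simpa using hD i hi 0 (Nat.zero_le m)
    · have hx' : q ^ i * x ≠ 0 := mul_ne_zero (pow_ne_zero _ hq.ne') hx
      rw [er q hq hq1 _ (q ^ i * x) y hy fun j hj => ⟨hD i hi j hj, ?_⟩]
      · simp [rodFactorY]
      · have hy' : q ^ j * y ≠ 0 := mul_ne_zero (pow_ne_zero _ hq.ne') hy
        rw [zero_add, rodFactorX_eq n hx', rodFactorY_eq m _ hy']
        ring
  -- Each of the `n+m` steps contributed a sign, which the limit of `Λ` cancels.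
  · have h1 : (-1 : ℝ) ^ (n + m) * ((-1) ^ n * (-1) ^ m) = 1 := by
      rw [← pow_add, ← mul_pow]
      norm_num
    have h2 : ∀ (n : ℕ) (β γ c : ℝ) (p : Poly2), rodX β γ n (C c * p) = C c * rodX β γ n p := by
      intro n
      induction n with
      | zero => intros; rfl
      | succ n ih =>
        intro β γ c p
        rw [rodX, ih, raiseX_C_mul, rodX]
    rw [h2, ← mul_assoc, ← mul_assoc, ← map_mul, ← map_mul, mul_assoc, h1, map_one, one_mul,
      rodriguesPoly]
    simp

/-- For `q` near `1` every argument of the infinite products is below `1`, so all of them are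
positive. -/
theorem eventually_rodriguesRegular (α β γ δ : ℝ) (n m : ℕ) {x y : ℝ} (hx : -1 < x) (hxy : x < y)
    (hy : y < 1) (hy0 : 0 < y) (hx0 : x ≠ 0) : ∀ᶠ q : ℝ in 𝓝[<] 1,
      RodriguesRegular n m x y (q ^ α) (q ^ β) (q ^ γ) (-(q ^ δ)) q := by
  have ta := tendsto_rpow_nhdsLT_one α
  have tb := tendsto_rpow_nhdsLT_one β
  have tc := tendsto_rpow_nhdsLT_one γ
  have td := (tendsto_rpow_nhdsLT_one δ).neg
  have tp := tendsto_pow_nhdsLT_one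
  have hxy1 : x / y < 1 := (div_lt_one hy0).2 hxy
  have hd : (-1 : ℝ) ≠ 0 := by norm_num
  have n1 : ∀ᶠ q : ℝ in 𝓝[<] 1, y / q ^ α < 1 :=
    (tendsto_const_nhds.div ta one_ne_zero).eventually_lt_const (by simpa using hy)
  have n2 : ∀ᶠ q : ℝ in 𝓝[<] 1, x / -(q ^ δ) < 1 :=
    (tendsto_const_nhds.div td hd).eventually_lt_const (by rw [div_neg, div_one]; linarith)
  have n4 : ∀ᶠ q : ℝ in 𝓝[<] 1, x / (q ^ γ * y) < 1 :=
    (tendsto_const_nhds.div (tc.mul_const y) (by simpa using hy0.ne')).eventually_lt_const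
      (by simpa using hxy1)
  have d1 : ∀ᶠ q : ℝ in 𝓝[<] 1, ∀ j ∈ Finset.range (m + 1), q ^ j * y < 1 := by
    rw [Filter.eventually_all_finset]
    exact fun j _ => ((tp j).mul_const y).eventually_lt_const (by simpa using hy)
  have d2 : ∀ᶠ q : ℝ in 𝓝[<] 1, ∀ i ∈ Finset.range (n + 1), ∀ j ∈ Finset.range (m + 1),
      q ^ i * x / (q ^ j * y) < 1 := by
    rw [Filter.eventually_all_finset]
    intro i _
    rw [Filter.eventually_all_finset]
    exact fun j _ => (((tp i).mul_const x).div ((tp j).mul_const y)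
      (by simpa using hy0.ne')).eventually_lt_const (by simpa using hxy1)
  have d3 : ∀ᶠ q : ℝ in 𝓝[<] 1, ∀ i ∈ Finset.range (n + 1), q ^ β * (q ^ i * x) / -(q ^ δ) < 1 := by
    rw [Filter.eventually_all_finset]
    exact fun i _ => ((tb.mul ((tp i).mul_const x)).div td hd).eventually_lt_const
      (by rw [div_neg, div_one, one_mul, one_mul]; linarith)
  filter_upwards [eventually_mem_Ioo, n1, n2, n4, d1, d2, d3] with q hq n1 n2 n4 d1 d2 d3
  have pc := Real.rpow_pos_of_pos hq.1 γ
  have pd := Real.rpow_pos_of_pos hq.1 δ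
  have lt1 : ∀ s t : ℝ, 0 < s → 0 < t → -s / t < 1 := fun s t hs ht => by
    have := div_pos hs ht
    rw [neg_div]
    linarith
  refine ⟨hx0, hy0.ne', ?_, fun i hi j hj => ?_⟩
  · have p1 := qPochInf_pos hq n1
    have p2 := qPochInf_pos hq n2
    have p3 := qPochInf_pos hq (z := -(q ^ δ) * q / y)
      (by rw [neg_mul]; exact lt1 _ _ (mul_pos pd hq.1) hy0)
    have p4 := qPochInf_pos hq n4
    have p5 := qPochInf_pos hq (z := y / -(q ^ δ))
      (by rw [div_neg, ← neg_div]; exact lt1 _ _ hy0 pd)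
    rw [rhoNum]
    positivity
  · have pj : 0 < q ^ j * y := mul_pos (pow_pos hq.1 j) hy0
    have hi' := Finset.mem_range_succ_iff.2 hi
    have hj' := Finset.mem_range_succ_iff.2 hj
    have p1 := qPochInf_pos hq (d1 j hj')
    have p2 := qPochInf_pos hq (d2 i hi' j hj')
    have p3 := qPochInf_pos hq (d3 i hi')
    have p4 := qPochInf_pos hq (z := -(q ^ δ) * q / (q ^ γ * (q ^ j * y)))
      (by rw [neg_mul]; exact lt1 _ _ (mul_pos pd hq.1) (mul_pos pc pj))
    have p5 := qPochInf_pos hq (z := q ^ γ * (q ^ j * y) / -(q ^ δ))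
      (by rw [div_neg, ← neg_div]; exact lt1 _ _ (mul_pos pc pj) pd)
    rw [rhoDen]
    positivity

theorem tendsto_rodriguesBigQJacobi (α β γ δ : ℝ) (n m : ℕ) {Λ : ℝ → ℝ}
    (hΛ : Tendsto Λ (𝓝[<] 1) (𝓝 ((-1) ^ (n + m)))) {x y : ℝ} (hx : -1 < x) (hxy : x < y)
    (hy : y < 1) (hy0 : 0 < y) (hx0 : x ≠ 0) :
    Tendsto (fun q : ℝ =>
        rodriguesBigQJacobi n m (Λ q) x y (q ^ α) (q ^ β) (q ^ γ) (-(q ^ δ)) q)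
      (𝓝[<] 1) (𝓝 (rodriguesJacobi n m α β γ x y)) := by
  obtain ⟨p, hp, ht⟩ := exists_tendsto_rodriguesPoly α β γ δ n m hΛ
  rw [← evalPt_rodriguesPoly α β γ n m hx hxy hy]
  refine (ht x y).congr' ?_
  filter_upwards [eventually_mem_Ioo,
    eventually_rodriguesRegular α β γ δ n m hx hxy hy hy0 hx0] with q hq hr
  exact hp q hq.1 hq.2 x y hr

end

/-! ### Assembly of the limit relations -/

theorem mainTheorem10 (α β γ δ : ℝ) (hα : -1 < α) (hβ : -1 < β) (hγ : -1 < γ) :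
    -- the equation
    (∀ (N : ℕ) (f : ℝ → ℝ → ℝ) (x y : ℝ), ContDiffAt ℝ 2 (Function.uncurry f) (x, y) →
      Tendsto (fun q : ℝ => qEquation N (q ^ α) (q ^ β) (q ^ γ) (-(q ^ δ)) q f x y)
        (𝓝[<] 1) (𝓝 (appellEquation N α β γ f x y))) ∧
    -- the weight, pointwise
    (∀ x y : ℝ, -1 < x → x < y → y < 1 → 0 < y →
      Tendsto (fun q : ℝ => qWeight x y (q ^ α) (q ^ β) (q ^ γ) (-(q ^ δ)) q)
        (𝓝[<] 1) (𝓝 (jacobiWeight α β γ x y))) ∧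
    -- the weight, along the nodes `(d q^(l+1), d q^(k+1))` of the double `q`-integral
    (∀ x y : ℝ, -1 < x → x < y → y ≤ 0 → ∀ k l : ℝ → ℕ,
      Tendsto (fun q : ℝ => -(q ^ δ) * q ^ (l q + 1)) (𝓝[<] 1) (𝓝 x) →
      Tendsto (fun q : ℝ => -(q ^ δ) * q ^ (k q + 1)) (𝓝[<] 1) (𝓝 y) →
      ∃ w : ℝ → ℝ,
        (∀ᶠ q : ℝ in 𝓝[<] 1,
          Tendsto (fun t : ℝ => qWeight (-(q ^ δ) * q ^ (l q + 1)) t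
              (q ^ α) (q ^ β) (q ^ γ) (-(q ^ δ)) q)
            (𝓝[≠] (-(q ^ δ) * q ^ (k q + 1))) (𝓝 (w q))) ∧
        Tendsto w (𝓝[<] 1) (𝓝 (jacobiWeight α β γ x y))) ∧
    -- the monic family
    (∃ A : ℕ → ℕ → MvPolynomial (Fin 2) ℝ,
      (∀ (n m : ℕ) (x y : ℝ), evalPt (A n m) x y = monicJacobi n m α β γ x y) ∧
      (∀ (n m : ℕ) (s : Fin 2 →₀ ℕ), n + m ≤ s 0 + s 1 →
        (A n m).coeff s = if s 0 = n ∧ s 1 = m then 1 else 0) ∧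
      IsOrthogonalSolutionSystem α β γ (fun N k => A (N - k) k) ∧
      ∀ (n m : ℕ) (x y : ℝ),
        Tendsto (fun q : ℝ => monicBigQJacobi n m x y (q ^ α) (q ^ β) (q ^ γ) (-(q ^ δ)) q)
          (𝓝[<] 1) (𝓝 (monicJacobi n m α β γ x y))) ∧
    -- the non-monic family
    (∃ J : ℕ → ℕ → MvPolynomial (Fin 2) ℝ,
      (∀ n m : ℕ, m ≤ n → ∀ x y : ℝ, y ≠ -1 →
        evalPt (J n m) x y = jacobiJ n m α β γ x y ∧
        jacobiJ n m α β γ x y =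
          (m.factorial : ℝ) * (y + 1) ^ m * ((n - m).factorial : ℝ) /
              (poch (γ + 1) m * poch (α + 1) (n - m)) *
            jacobiP m γ β ((2 * x - y + 1) / (y + 1)) *
            jacobiP (n - m) α (β + γ + 2 * m + 1) y) ∧
      IsOrthogonalSolutionSystem α β γ J ∧
      (∀ n m k l : ℕ, m ≤ n → l ≤ k → (n, m) ≠ (k, l) →
        ∫ z in triangle, evalPt (J n m) z.1 z.2 * evalPt (J k l) z.1 z.2 *
          jacobiWeight α β γ z.1 z.2 = 0) ∧
      ∀ n m : ℕ, m ≤ n →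
        (∀ x y : ℝ, y ≠ 0 → y ≠ -1 →
          Tendsto (fun q : ℝ => bivBigQJacobi n m x y (q ^ α) (q ^ β) (q ^ γ) (-(q ^ δ)) q)
            (𝓝[<] 1) (𝓝 (jacobiJ n m α β γ x y))) ∧
        ∃ p : ℝ → MvPolynomial (Fin 2) ℝ,
          (∀ q : ℝ, 0 < q → q < 1 → ∀ x y : ℝ, y ≠ 0 →
            (∀ j < m, y ≠ -(q ^ δ) * q ^ (j + 1)) →
            evalPt (p q) x y =
              bivBigQJacobi n m x y (q ^ α) (q ^ β) (q ^ γ) (-(q ^ δ)) q) ∧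
          ∀ x y : ℝ, Tendsto (fun q => evalPt (p q) x y) (𝓝[<] 1) (𝓝 (evalPt (J n m) x y))) ∧
    -- the Rodrigues family
    (∃ T : ℕ → ℕ → MvPolynomial (Fin 2) ℝ,
      (∀ (n m : ℕ) (x y : ℝ), -1 < x → x < y → y < 1 →
        evalPt (T n m) x y = rodriguesJacobi n m α β γ x y) ∧
      IsOrthogonalSolutionSystem α β γ (fun N k => T (N - k) k) ∧
      ∀ (n m : ℕ) (Λ : ℝ → ℝ), Tendsto Λ (𝓝[<] 1) (𝓝 ((-1) ^ (n + m))) →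
        (∀ x y : ℝ, -1 < x → x < y → y < 1 → 0 < y → x ≠ 0 →
          Tendsto (fun q : ℝ =>
              rodriguesBigQJacobi n m (Λ q) x y (q ^ α) (q ^ β) (q ^ γ) (-(q ^ δ)) q)
            (𝓝[<] 1) (𝓝 (rodriguesJacobi n m α β γ x y))) ∧
        ∃ p : ℝ → MvPolynomial (Fin 2) ℝ,
          (∀ q : ℝ, 0 < q → q < 1 → ∀ x y : ℝ,
            RodriguesRegular n m x y (q ^ α) (q ^ β) (q ^ γ) (-(q ^ δ)) q →
            evalPt (p q) x y =
              rodriguesBigQJacobi n m (Λ q) x y (q ^ α) (q ^ β) (q ^ γ) (-(q ^ δ)) q) ∧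
          ∀ x y : ℝ, Tendsto (fun q => evalPt (p q) x y) (𝓝[<] 1) (𝓝 (evalPt (T n m) x y))) := by
  have h : Admissible α β γ := ⟨hα, hβ, hγ⟩
  refine ⟨tendsto_qEquation α β γ δ, tendsto_qWeight α β γ δ,
    fun x y hx hxy hy k l hl hk => tendsto_qWeight_nodes α β γ δ hβ hγ x y hx hxy hy k l hl hk,
    ⟨monicPoly α β γ, evalPt_monicPoly α β γ, coeff_monicPoly h,
      isOrthogonalSolutionSystem_monicPoly h, tendsto_monicBigQJacobi δ h⟩,
    ⟨nonmonicPoly α β γ, fun n m hmn x y hy => ⟨evalPt_nonmonicPoly α β γ hmn x hy,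
        jacobiJ_eq_jacobiP hα β hγ hmn x hy⟩,
      isOrthogonalSolutionSystem_nonmonicPoly h, fun n m k l hmn hlk hne => ?_,
      fun n m hmn => ⟨fun x y hy hy1 => tendsto_bivBigQJacobi δ h hmn x hy hy1,
        fun q => nonmonicQPoly n m (q ^ α) (q ^ β) (q ^ γ) (-(q ^ δ)) q,
        fun q hq _ x y hy hyd => evalPt_nonmonicQPoly hq.ne' hy hyd,
        tendsto_nonmonicQPoly δ h hmn⟩⟩,
    ⟨rodriguesPoly α β γ, fun n m x y => evalPt_rodriguesPoly α β γ n m,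
      isOrthogonalSolutionSystem_rodriguesPoly h, fun n m Λ hΛ =>
        ⟨fun x y hx hxy hy hy0 hx0 =>
          tendsto_rodriguesBigQJacobi α β γ δ n m hΛ hx hxy hy hy0 hx0,
        exists_tendsto_rodriguesPoly α β γ δ n m hΛ⟩⟩⟩
  have := jacobiInt_nonmonicPoly_mul h hmn hlk hne
  simpa [jacobiInt_apply] using this
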